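/- **Theorem (Algebraicity of simple whirls).** *Rectangulations.* A rectangulation of size $n$ is a tiling of a rectangle $R$ by $n$ axis-parallel rectangles such that no four of them meet in a point. Two rectangulations are equivalent (strongly equivalent) if there is a bijection between their rectangles that preserves adjacency along a side piece of positive length together with its direction (left/right, below/above); rectangulations are counted up to equivalence. A segment is a maximal line segment contained in the union of the sides of the rectangles. A segment has a *tick* on one of its two sides if a perpendicular segment lying on that side ends at an inner point of it. *Patterns.* A *windmill* consists of four segments containing the four sides of a rectangle (its *interior*) such that the upper one continues to the right of the interior, the right one downwards, the lower one to the left, and the left one upwards, and each of them starts at an inner point of another of them (the upper at the left one, the right at the upper one, the lower at the right one, the left at the lower one). A *block* is a rectangle that is a union of rectangles of the rectangulation. A *whirl* is a rectangulation that contains a windmill but none of the following: the mirror image of a windmill; a vertical segment with ticks on its left and on its right; a horizontal segment with ticks above and below; a block such that the segment containing its left side has a tick on the left and the segment containing its right side has a tick on the right; a block such that the segment containing its lower side has a tick below and the segment containing its upper side has a tick above. A whirl is *peelable* if one of its rectangles extends from the left to the right side or from the top to the bottom of $R$. A *simple whirl* is a non-peelable whirl with exactly one windmill, whose interior is a single rectangle.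 *Colours.* In a simple whirl, let $P_{SE}$ be the path that starts at the upper endpoint of the right segment of the windmill, and alternately goes along segments (including the sides of $R$) down to their lower endpoint and right to their right endpoint, until it reaches the south-eastern corner of $R$; let $P_{SW}, P_{NW}, P_{NE}$ be obtained by rotating this construction by quarter turns (so $P_{SW}$ starts along the lower segment to the left, $P_{NW}$ along the left segment upwards, and $P_{NE}$ along the upper segment to the right). Apart from the interior of the windmill, these paths divide $R$ into four regions: $R_1$ (above $P_{SE}$ and below $P_{NE}$), $R_2$ (to the right of $P_{SW}$ and to the left of $P_{SE}$), $R_3$ (above $P_{SW}$ and below $P_{NW}$), $R_4$ (to the right of $P_{NW}$ and to the left of $P_{NE}$). A rectangle has colour $i$ if it is contained in $R_i$. *Statement.* There are finitely many simple whirls of each size. Let $F(t,x_1,x_2,x_3,x_4)\in\mathbb Q[x_1,x_2,x_3,x_4][[t]]$ be the generating function of simple whirls (up to equivalence), where $t$ counts the size and $x_i$ counts the rectangles of colour $i$ that touch the border of $R$. Then $F$ is algebraic over $\mathbb Q[x_1,x_2,x_3,x_4][t]$ and $$F(t,x_1,x_2,x_3,x_4)=t^5\,\frac{\beta-\sqrt{\beta^2-4\alpha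 e_4^2}}{2\alpha},$$ where $$\alpha=\prod_{i=1}^4(1-x_i+t x_i^2),\qquad \beta=\bigl(2e_4t^2-t(4e_4-3e_3+2e_2)+e_4-e_3+e_2-e_1+2\bigr)e_4,$$ $e_m$ is the elementary symmetric polynomial of degree $m$ in $x_1,\dots,x_4$, and the square root is a power series in $\mathbb Q[x_1,\dots,x_4][[t]]$, namely the one with constant term $e_4\bigl(1-\prod_{i=1}^4(1-x_i)\bigr)$. In particular, the generating function of simple whirls by size is $F(t)=F(t,1,1,1,1)=t^5C(t)^4$, where $C(t)=\sum_{n\ge0}\frac1{n+1}\binom{2n}{n}t^n$ is the generating function of the Catalan numbers. -/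

import Mathlib

open Set

/-- A tiling of the rectangle `R = [west, east] × [south, north]` by `n` rectangles
`[left i, right i] × [bottom i, top i]` such that no four of them meet in a point.
The labels `i : Fin n` carry no information: they are forgotten by `Rectangulation.setoid`. -/
structure Rectangulation (n : ℕ) where
  west : ℝ
  east : ℝ
  south : ℝ
  north : ℝ
  west_lt_east : west < east
  south_lt_north : south < north
  left : Fin n → ℝ
  right : Fin n → ℝ
  bottom : Fin n → ℝ
  top : Fin n → ℝ
  left_lt_right : ∀ i, left i < right i
  bottom_lt_top : ∀ i, bottom i < top i
  /-- the rectangles cover `R` -/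
  cover : (⋃ i, Icc (left i) (right i) ×ˢ Icc (bottom i) (top i)) =
    Icc west east ×ˢ Icc south north
  /-- distinct rectangles have disjoint interiors -/
  disjoint_interiors : ∀ i j, i ≠ j →
    Disjoint (Ioo (left i) (right i) ×ˢ Ioo (bottom i) (top i))
      (Ioo (left j) (right j) ×ˢ Ioo (bottom j) (top j))
  /-- no four rectangles meet in a point -/
  no_four : ∀ p : ℝ × ℝ,
    {i | p ∈ Icc (left i) (right i) ×ˢ Icc (bottom i) (top i)}.ncard ≤ 3

namespace Rectangulation

variable {n : ℕ} (R : Rectangulation n)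

/-- The `i`-th (closed) rectangle. -/
def cell (i : Fin n) : Set (ℝ × ℝ) :=
  Icc (R.left i) (R.right i) ×ˢ Icc (R.bottom i) (R.top i)

/-! ### Equivalence of rectangulations -/

/-- Rectangles `i` and `j` share a vertical piece of boundary, `i` being on the left. -/
def LeftAdj (i j : Fin n) : Prop :=
  R.right i = R.left j ∧ max (R.bottom i) (R.bottom j) < min (R.top i) (R.top j)

/-- Rectangles `i` and `j` share a horizontal piece of boundary, `i` being below. -/
def BelowAdj (i j : Fin n) : Prop :=
  R.top i = R.bottom j ∧ max (R.left i) (R.left j) < min (R.right i) (R.right j)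

/-- (Strong) equivalence: a bijection between the rectangles preserves adjacency
together with its direction. -/
def Equivalent (R S : Rectangulation n) : Prop :=
  ∃ σ : Equiv.Perm (Fin n), ∀ i j,
    (R.LeftAdj i j ↔ S.LeftAdj (σ i) (σ j)) ∧ (R.BelowAdj i j ↔ S.BelowAdj (σ i) (σ j))

theorem equivalent_equivalence (n : ℕ) : Equivalence (Equivalent (n := n)) where
  refl R := ⟨Equiv.refl _, fun i j => ⟨Iff.rfl, Iff.rfl⟩⟩
  symm := by
    rintro R S ⟨σ, h⟩
    refine ⟨σ.symm, fun i j => ?_⟩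
    have := h (σ.symm i) (σ.symm j)
    simp only [Equiv.apply_symm_apply] at this
    exact ⟨this.1.symm, this.2.symm⟩
  trans := by
    rintro R S T ⟨σ, h⟩ ⟨τ, k⟩
    refine ⟨σ.trans τ, fun i j => ?_⟩
    have h1 := h i j
    have k1 := k (σ i) (σ j)
    exact ⟨h1.1.trans k1.1, h1.2.trans k1.2⟩

/-- Rectangulations of size `n` are counted up to equivalence. -/
def setoid (n : ℕ) : Setoid (Rectangulation n) := ⟨Equivalent, equivalent_equivalence n⟩

/-! ### Segments -/

/-- The union of the vertical sides of all rectangles. -/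
def verticalSides : Set (ℝ × ℝ) :=
  ⋃ i, {R.left i, R.right i} ×ˢ Icc (R.bottom i) (R.top i)

/-- The union of the horizontal sides of all rectangles. -/
def horizontalSides : Set (ℝ × ℝ) :=
  ⋃ i, Icc (R.left i) (R.right i) ×ˢ {R.bottom i, R.top i}

/-- `{x} × [p, q]` is a (maximal) vertical segment of the rectangulation.
The western and eastern sides of `R` are included. -/
def IsVSeg (x p q : ℝ) : Prop :=
  p < q ∧ {x} ×ˢ Icc p q ⊆ R.verticalSides ∧
    ∀ p' q', p' ≤ p → q ≤ q' → {x} ×ˢ Icc p' q' ⊆ R.verticalSides → p' = p ∧ q' = q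

/-- `[p, q] × {y}` is a (maximal) horizontal segment of the rectangulation.
The southern and northern sides of `R` are included. -/
def IsHSeg (y p q : ℝ) : Prop :=
  p < q ∧ Icc p q ×ˢ {y} ⊆ R.horizontalSides ∧
    ∀ p' q', p' ≤ p → q ≤ q' → Icc p' q' ×ˢ {y} ⊆ R.horizontalSides → p' = p ∧ q' = q

/-- A horizontal segment at height `y` ends, coming from the left, at an inner point of the
vertical segment `{x} × [p, q]`. -/
def TickLeft (x p q y : ℝ) : Prop := p < y ∧ y < q ∧ ∃ r, R.IsHSeg y r x

/-- A horizontal segment at height `y` starts, going to the right, at an inner point of the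
vertical segment `{x} × [p, q]`. -/
def TickRight (x p q y : ℝ) : Prop := p < y ∧ y < q ∧ ∃ r, R.IsHSeg y x r

/-- A vertical segment at abscissa `x` ends, coming from below, at an inner point of the
horizontal segment `[p, q] × {y}`. -/
def TickBelow (y p q x : ℝ) : Prop := p < x ∧ x < q ∧ ∃ r, R.IsVSeg x r y

/-- A vertical segment at abscissa `x` starts, going upwards, at an inner point of the
horizontal segment `[p, q] × {y}`. -/
def TickAbove (y p q x : ℝ) : Prop := p < x ∧ x < q ∧ ∃ r, R.IsVSeg x y r

/-! ### Patterns -/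

/-- A windmill with interior `[a, b] × [c, d]` in which the upper segment continues to the right,
the left one upwards, the lower one to the left and the right one downwards; each of the four
segments ends at an inner point of the next one. -/
def IsWindmill (a b c d : ℝ) : Prop :=
  a < b ∧ c < d ∧ ∃ l r u v : ℝ,
    (R.IsVSeg a c l ∧ d < l) ∧ (R.IsHSeg d a r ∧ b < r) ∧
    (R.IsVSeg b u d ∧ u < c) ∧ (R.IsHSeg c v b ∧ v < a)

/-- The mirror image: the upper segment continues to the left, the left one downwards, the lower
one to the right and the right one upwards. -/
def IsMirrorWindmill (a b c d : ℝ) : Prop :=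
  a < b ∧ c < d ∧ ∃ l r u v : ℝ,
    (R.IsVSeg a l d ∧ l < c) ∧ (R.IsHSeg d r b ∧ r < a) ∧
    (R.IsVSeg b c u ∧ d < u) ∧ (R.IsHSeg c a v ∧ b < v)

def ContainsP1 : Prop := ∃ a b c d, R.IsMirrorWindmill a b c d

def ContainsP2 : Prop := ∃ a b c d, R.IsWindmill a b c d

/-- A vertical segment with a tick on its left that is lower than a tick on its right. -/
def ContainsP3 : Prop := ∃ x p q y z,
  R.IsVSeg x p q ∧ R.TickLeft x p q y ∧ R.TickRight x p q z ∧ y < z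

/-- A horizontal segment with a tick below it that is to the left of a tick above it. -/
def ContainsP4 : Prop := ∃ y p q x z,
  R.IsHSeg y p q ∧ R.TickBelow y p q x ∧ R.TickAbove y p q z ∧ x < z

/-- A vertical segment with a tick on its left that is higher than a tick on its right. -/
def ContainsP5 : Prop := ∃ x p q y z,
  R.IsVSeg x p q ∧ R.TickLeft x p q y ∧ R.TickRight x p q z ∧ z < y

/-- A horizontal segment with a tick below it that is to the right of a tick above it. -/
def ContainsP6 : Prop := ∃ y p q x z,
  R.IsHSeg y p q ∧ R.TickBelow y p q x ∧ R.TickAbove y p q z ∧ z < x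

/-- `[a, b] × [c, d]` is a (possibly further partitioned) rectangle of the rectangulation. -/
def IsBlock (a b c d : ℝ) : Prop :=
  a < b ∧ c < d ∧ ∃ I : Set (Fin n), (⋃ i ∈ I, R.cell i) = Icc a b ×ˢ Icc c d

/-- A (possibly further partitioned) rectangle such that the segment containing its left side has
a tick on the left and the segment containing its right side has a tick on the right. -/
def ContainsP7 : Prop := ∃ a b c d, R.IsBlock a b c d ∧
  (∃ p q y, R.IsVSeg a p q ∧ p ≤ c ∧ d ≤ q ∧ R.TickLeft a p q y) ∧
  (∃ p q y, R.IsVSeg b p q ∧ p ≤ c ∧ d ≤ q ∧ R.TickRight b p q y)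

/-- A (possibly further partitioned) rectangle such that the segment containing its lower side has
a tick below and the segment containing its upper side has a tick above. -/
def ContainsP8 : Prop := ∃ a b c d, R.IsBlock a b c d ∧
  (∃ p q x, R.IsHSeg c p q ∧ p ≤ a ∧ b ≤ q ∧ R.TickBelow c p q x) ∧
  (∃ p q x, R.IsHSeg d p q ∧ p ≤ a ∧ b ≤ q ∧ R.TickAbove d p q x)

/-! ### Whirls -/

/-- A vortex rectangulation avoids all the patterns except possibly `P2`. -/
def IsVortex : Prop :=
  ¬ R.ContainsP1 ∧ ¬ R.ContainsP3 ∧ ¬ R.ContainsP4 ∧ ¬ R.ContainsP5 ∧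
    ¬ R.ContainsP6 ∧ ¬ R.ContainsP7 ∧ ¬ R.ContainsP8

def IsWhirl : Prop := R.IsVortex ∧ R.ContainsP2

/-- Some rectangle extends from the left to the right side or from the bottom to the top of `R`. -/
def IsPeelable : Prop :=
  ∃ i, (R.left i = R.west ∧ R.right i = R.east) ∨ (R.bottom i = R.south ∧ R.top i = R.north)

/-- A simple whirl: non-peelable, with precisely one windmill, whose interior is a single
rectangle. -/
def IsSimpleWhirl : Prop :=
  R.IsWhirl ∧ ¬ R.IsPeelable ∧
    ∃ a b c d, R.IsWindmill a b c d ∧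
      (∀ a' b' c' d', R.IsWindmill a' b' c' d' → a' = a ∧ b' = b ∧ c' = c ∧ d' = d) ∧
      ∃ i, R.cell i = Icc a b ×ˢ Icc c d

/-! ### Alternating paths and colours -/

/-- Going along a vertical segment to its lower endpoint. -/
def GoDown (P Q : ℝ × ℝ) : Prop :=
  ∃ x y p q, R.IsVSeg x p q ∧ p ≤ y ∧ y ≤ q ∧ P = (x, y) ∧ Q = (x, p)

/-- Going along a vertical segment to its upper endpoint. -/
def GoUp (P Q : ℝ × ℝ) : Prop :=
  ∃ x y p q, R.IsVSeg x p q ∧ p ≤ y ∧ y ≤ q ∧ P = (x, y) ∧ Q = (x, q)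

/-- Going along a horizontal segment to its left endpoint. -/
def GoLeft (P Q : ℝ × ℝ) : Prop :=
  ∃ x y p q, R.IsHSeg y p q ∧ p ≤ x ∧ x ≤ q ∧ P = (x, y) ∧ Q = (p, y)

/-- Going along a horizontal segment to its right endpoint. -/
def GoRight (P Q : ℝ × ℝ) : Prop :=
  ∃ x y p q, R.IsHSeg y p q ∧ p ≤ x ∧ x ≤ q ∧ P = (x, y) ∧ Q = (q, y)

/-- The legs `P → Q` of the path that starts at `O` and alternately makes moves `f` and `g`,
beginning with `f`; the flag is `true` for the legs made by `f`. -/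
inductive AltLeg (f g : ℝ × ℝ → ℝ × ℝ → Prop) (O : ℝ × ℝ) : Bool → ℝ × ℝ → ℝ × ℝ → Prop
  | start {Q : ℝ × ℝ} : f O Q → AltLeg f g O true O Q
  | turnG {P Q S : ℝ × ℝ} : AltLeg f g O true P Q → g Q S → AltLeg f g O false Q S
  | turnF {P Q S : ℝ × ℝ} : AltLeg f g O false P Q → f Q S → AltLeg f g O true Q S

/-- The point set of the alternating path. -/
def altPath (f g : ℝ × ℝ → ℝ × ℝ → Prop) (O : ℝ × ℝ) : Set (ℝ × ℝ) :=
  {X | ∃ s P Q, AltLeg f g O s P Q ∧ X ∈ segment ℝ P Q}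

/-- The alternating paths of the windmill with interior `[a, b] × [c, d]`: from its right segment
downwards, rightwards, downwards, … to the south-east corner of `R`, and the rotations of this. -/
def pathSE (b d : ℝ) : Set (ℝ × ℝ) := altPath R.GoDown R.GoRight (b, d)

def pathSW (b c : ℝ) : Set (ℝ × ℝ) := altPath R.GoLeft R.GoDown (b, c)

def pathNW (a c : ℝ) : Set (ℝ × ℝ) := altPath R.GoUp R.GoLeft (a, c)

def pathNE (a d : ℝ) : Set (ℝ × ℝ) := altPath R.GoRight R.GoUp (a, d)

/-- The set of points with a point of `A` weakly below and a point of `B` weakly above. -/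
def betweenVert (A B : Set (ℝ × ℝ)) : Set (ℝ × ℝ) :=
  {X | (∃ y, y ≤ X.2 ∧ (X.1, y) ∈ A) ∧ ∃ y, X.2 ≤ y ∧ (X.1, y) ∈ B}

/-- The set of points with a point of `A` weakly to the left and a point of `B` weakly to the
right. -/
def betweenHoriz (A B : Set (ℝ × ℝ)) : Set (ℝ × ℝ) :=
  {X | (∃ x, x ≤ X.1 ∧ (x, X.2) ∈ A) ∧ ∃ x, X.1 ≤ x ∧ (x, X.2) ∈ B}

/-- The four (closed) regions into which the alternating paths divide the complement of the
interior of the windmill `[a, b] × [c, d]`. In order: the eastern region, between the south-east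
and north-east paths, which holds the south-eastern corner rectangle of a simple whirl, and then
clockwise the southern, the western and the northern region. -/
def region (a b c d : ℝ) : Fin 4 → Set (ℝ × ℝ) :=
  ![betweenVert (R.pathSE b d) (R.pathNE a d),
    betweenHoriz (R.pathSW b c) (R.pathSE b d),
    betweenVert (R.pathSW b c) (R.pathNW a c),
    betweenHoriz (R.pathNW a c) (R.pathNE a d)]

/-- Rectangle `i` has colour `k`: it lies in the `k`-th region of the windmill. -/
def HasColour (i : Fin n) (k : Fin 4) : Prop :=
  ∃ a b c d, R.IsWindmill a b c d ∧ R.cell i ⊆ R.region a b c d k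

/-- Rectangle `i` touches the border of `R`. -/
def TouchesBorder (i : Fin n) : Prop :=
  R.left i = R.west ∨ R.right i = R.east ∨ R.bottom i = R.south ∨ R.top i = R.north

/-- The number of rectangles of colour `k` that touch the border of `R`. -/
noncomputable def borderCount (k : Fin 4) : ℕ :=
  {i | R.HasColour i k ∧ R.TouchesBorder i}.ncard

end Rectangulation

/-! ### Generating functions -/

/-- The simple whirls of size `n`, up to equivalence. -/
def simpleWhirls (n : ℕ) : Set (Quotient (Rectangulation.setoid n)) :=
  {W | ∃ R : Rectangulation n, Quotient.mk _ R = W ∧ R.IsSimpleWhirl}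

/-- The simple whirls of size `n`, up to equivalence, with `m k` rectangles of colour `k`
touching the border for each `k`. -/
def simpleWhirlsWith (n : ℕ) (m : Fin 4 → ℕ) : Set (Quotient (Rectangulation.setoid n)) :=
  {W | ∃ R : Rectangulation n, Quotient.mk _ R = W ∧ R.IsSimpleWhirl ∧
    ∀ k, R.borderCount k = m k}

/-- The multivariate generating function `F(t, x₁, x₂, x₃, x₄)` of simple whirls, a power series
in `t` whose coefficients are polynomials in the `xₖ`. The sum ranges over all possible values
`0, …, n` of the four counts. -/
noncomputable def simpleWhirlSeries : PowerSeries (MvPolynomial (Fin 4) ℚ) :=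
  PowerSeries.mk fun n =>
    ∑ m : Fin 4 → Fin (n + 1),
      MvPolynomial.C ((simpleWhirlsWith n fun k => (m k : ℕ)).ncard : ℚ) *
        ∏ k, MvPolynomial.X k ^ (m k : ℕ)

/-- The univariate generating function of simple whirls, counted by size. -/
noncomputable def simpleWhirlCountSeries : PowerSeries ℚ :=
  PowerSeries.mk fun n => ((simpleWhirls n).ncard : ℚ)

/-- The variable `xₖ`. -/
noncomputable def xvar (k : Fin 4) : PowerSeries (MvPolynomial (Fin 4) ℚ) :=
  PowerSeries.C (MvPolynomial.X k)

/-- The elementary symmetric polynomial `eₘ(x₁, x₂, x₃, x₄)`. -/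
noncomputable def esym (m : ℕ) : PowerSeries (MvPolynomial (Fin 4) ℚ) :=
  PowerSeries.C (MvPolynomial.esymm (Fin 4) ℚ m)

/-- The polynomial `α = ∏ (1 - xₖ + t xₖ²)`. -/
noncomputable def whirlAlpha : PowerSeries (MvPolynomial (Fin 4) ℚ) :=
  ∏ k, (1 - xvar k + PowerSeries.X * xvar k ^ 2)

/-- The polynomial
`β = (2 e₄ t² - t (4 e₄ - 3 e₃ + 2 e₂) + e₄ - e₃ + e₂ - e₁ + 2) e₄`. -/
noncomputable def whirlBeta : PowerSeries (MvPolynomial (Fin 4) ℚ) :=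
  (2 * esym 4 * PowerSeries.X ^ 2
    - PowerSeries.X * (4 * esym 4 - 3 * esym 3 + 2 * esym 2)
    + esym 4 - esym 3 + esym 2 - esym 1 + 2) * esym 4

/-! The interior of the windmill of a simple whirl is a rectangle `z`. Each windmill segment has a
tick on the side facing `z`, hence none on the other side, and so it is the inner side of a single
rectangle. The patterns P7 and P8 forbid outward ticks on the segment through the outer side of that
rectangle, and the argument repeats. Thus an arm of rectangles leads from each side of `z` to the
border (`exists_arm`).

Number the directions clockwise from the east. In direction `k + 1`, the `j`-th rectangle of arm `k`
ends flush with the `f k j`-th rectangle of arm `k + 1`; in direction `k + 3` its end is given by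
the adjoint `g (k + 3)` of `f (k + 3)`. The arms and `z` leave no room for other rectangles
(`SpiralCode.exists_node_cover`). Hence a rectangulation of this kind is a spiral, encoded by four
chains and monotone maps `f k` from each to the next. The code determines it up to equivalence
(`Spiral.equivalent_iff`), and every code occurs (`SpiralCode.spiral`).

In a spiral every segment reaches across the strip of the centre, so P3 to P8 never occur. Windmills
are the cycles of the maps `g k`, mirror windmills the cycles of the maps `j ↦ f k j + 1`. It
follows that the spiral is a simple whirl exactly when the code is `Valid` (`Spiral.isSimpleWhirl`,
`Spiral.valid`). Colour `k` is arm `k`, and its border rectangles are the elements that `f k` maps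
to the greatest one; their number is `tops k`.

Removing the greatest element of a chain gives a recurrence for the number of valid codes of total
length `N` with `r k + 1` such elements in chain `k`. The recurrence is that of the powers of `U = t
C(t)`, which satisfies `U = t + U²`; so the number is the coefficient of `t ^ N` in `U ^ ∑ r k`
(`ncard_topsCodes`). Summation gives `F = t⁵ ∏ xₖ / (1 - xₖ U)`. Replacing `U` by the other root `1
- U` of `U (1 - U) = t` gives a conjugate denominator; the two denominators have product `α` and sum
`β / e₄`, whence the quadratic equation for `F`. -/

namespace Rectangulation

/-! ### Outward coordinates and separation of rectangles -/

variable {n : ℕ} (R : Rectangulation n)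

/-- The coordinates of the four sides of a rectangle, measured outwards, in the order east, south,
west, north. -/
def ext (k : Fin 4) (c : Fin n) : ℝ := ![R.right c, -R.bottom c, -R.left c, R.top c] k

/-- The coordinates of the four sides of the whole rectangle, measured outwards. -/
def bd (k : Fin 4) : ℝ := ![R.east, -R.south, -R.west, R.north] k

@[simp] theorem ext_zero (c : Fin n) : R.ext 0 c = R.right c := rfl
@[simp] theorem ext_one (c : Fin n) : R.ext 1 c = -R.bottom c := rfl
@[simp] theorem ext_two (c : Fin n) : R.ext 2 c = -R.left c := rfl
@[simp] theorem ext_three (c : Fin n) : R.ext 3 c = R.top c := rfl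
@[simp] theorem bd_zero : R.bd 0 = R.east := rfl
@[simp] theorem bd_one : R.bd 1 = -R.south := rfl
@[simp] theorem bd_two : R.bd 2 = -R.west := rfl
@[simp] theorem bd_three : R.bd 3 = R.north := rfl

theorem ext_pos (k : Fin 4) (c : Fin n) : 0 < R.ext k c + R.ext (k + 2) c := by
  have h1 := R.left_lt_right c
  have h2 := R.bottom_lt_top c
  fin_cases k <;> simp <;> linarith

theorem mem_cell {c : Fin n} {x y : ℝ} :
    (x, y) ∈ R.cell c ↔ (R.left c ≤ x ∧ x ≤ R.right c) ∧ R.bottom c ≤ y ∧ y ≤ R.top c := by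
  simp only [cell, mem_prod, mem_Icc]

theorem cell_subset (c : Fin n) : R.cell c ⊆ Icc R.west R.east ×ˢ Icc R.south R.north := by
  rw [← R.cover]; exact subset_iUnion (fun i => R.cell i) c

theorem exists_mem_cell {x y : ℝ} (h1 : R.west ≤ x) (h2 : x ≤ R.east) (h3 : R.south ≤ y)
    (h4 : y ≤ R.north) : ∃ c, (x, y) ∈ R.cell c := by
  have : (x, y) ∈ ⋃ i, Icc (R.left i) (R.right i) ×ˢ Icc (R.bottom i) (R.top i) := by
    rw [R.cover]; exact ⟨⟨h1, h2⟩, h3, h4⟩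
  simpa [cell] using this

theorem west_le_left (c : Fin n) : R.west ≤ R.left c := by
  have := R.cell_subset c (R.mem_cell.2 ⟨⟨le_rfl, (R.left_lt_right c).le⟩, le_rfl,
    (R.bottom_lt_top c).le⟩)
  exact this.1.1

theorem south_le_bottom (c : Fin n) : R.south ≤ R.bottom c := by
  have := R.cell_subset c (R.mem_cell.2 ⟨⟨le_rfl, (R.left_lt_right c).le⟩, le_rfl,
    (R.bottom_lt_top c).le⟩)
  exact this.2.1

theorem right_le_east (c : Fin n) : R.right c ≤ R.east := by
  have := R.cell_subset c (R.mem_cell.2 ⟨⟨(R.left_lt_right c).le, le_rfl⟩,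
    (R.bottom_lt_top c).le, le_rfl⟩)
  exact this.1.2

theorem top_le_north (c : Fin n) : R.top c ≤ R.north := by
  have := R.cell_subset c (R.mem_cell.2 ⟨⟨(R.left_lt_right c).le, le_rfl⟩,
    (R.bottom_lt_top c).le, le_rfl⟩)
  exact this.2.2

theorem ext_le_bd (k : Fin 4) (c : Fin n) : R.ext k c ≤ R.bd k := by
  have h1 := R.west_le_left c
  have h2 := R.south_le_bottom c
  have h3 := R.right_le_east c
  have h4 := R.top_le_north c
  fin_cases k <;> simp <;> linarith

theorem interior_disjoint {i j : Fin n} (h : i ≠ j) {P : ℝ × ℝ}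
    (hP : P ∈ Ioo (R.left i) (R.right i) ×ˢ Ioo (R.bottom i) (R.top i) ∩
      Ioo (R.left j) (R.right j) ×ˢ Ioo (R.bottom j) (R.top j)) : False :=
  Set.disjoint_left.1 (R.disjoint_interiors i j h) hP.1 hP.2

/-- A point of the interior of a rectangle lies in no other rectangle. -/
theorem eq_of_mem_interior {c c' : Fin n} {x y : ℝ} (h1 : R.left c < x) (h2 : x < R.right c)
    (h3 : R.bottom c < y) (h4 : y < R.top c) (h : (x, y) ∈ R.cell c') : c' = c := by
  by_contra hne
  obtain ⟨⟨a1, a2⟩, a3, a4⟩ := R.mem_cell.1 h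
  have b1 := R.left_lt_right c'
  have b2 := R.bottom_lt_top c'
  -- The given point may lie on the boundary of `c'`; it is moved to a point interior to both
  -- rectangles.
  obtain ⟨x', hx1, hx2⟩ := exists_between
    (show max (R.left c) (R.left c') < min (R.right c) (R.right c') by
      simp only [lt_min_iff, max_lt_iff]
      refine ⟨⟨?_, ?_⟩, ?_, ?_⟩ <;> linarith)
  obtain ⟨y', hy1, hy2⟩ := exists_between
    (show max (R.bottom c) (R.bottom c') < min (R.top c) (R.top c') by
      simp only [lt_min_iff, max_lt_iff]
      refine ⟨⟨?_, ?_⟩, ?_, ?_⟩ <;> linarith)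
  simp only [lt_min_iff, max_lt_iff] at hx1 hx2 hy1 hy2
  exact R.interior_disjoint hne (P := (x', y')) ⟨⟨⟨hx1.2, hx2.2⟩, hy1.2, hy2.2⟩, ⟨hx1.1, hx2.1⟩, hy1.1, hy2.1⟩

/-- Distinct rectangles are separated by a horizontal or vertical line. -/
theorem exists_ext_le {c c' : Fin n} (h : c ≠ c') : ∃ k, R.ext k c ≤ -R.ext (k + 2) c' := by
  by_contra! H
  have h0 := H 0
  have h1 := H 1
  have h2 := H 2
  have h3 := H 3
  simp only [ext_zero, ext_one, ext_two, ext_three, Fin.isValue, show (0 + 2 : Fin 4) = 2 from rfl,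
    show (1 + 2 : Fin 4) = 3 from rfl, show (2 + 2 : Fin 4) = 0 from rfl,
    show (3 + 2 : Fin 4) = 1 from rfl] at h0 h1 h2 h3
  have b1 := R.left_lt_right c'
  have b2 := R.bottom_lt_top c'
  have b3 := R.left_lt_right c
  have b4 := R.bottom_lt_top c
  obtain ⟨x', hx1, hx2⟩ := exists_between
    (show max (R.left c) (R.left c') < min (R.right c) (R.right c') by
      simp only [lt_min_iff, max_lt_iff]
      refine ⟨⟨?_, ?_⟩, ?_, ?_⟩ <;> linarith)
  obtain ⟨y', hy1, hy2⟩ := exists_between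
    (show max (R.bottom c) (R.bottom c') < min (R.top c) (R.top c') by
      simp only [lt_min_iff, max_lt_iff]
      refine ⟨⟨?_, ?_⟩, ?_, ?_⟩ <;> linarith)
  simp only [lt_min_iff, max_lt_iff] at hx1 hx2 hy1 hy2
  exact h (R.eq_of_mem_interior hx1.2 hx2.2 hy1.2 hy2.2
    (R.mem_cell.2 ⟨⟨hx1.1.le, hx2.1.le⟩, hy1.1.le, hy2.1.le⟩))

theorem mem_verticalSides {x y : ℝ} : (x, y) ∈ R.verticalSides ↔
    ∃ c, (x = R.left c ∨ x = R.right c) ∧ R.bottom c ≤ y ∧ y ≤ R.top c := by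
  simp [verticalSides, mem_prod]

theorem mem_horizontalSides {x y : ℝ} : (x, y) ∈ R.horizontalSides ↔
    ∃ c, (R.left c ≤ x ∧ x ≤ R.right c) ∧ (y = R.bottom c ∨ y = R.top c) := by
  simp [horizontalSides, mem_prod]

theorem singleton_prod_Icc_subset {x p q : ℝ} {A : Set (ℝ × ℝ)} :
    {x} ×ˢ Icc p q ⊆ A ↔ ∀ y, p ≤ y → y ≤ q → (x, y) ∈ A := by
  constructor
  · intro h y h1 h2; exact h ⟨rfl, h1, h2⟩
  · rintro h ⟨a, b⟩ ⟨h1, h2⟩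
    simp only [mem_singleton_iff] at h1
    subst h1; exact h b h2.1 h2.2

theorem Icc_prod_singleton_subset {y p q : ℝ} {A : Set (ℝ × ℝ)} :
    Icc p q ×ˢ {y} ⊆ A ↔ ∀ x, p ≤ x → x ≤ q → (x, y) ∈ A := by
  constructor
  · intro h x h1 h2; exact h ⟨⟨h1, h2⟩, rfl⟩
  · rintro h ⟨a, b⟩ ⟨h1, h2⟩
    simp only [mem_singleton_iff] at h2
    subst h2; exact h a h1.1 h1.2

/-! ### Rotation -/

theorem cover_iff {n : ℕ} {l r b t : Fin n → ℝ} {w e s m : ℝ} :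
    (⋃ i, Icc (l i) (r i) ×ˢ Icc (b i) (t i)) = Icc w e ×ˢ Icc s m ↔
    ∀ x y, (∃ i, (l i ≤ x ∧ x ≤ r i) ∧ b i ≤ y ∧ y ≤ t i) ↔ (w ≤ x ∧ x ≤ e) ∧ s ≤ y ∧ y ≤ m := by
  simp only [Set.ext_iff, mem_iUnion, Prod.forall, mem_prod, mem_Icc]

/-- The image under the clockwise quarter turn `(x, y) ↦ (y, -x)`. -/
def rot : Rectangulation n where
  west := R.south
  east := R.north
  south := -R.east
  north := -R.west
  west_lt_east := R.south_lt_north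
  south_lt_north := neg_lt_neg R.west_lt_east
  left := R.bottom
  right := R.top
  bottom i := -R.right i
  top i := -R.left i
  left_lt_right := R.bottom_lt_top
  bottom_lt_top i := neg_lt_neg (R.left_lt_right i)
  cover := by
    rw [cover_iff]
    intro x y
    have := cover_iff.1 R.cover (-y) x
    constructor
    · rintro ⟨i, h1, h2, h3⟩
      have := this.1 ⟨i, ⟨by linarith, by linarith⟩, h1⟩
      exact ⟨this.2, by linarith, by linarith⟩
    · rintro ⟨h1, h2, h3⟩
      obtain ⟨i, h4, h5⟩ := this.2 ⟨⟨by linarith, by linarith⟩, h1⟩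
      exact ⟨i, h5, by linarith, by linarith⟩
  disjoint_interiors i j h := by
    rw [Set.disjoint_left]
    rintro ⟨x, y⟩ ⟨⟨a1, a2⟩, a3, a4⟩ ⟨⟨b1, b2⟩, b3, b4⟩
    simp only at a1 a2 a3 a4 b1 b2 b3 b4
    refine R.interior_disjoint h (P := (-y, x)) ⟨⟨⟨by simp only; linarith, by simp only; linarith⟩, a1, a2⟩,
      ⟨by simp only; linarith, by simp only; linarith⟩, b1, b2⟩
  no_four := by
    rintro ⟨x, y⟩
    convert R.no_four (-y, x) using 3
    refine funext fun i => propext ?_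
    simp only [mem_prod, mem_Icc]
    constructor <;> rintro ⟨⟨_, _⟩, _, _⟩ <;> refine ⟨⟨?_, ?_⟩, ?_, ?_⟩ <;> linarith

/-- Directions are numbered clockwise, so that a clockwise quarter turn adds 1. A statement in terms
of `ext` and `bd` proved for one direction then carries over to all four. -/
theorem ext_rot (k : Fin 4) (c : Fin n) : R.rot.ext (k + 1) c = R.ext k c := by
  fin_cases k <;> simp [rot]

theorem bd_rot (k : Fin 4) : R.rot.bd (k + 1) = R.bd k := by
  fin_cases k <;> simp [rot]

theorem rot_mem_verticalSides {x y : ℝ} :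
    (y, -x) ∈ R.rot.verticalSides ↔ (x, y) ∈ R.horizontalSides := by
  rw [mem_verticalSides, mem_horizontalSides]
  simp only [rot, neg_le_neg_iff]
  exact exists_congr fun c => by tauto

theorem rot_mem_horizontalSides {x y : ℝ} :
    (y, -x) ∈ R.rot.horizontalSides ↔ (x, y) ∈ R.verticalSides := by
  rw [mem_verticalSides, mem_horizontalSides]
  simp only [rot, neg_inj]
  exact exists_congr fun c => by tauto

theorem rot_mem_cell {c : Fin n} {x y : ℝ} : (y, -x) ∈ R.rot.cell c ↔ (x, y) ∈ R.cell c := by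
  rw [mem_cell, mem_cell]
  simp only [rot, neg_le_neg_iff]
  tauto

theorem rot_isVSeg {y p q : ℝ} : R.rot.IsVSeg y (-q) (-p) ↔ R.IsHSeg y p q := by
  have key : ∀ p q, {y} ×ˢ Icc (-q) (-p) ⊆ R.rot.verticalSides ↔
      Icc p q ×ˢ {y} ⊆ R.horizontalSides := by
    intro p q
    rw [singleton_prod_Icc_subset, Icc_prod_singleton_subset]
    constructor
    · intro h x h1 h2
      exact R.rot_mem_verticalSides.1 (h (-x) (by linarith) (by linarith))
    · intro h x h1 h2
      have := R.rot_mem_verticalSides.2 (h (-x) (by linarith) (by linarith))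
      simpa using this
  unfold IsVSeg IsHSeg
  rw [key, neg_lt_neg_iff]
  refine and_congr Iff.rfl (and_congr Iff.rfl ?_)
  constructor
  · intro h p' q' h1 h2 h3
    have := h (-q') (-p') (by linarith) (by linarith) ((key _ _).2 h3)
    simp only [neg_inj] at this
    exact this.symm
  · intro h p' q' h1 h2 h3
    have := h (-q') (-p') (by linarith) (by linarith) ((key _ _).1 (by simpa using h3))
    constructor <;> linarith

theorem rot_isHSeg {x p q : ℝ} : R.rot.IsHSeg (-x) p q ↔ R.IsVSeg x p q := by
  have key : ∀ p q, Icc p q ×ˢ {-x} ⊆ R.rot.horizontalSides ↔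
      {x} ×ˢ Icc p q ⊆ R.verticalSides := by
    intro p q
    rw [singleton_prod_Icc_subset, Icc_prod_singleton_subset]
    exact forall_congr' fun y => by rw [rot_mem_horizontalSides]
  unfold IsVSeg IsHSeg
  simp only [key]

theorem rot_isVSeg' {y p q : ℝ} : R.rot.IsVSeg y p q ↔ R.IsHSeg y (-q) (-p) := by
  simpa using R.rot_isVSeg (y := y) (p := -q) (q := -p)

theorem rot_isHSeg' {y p q : ℝ} : R.rot.IsHSeg y p q ↔ R.IsVSeg (-y) p q := by
  simpa using R.rot_isHSeg (x := -y) (p := p) (q := q)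

theorem rot_tickLeft {x p q y : ℝ} :
    R.rot.TickLeft x p q y ↔ R.TickBelow x (-q) (-p) (-y) := by
  simp only [TickLeft, TickBelow, rot_isHSeg', neg_lt_neg_iff]; tauto

theorem rot_tickRight {x p q y : ℝ} :
    R.rot.TickRight x p q y ↔ R.TickAbove x (-q) (-p) (-y) := by
  simp only [TickRight, TickAbove, rot_isHSeg', neg_lt_neg_iff]; tauto

theorem rot_tickBelow {x p q y : ℝ} :
    R.rot.TickBelow y p q x ↔ R.TickRight (-y) p q x := by
  simp only [TickRight, TickBelow, rot_isVSeg']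
  refine and_congr Iff.rfl (and_congr Iff.rfl ?_)
  constructor
  · rintro ⟨r, h⟩; exact ⟨-r, h⟩
  · rintro ⟨r, h⟩; exact ⟨-r, by simpa using h⟩

theorem rot_tickAbove {x p q y : ℝ} :
    R.rot.TickAbove y p q x ↔ R.TickLeft (-y) p q x := by
  simp only [TickLeft, TickAbove, rot_isVSeg']
  refine and_congr Iff.rfl (and_congr Iff.rfl ?_)
  constructor
  · rintro ⟨r, h⟩; exact ⟨-r, h⟩
  · rintro ⟨r, h⟩; exact ⟨-r, by simpa using h⟩

theorem isBlock_iff {a b c d : ℝ} : R.IsBlock a b c d ↔ a < b ∧ c < d ∧ ∃ I : Set (Fin n),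
    ∀ x y, (∃ i ∈ I, (x, y) ∈ R.cell i) ↔ (a ≤ x ∧ x ≤ b) ∧ c ≤ y ∧ y ≤ d := by
  simp only [IsBlock, Set.ext_iff, Prod.forall, mem_iUnion, mem_prod, mem_Icc, exists_prop]

theorem rot_isBlock {a b c d : ℝ} : R.rot.IsBlock a b c d ↔ R.IsBlock (-d) (-c) a b := by
  rw [isBlock_iff, isBlock_iff, neg_lt_neg_iff]
  constructor
  · rintro ⟨h1, h2, I, h⟩
    refine ⟨h2, h1, I, fun x y => ?_⟩
    have := h y (-x)
    simp only [rot_mem_cell] at this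
    rw [this]
    constructor <;> rintro ⟨⟨_, _⟩, _, _⟩ <;> refine ⟨⟨?_, ?_⟩, ?_, ?_⟩ <;> linarith
  · rintro ⟨h1, h2, I, h⟩
    refine ⟨h2, h1, I, fun x y => ?_⟩
    have := h (-y) x
    have h' : ∀ i, (x, y) ∈ R.rot.cell i ↔ (-y, x) ∈ R.cell i := fun i => by
      have := R.rot_mem_cell (c := i) (x := -y) (y := x)
      rwa [neg_neg] at this
    simp only [h', this]
    constructor <;> rintro ⟨⟨_, _⟩, _, _⟩ <;> refine ⟨⟨?_, ?_⟩, ?_, ?_⟩ <;> linarith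

theorem rot_isWindmill {a b c d : ℝ} :
    R.rot.IsWindmill a b c d ↔ R.IsWindmill (-d) (-c) a b := by
  simp only [IsWindmill, rot_isVSeg', rot_isHSeg']
  constructor
  · rintro ⟨h1, h2, l, r, u, v, ⟨h3, h3'⟩, ⟨h4, h4'⟩, ⟨h5, hu⟩, h6, h6'⟩
    exact ⟨by linarith, by linarith, r, -u, v, -l, ⟨h4, h4'⟩, ⟨h5, by linarith⟩, ⟨h6, h6'⟩, h3,
      by linarith⟩
  · rintro ⟨h1, h2, l, r, u, v, ⟨h3, h3'⟩, ⟨h4, h4'⟩, ⟨h5, hu⟩, h6, h6'⟩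
    exact ⟨by linarith, by linarith, -v, l, -r, u, ⟨by simpa using h6, by linarith⟩, ⟨h3, h3'⟩,
      ⟨by simpa using h4, by linarith⟩, h5, hu⟩

/-- No segment has ticks on both sides, and no block lies between two outward ticks. -/
def Clean : Prop :=
  ¬ R.ContainsP3 ∧ ¬ R.ContainsP4 ∧ ¬ R.ContainsP5 ∧ ¬ R.ContainsP6 ∧ ¬ R.ContainsP7 ∧
    ¬ R.ContainsP8

-- The quarter turn permutes the six patterns: it exchanges P7 with P8 and turns ticks on vertical
-- segments into ticks on horizontal ones, in one of the two orders.
variable {R} in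
theorem Clean.rot (h : R.Clean) : R.rot.Clean := by
  obtain ⟨h3, h4, h5, h6, h7, h8⟩ := h
  simp only [Clean, ContainsP3, ContainsP4, ContainsP5, ContainsP6, ContainsP7, ContainsP8,
    rot_isVSeg', rot_isHSeg', rot_tickLeft, rot_tickRight, rot_tickBelow, rot_tickAbove,
    rot_isBlock]
  refine ⟨?_, ?_, ?_, ?_, ?_, ?_⟩
  · rintro ⟨x, p, q, y, z, a, b, c, d⟩
    exact h6 ⟨x, -q, -p, -y, -z, a, b, c, by linarith⟩
  · rintro ⟨x, p, q, y, z, a, b, c, d⟩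
    exact h5 ⟨-x, p, q, z, y, a, c, b, d⟩
  · rintro ⟨x, p, q, y, z, a, b, c, d⟩
    exact h4 ⟨x, -q, -p, -y, -z, a, b, c, by linarith⟩
  · rintro ⟨x, p, q, y, z, a, b, c, d⟩
    exact h3 ⟨-x, p, q, z, y, a, c, b, d⟩
  · rintro ⟨a, b, c, d, h, ⟨p, q, y, i1, i2, i3, i4⟩, ⟨p', q', y', j1, j2, j3, j4⟩⟩
    exact h8 ⟨-d, -c, a, b, h, ⟨-q, -p, -y, i1, by linarith, by linarith, i4⟩,
      ⟨-q', -p', -y', j1, by linarith, by linarith, j4⟩⟩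
  · rintro ⟨a, b, c, d, h, ⟨p, q, y, i1, i2, i3, i4⟩, ⟨p', q', y', j1, j2, j3, j4⟩⟩
    exact h7 ⟨-d, -c, a, b, h, ⟨p', q', y', j1, by linarith, by linarith, j4⟩,
      ⟨p, q, y, i1, by linarith, by linarith, i4⟩⟩

end Rectangulation

namespace Rectangulation

variable {n : ℕ} (R : Rectangulation n)

/-! ### Local structure -/

-- The points `(x - e, y + e)` with small `e > 0` lie in `R`. A rectangle without the required
-- inequalities misses them for all small `e`, and there are finitely many rectangles.
open Filter Topology in
theorem exists_cell_northwest {x y : ℝ} (h1 : R.west < x) (h2 : x ≤ R.east) (h3 : R.south ≤ y)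
    (h4 : y < R.north) : ∃ c, (R.left c < x ∧ x ≤ R.right c) ∧ R.bottom c ≤ y ∧ y < R.top c := by
  by_contra! H
  have key : ∀ c, ∀ᶠ e in 𝓝[>] (0 : ℝ), (x - e, y + e) ∉ R.cell c := by
    intro c
    have small : ∀ d : ℝ, 0 < d → ∀ᶠ e in 𝓝[>] (0 : ℝ), e < d := fun d hd =>
      (eventually_lt_nhds hd).filter_mono nhdsWithin_le_nhds
    have pos : ∀ᶠ e in 𝓝[>] (0 : ℝ), 0 < e := eventually_mem_nhdsWithin
    rcases le_or_gt x (R.left c) with a | a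
    · filter_upwards [pos] with e he hm
      have := (R.mem_cell.1 hm).1.1
      linarith
    rcases lt_or_ge (R.right c) x with b | b
    · filter_upwards [small _ (sub_pos.2 b)] with e he hm
      have := (R.mem_cell.1 hm).1.2
      linarith
    rcases lt_or_ge y (R.bottom c) with d | d
    · filter_upwards [small _ (sub_pos.2 d)] with e he hm
      have := (R.mem_cell.1 hm).2.1
      linarith
    · have := H c ⟨a, b⟩ d
      filter_upwards [pos] with e he hm
      have := (R.mem_cell.1 hm).2.2
      linarith
  have small : ∀ d : ℝ, 0 < d → ∀ᶠ e in 𝓝[>] (0 : ℝ), e < d := fun d hd =>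
    (eventually_lt_nhds hd).filter_mono nhdsWithin_le_nhds
  have pos : ∀ᶠ e in 𝓝[>] (0 : ℝ), 0 < e := eventually_mem_nhdsWithin
  obtain ⟨e, he, he1, he2, he3⟩ := ((eventually_all.2 key).and ((small _ (sub_pos.2 h1)).and
    ((small _ (sub_pos.2 h4)).and pos))).exists
  obtain ⟨c, hc⟩ := R.exists_mem_cell (x := x - e) (y := y + e) (by linarith) (by linarith)
    (by linarith) (by linarith)
  exact he c hc

theorem exists_cell_southwest {x y : ℝ} (h1 : R.west < x) (h2 : x ≤ R.east) (h3 : R.south < y)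
    (h4 : y ≤ R.north) : ∃ c, (R.left c < x ∧ x ≤ R.right c) ∧ R.bottom c < y ∧ y ≤ R.top c := by
  obtain ⟨c, ⟨a1, a2⟩, a3, a4⟩ := R.rot.exists_cell_northwest (x := y) (y := -x) h3 h4
    (neg_le_neg h2) (neg_lt_neg h1)
  exact ⟨c, ⟨neg_lt_neg_iff.1 a4, neg_le_neg_iff.1 a3⟩, a1, a2⟩

theorem exists_cell_southeast {x y : ℝ} (h1 : R.west ≤ x) (h2 : x < R.east) (h3 : R.south < y)
    (h4 : y ≤ R.north) : ∃ c, (R.left c ≤ x ∧ x < R.right c) ∧ R.bottom c < y ∧ y ≤ R.top c := by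
  obtain ⟨c, ⟨a1, a2⟩, a3, a4⟩ := R.rot.exists_cell_southwest (x := y) (y := -x) h3 h4
    (neg_lt_neg h2) (neg_le_neg h1)
  exact ⟨c, ⟨neg_le_neg_iff.1 a4, neg_lt_neg_iff.1 a3⟩, a1, a2⟩

theorem exists_cell_northeast {x y : ℝ} (h1 : R.west ≤ x) (h2 : x < R.east) (h3 : R.south ≤ y)
    (h4 : y < R.north) : ∃ c, (R.left c ≤ x ∧ x < R.right c) ∧ R.bottom c ≤ y ∧ y < R.top c := by
  obtain ⟨c, ⟨a1, a2⟩, a3, a4⟩ := R.rot.exists_cell_southeast (x := y) (y := -x) h3 h4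
    (neg_lt_neg h2) (neg_le_neg h1)
  exact ⟨c, ⟨neg_le_neg_iff.1 a4, neg_lt_neg_iff.1 a3⟩, a1, a2⟩

theorem not_mem_verticalSides {c : Fin n} {x y : ℝ} (h1 : R.left c < x) (h2 : x < R.right c)
    (h3 : R.bottom c < y) (h4 : y < R.top c) : (x, y) ∉ R.verticalSides := by
  intro h
  obtain ⟨c', hx, hy⟩ := R.mem_verticalSides.1 h
  have b := R.left_lt_right c'
  have := R.eq_of_mem_interior h1 h2 h3 h4 (c' := c') (R.mem_cell.2 ⟨by
    rcases hx with rfl | rfl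
    · exact ⟨le_rfl, b.le⟩
    · exact ⟨b.le, le_rfl⟩, hy⟩)
  subst this
  rcases hx with rfl | rfl <;> linarith

theorem not_mem_horizontalSides {c : Fin n} {x y : ℝ} (h1 : R.left c < x) (h2 : x < R.right c)
    (h3 : R.bottom c < y) (h4 : y < R.top c) : (x, y) ∉ R.horizontalSides := by
  rw [← rot_mem_verticalSides]
  exact R.rot.not_mem_verticalSides (c := c) h3 h4 (neg_lt_neg h2) (neg_lt_neg h1)

theorem verticalSides_bounds {x y : ℝ} (h : (x, y) ∈ R.verticalSides) :
    (R.west ≤ x ∧ x ≤ R.east) ∧ R.south ≤ y ∧ y ≤ R.north := by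
  obtain ⟨c, hx, h1, h2⟩ := R.mem_verticalSides.1 h
  have a1 := R.left_lt_right c
  have a2 := R.west_le_left c
  have a3 := R.right_le_east c
  have a4 := R.south_le_bottom c
  have a5 := R.top_le_north c
  rcases hx with rfl | rfl <;> refine ⟨⟨?_, ?_⟩, ?_, ?_⟩ <;> linarith

theorem horizontalSides_bounds {x y : ℝ} (h : (x, y) ∈ R.horizontalSides) :
    (R.west ≤ x ∧ x ≤ R.east) ∧ R.south ≤ y ∧ y ≤ R.north := by
  obtain ⟨⟨a1, a2⟩, a3, a4⟩ := R.rot.verticalSides_bounds (R.rot_mem_verticalSides.2 h)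
  exact ⟨⟨neg_le_neg_iff.1 a4, neg_le_neg_iff.1 a3⟩, a1, a2⟩

/-- The cell `c` at a point just beside a piece of vertical segment ends at that segment. -/
theorem eq_side_of_verticalSides {c : Fin n} {x p q : ℝ} (h : {x} ×ˢ Icc p q ⊆ R.verticalSides)
    (h1 : max p (R.bottom c) < min q (R.top c)) (h2 : R.left c ≤ x) (h3 : x ≤ R.right c) :
    x = R.left c ∨ x = R.right c := by
  by_contra! H
  obtain ⟨y, hy1, hy2⟩ := exists_between h1
  simp only [lt_min_iff, max_lt_iff] at hy1 hy2
  exact R.not_mem_verticalSides (lt_of_le_of_ne h2 H.1.symm) (lt_of_le_of_ne h3 H.2) hy1.2 hy2.2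
    (singleton_prod_Icc_subset.1 h y hy1.1.le hy2.1.le)

theorem eq_side_of_horizontalSides {c : Fin n} {y p q : ℝ}
    (h : Icc p q ×ˢ {y} ⊆ R.horizontalSides)
    (h1 : max p (R.left c) < min q (R.right c)) (h2 : R.bottom c ≤ y) (h3 : y ≤ R.top c) :
    y = R.bottom c ∨ y = R.top c := by
  by_contra! H
  obtain ⟨x, hx1, hx2⟩ := exists_between h1
  simp only [lt_min_iff, max_lt_iff] at hx1 hx2
  exact R.not_mem_horizontalSides hx1.2 hx2.2 (lt_of_le_of_ne h2 H.1.symm) (lt_of_le_of_ne h3 H.2)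
    (Icc_prod_singleton_subset.1 h x hx1.1.le hx2.1.le)

/-- Segments do not cross. -/
theorem not_crossing {x y p q r s : ℝ} (h : {x} ×ˢ Icc p q ⊆ R.verticalSides)
    (h' : Icc r s ×ˢ {y} ⊆ R.horizontalSides) (h1 : p < y) (h2 : y < q) (h3 : r < x)
    (h4 : x < s) : False := by
  have b1 := R.verticalSides_bounds (singleton_prod_Icc_subset.1 h p le_rfl (h1.trans h2).le)
  have b2 := R.verticalSides_bounds (singleton_prod_Icc_subset.1 h q (h1.trans h2).le le_rfl)
  have b3 := R.horizontalSides_bounds (Icc_prod_singleton_subset.1 h' r le_rfl (h3.trans h4).le)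
  have b4 := R.horizontalSides_bounds (Icc_prod_singleton_subset.1 h' s (h3.trans h4).le le_rfl)
  have hw : R.west < x := b3.1.1.trans_lt h3
  have he : x < R.east := h4.trans_le b4.1.2
  have hs : R.south < y := b1.2.1.trans_lt h1
  have hn : y < R.north := h2.trans_le b2.2.2
  obtain ⟨c1, ⟨a1, a2⟩, a3, a4⟩ := R.exists_cell_northwest hw he.le hs.le hn
  obtain ⟨c2, ⟨d1, d2⟩, d3, d4⟩ := R.exists_cell_southwest hw he.le hs hn.le
  obtain ⟨c3, ⟨e1, e2⟩, e3, e4⟩ := R.exists_cell_southeast hw.le he hs hn.le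
  obtain ⟨c4, ⟨f1, f2⟩, f3, f4⟩ := R.exists_cell_northeast hw.le he hs.le hn
  -- Neither segment enters the interior of a rectangle, so the crossing point is a corner of each
  -- of the four; they occupy different quadrants and are therefore distinct.
  have g1 := R.eq_side_of_verticalSides h (c := c1) (by simp; grind) a1.le a2
  have g2 := R.eq_side_of_verticalSides h (c := c2) (by simp; grind) d1.le d2
  have g3 := R.eq_side_of_verticalSides h (c := c3) (by simp; grind) e1 e2.le
  have g4 := R.eq_side_of_verticalSides h (c := c4) (by simp; grind) f1 f2.le
  have k1 := R.eq_side_of_horizontalSides h' (c := c1) (by simp; grind) a3 a4.le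
  have k2 := R.eq_side_of_horizontalSides h' (c := c2) (by simp; grind) d3.le d4
  have k3 := R.eq_side_of_horizontalSides h' (c := c3) (by simp; grind) e3.le e4
  have k4 := R.eq_side_of_horizontalSides h' (c := c4) (by simp; grind) f3 f4.le
  have n12 : c1 ≠ c2 := by rintro rfl; grind
  have n13 : c1 ≠ c3 := by rintro rfl; grind
  have n14 : c1 ≠ c4 := by rintro rfl; grind
  have n23 : c2 ≠ c3 := by rintro rfl; grind
  have n24 : c2 ≠ c4 := by rintro rfl; grind
  have n34 : c3 ≠ c4 := by rintro rfl; grind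
  have h4 : (({c1, c2, c3, c4} : Finset (Fin n)) : Set (Fin n)).ncard = 4 := by
    rw [Set.ncard_coe_finset]
    simp [n12, n13, n14, n23, n24, n34]
  have hsub : (({c1, c2, c3, c4} : Finset (Fin n)) : Set (Fin n)) ⊆
      {i | (x, y) ∈ Icc (R.left i) (R.right i) ×ˢ Icc (R.bottom i) (R.top i)} := by
    intro c hc
    simp only [Finset.coe_insert, Finset.coe_singleton, mem_insert_iff, mem_singleton_iff] at hc
    show (x, y) ∈ R.cell c
    rw [mem_cell]
    rcases hc with rfl | rfl | rfl | rfl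
    · exact ⟨⟨a1.le, a2⟩, a3, a4.le⟩
    · exact ⟨⟨d1.le, d2⟩, d3.le, d4⟩
    · exact ⟨⟨e1, e2.le⟩, e3.le, e4⟩
    · exact ⟨⟨f1, f2.le⟩, f3, f4.le⟩
  have := Set.ncard_le_ncard hsub (Set.toFinite _)
  have := R.no_four (x, y)
  omega

/-! ### Maximal segments -/

theorem isClosed_verticalSides : IsClosed R.verticalSides :=
  isClosed_iUnion_of_finite fun i =>
    ((Set.toFinite {R.left i, R.right i}).isClosed).prod isClosed_Icc

/-- The supremum of the possible upper ends is attained because the union of the sides is closed. -/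
theorem exists_isVSeg_upper {x p q : ℝ} (hpq : p ≤ q) (h : {x} ×ˢ Icc p q ⊆ R.verticalSides) :
    ∃ q', q ≤ q' ∧ {x} ×ˢ Icc p q' ⊆ R.verticalSides ∧
      ∀ r, {x} ×ˢ Icc p r ⊆ R.verticalSides → r ≤ q' := by
  have hp := R.verticalSides_bounds (singleton_prod_Icc_subset.1 h p le_rfl hpq)
  have bdd : BddAbove {r | ({x} : Set ℝ) ×ˢ Icc p r ⊆ R.verticalSides} := by
    refine ⟨R.north, fun r hr => ?_⟩
    rcases lt_or_ge r p with h1 | h1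
    · exact h1.le.trans hp.2.2
    · exact (R.verticalSides_bounds (singleton_prod_Icc_subset.1 hr r h1 le_rfl)).2.2
  refine ⟨sSup {r | ({x} : Set ℝ) ×ˢ Icc p r ⊆ R.verticalSides}, le_csSup bdd h, ?_,
    fun r hr => le_csSup bdd hr⟩
  set S := sSup {r | ({x} : Set ℝ) ×ˢ Icc p r ⊆ R.verticalSides}
  have hpS : p ≤ S := hpq.trans (le_csSup bdd h)
  have hlt : ∀ y, p ≤ y → y < S → (x, y) ∈ R.verticalSides := by
    intro y h1 h2
    obtain ⟨r, hr, hyr⟩ := exists_lt_of_lt_csSup ⟨q, h⟩ h2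
    exact singleton_prod_Icc_subset.1 hr y h1 hyr.le
  rw [singleton_prod_Icc_subset]
  intro y h1 h2
  rcases h2.lt_or_eq with h2 | rfl
  · exact hlt y h1 h2
  rcases hpS.lt_or_eq with h3 | h3
  · have hc : IsClosed {y | (x, y) ∈ R.verticalSides} :=
      R.isClosed_verticalSides.preimage (by fun_prop : Continuous fun y : ℝ => (x, y))
    have hsub : Ico p S ⊆ {y | (x, y) ∈ R.verticalSides} := fun y hy => hlt y hy.1 hy.2
    have := closure_minimal hsub hc
    rw [closure_Ico h3.ne] at this
    exact this ⟨h3.le, le_rfl⟩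
  · rw [← h3]; exact singleton_prod_Icc_subset.1 h p le_rfl hpq

theorem exists_isVSeg_lower {x p q : ℝ} (hpq : p ≤ q) (h : {x} ×ˢ Icc p q ⊆ R.verticalSides) :
    ∃ p', p' ≤ p ∧ {x} ×ˢ Icc p' q ⊆ R.verticalSides ∧
      ∀ r, {x} ×ˢ Icc r q ⊆ R.verticalSides → p' ≤ r := by
  have key : ∀ p q, {-x} ×ˢ Icc (-q) (-p) ⊆ R.rot.rot.verticalSides ↔
      {x} ×ˢ Icc p q ⊆ R.verticalSides := by
    intro p q
    have : ∀ y, (-x, -y) ∈ R.rot.rot.verticalSides ↔ (x, y) ∈ R.verticalSides := fun y => by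
      rw [rot_mem_verticalSides, rot_mem_horizontalSides]
    rw [singleton_prod_Icc_subset, singleton_prod_Icc_subset]
    constructor
    · intro h y h1 h2; exact (this y).1 (h (-y) (by linarith) (by linarith))
    · intro h y h1 h2
      have := (this (-y)).2 (h (-y) (by linarith) (by linarith))
      rwa [neg_neg] at this
  obtain ⟨p', h1, h2, h3⟩ := R.rot.rot.exists_isVSeg_upper (x := -x) (p := -q) (q := -p)
    (by linarith) ((key _ _).2 h)
  refine ⟨-p', by linarith, (key _ _).1 (by simpa using h2), fun r hr => ?_⟩
  have := h3 (-r) ((key _ _).2 hr)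
  linarith

theorem exists_isVSeg {x p q : ℝ} (hpq : p < q) (h : {x} ×ˢ Icc p q ⊆ R.verticalSides) :
    ∃ p' q', p' ≤ p ∧ q ≤ q' ∧ R.IsVSeg x p' q' := by
  obtain ⟨q', h1, h2, h3⟩ := R.exists_isVSeg_upper hpq.le h
  obtain ⟨p', h4, h5, h6⟩ := R.exists_isVSeg_lower (hpq.le.trans h1) h2
  refine ⟨p', q', h4, h1, by linarith, h5, fun p'' q'' i1 i2 i3 => ⟨?_, ?_⟩⟩
  · exact le_antisymm i1 (h6 _ (Subset.trans (prod_mono le_rfl (Icc_subset_Icc le_rfl i2)) i3))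
  · exact le_antisymm (h3 _ (Subset.trans (prod_mono le_rfl
      (Icc_subset_Icc (i1.trans h4) le_rfl)) i3)) i2

theorem exists_isHSeg {y p q : ℝ} (hpq : p < q) (h : Icc p q ×ˢ {y} ⊆ R.horizontalSides) :
    ∃ p' q', p' ≤ p ∧ q ≤ q' ∧ R.IsHSeg y p' q' := by
  obtain ⟨p', q', h1, h2, h3⟩ := R.rot.exists_isVSeg (x := y) (p := -q) (q := -p) (by linarith) (by
    rw [Icc_prod_singleton_subset] at h
    rw [singleton_prod_Icc_subset]
    intro x hx1 hx2
    have := R.rot_mem_verticalSides.2 (h (-x) (by linarith) (by linarith))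
    rwa [neg_neg] at this)
  exact ⟨-q', -p', by linarith, by linarith, R.rot_isVSeg'.1 h3⟩

variable {R}

/-- The union of two touching collinear pieces again consists of sides, so maximality applies to it.
-/
theorem IsVSeg.le_of_touch {x p q p' q' : ℝ} (h : R.IsVSeg x p q)
    (h' : {x} ×ˢ Icc p' q' ⊆ R.verticalSides) (h1 : p' ≤ q) (h2 : p ≤ q') :
    p ≤ p' ∧ q' ≤ q := by
  have h3 : {x} ×ˢ Icc (min p p') (max q q') ⊆ R.verticalSides := by
    have hv := singleton_prod_Icc_subset.1 h.2.1
    have hv' := singleton_prod_Icc_subset.1 h'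
    rw [singleton_prod_Icc_subset]
    intro y a b
    rcases min_le_iff.1 a with a | a <;> rcases le_max_iff.1 b with b | b
    · exact hv y a b
    · rcases le_total y q with c | c
      · exact hv y a c
      · exact hv' y (h1.trans c) b
    · rcases le_total p y with c | c
      · exact hv y c b
      · exact hv' y a (c.trans h2)
    · exact hv' y a b
  have := h.2.2 _ _ (min_le_left _ _) (le_max_left _ _) h3
  exact ⟨min_eq_left_iff.1 this.1, max_eq_left_iff.1 this.2⟩

theorem IsHSeg.le_of_touch {y p q p' q' : ℝ} (h : R.IsHSeg y p q)
    (h' : Icc p' q' ×ˢ {y} ⊆ R.horizontalSides) (h1 : p' ≤ q) (h2 : p ≤ q') :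
    p ≤ p' ∧ q' ≤ q := by
  have := (R.rot_isVSeg.2 h).le_of_touch (p' := -q') (q' := -p') (by
    rw [Icc_prod_singleton_subset] at h'
    rw [singleton_prod_Icc_subset]
    intro x hx1 hx2
    have := R.rot_mem_verticalSides.2 (h' (-x) (by linarith) (by linarith))
    rwa [neg_neg] at this) (by linarith) (by linarith)
  constructor <;> linarith

variable (R)

theorem left_side_subset (c : Fin n) :
    {R.left c} ×ˢ Icc (R.bottom c) (R.top c) ⊆ R.verticalSides :=
  singleton_prod_Icc_subset.2 fun _ h1 h2 => R.mem_verticalSides.2 ⟨c, Or.inl rfl, h1, h2⟩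

theorem right_side_subset (c : Fin n) :
    {R.right c} ×ˢ Icc (R.bottom c) (R.top c) ⊆ R.verticalSides :=
  singleton_prod_Icc_subset.2 fun _ h1 h2 => R.mem_verticalSides.2 ⟨c, Or.inr rfl, h1, h2⟩

theorem top_side_subset (c : Fin n) :
    Icc (R.left c) (R.right c) ×ˢ {R.top c} ⊆ R.horizontalSides :=
  Icc_prod_singleton_subset.2 fun _ h1 h2 => R.mem_horizontalSides.2 ⟨c, ⟨h1, h2⟩, Or.inr rfl⟩

variable {R}

/-- A segment without ticks on its left is the right side of a single rectangle. -/
theorem IsVSeg.exists_left_cell {x p q : ℝ} (h : R.IsVSeg x p q) (hx : R.west < x)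
    (hl : ∀ y, ¬ R.TickLeft x p q y) : ∃ c, R.right c = x ∧ R.bottom c = p ∧ R.top c = q := by
  have b1 := R.verticalSides_bounds (singleton_prod_Icc_subset.1 h.2.1 p le_rfl h.1.le)
  have b2 := R.verticalSides_bounds (singleton_prod_Icc_subset.1 h.2.1 q h.1.le le_rfl)
  obtain ⟨c, ⟨a1, a2⟩, a3, a4⟩ := R.exists_cell_northwest hx b1.1.2 b1.2.1 (h.1.trans_le b2.2.2)
  have hpq := h.1
  have hr : x = R.right c := by
    refine (R.eq_side_of_verticalSides h.2.1 (c := c) ?_ a1.le a2).resolve_left a1.ne'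
    simp only [lt_min_iff, max_lt_iff]
    refine ⟨⟨?_, ?_⟩, ?_, ?_⟩ <;> linarith
  have h1 := R.right_side_subset c
  rw [← hr] at h1
  have ht := h.le_of_touch h1 (by linarith) a4.le
  refine ⟨c, hr.symm, le_antisymm a3 ht.1, ?_⟩
  -- If `c` ended below `q`, the segment through its upper side would either cross the vertical
  -- segment or end there as a tick.
  by_contra hne
  have hlt := lt_of_le_of_ne ht.2 hne
  obtain ⟨r, r', i1, i2, i3⟩ := R.exists_isHSeg (R.left_lt_right c) (R.top_side_subset c)
  rw [← hr] at i2
  rcases i2.lt_or_eq with i2 | i2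
  · exact R.not_crossing h.2.1 i3.2.1 a4 hlt (i1.trans_lt a1) i2
  · subst i2
    exact hl _ ⟨a4, hlt, r, i3⟩

theorem IsVSeg.exists_right_cell {x p q : ℝ} (h : R.IsVSeg x p q) (hx : x < R.east)
    (hl : ∀ y, ¬ R.TickRight x p q y) : ∃ c, R.left c = x ∧ R.bottom c = p ∧ R.top c = q := by
  have h' : R.rot.rot.IsVSeg (-x) (-q) (-p) := by
    simpa [rot_isVSeg', rot_isHSeg'] using h
  obtain ⟨c, h1, h2, h3⟩ := h'.exists_left_cell (neg_lt_neg hx) (fun y hy => by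
    simp only [rot_tickLeft, rot_tickBelow, neg_neg] at hy
    exact hl _ hy)
  exact ⟨c, neg_inj.1 h1, neg_inj.1 h3, neg_inj.1 h2⟩

theorem not_tickLeft_of_tickRight (hR : R.Clean) {x p q y z : ℝ} (h : R.IsVSeg x p q)
    (h1 : R.TickRight x p q z) : ¬ R.TickLeft x p q y := by
  intro h2
  rcases lt_trichotomy y z with hlt | rfl | hlt
  · exact hR.1 ⟨x, p, q, y, z, h, h2, h1, hlt⟩
  -- Two ticks at the same height would join to a longer horizontal segment.
  · obtain ⟨_, _, r, hr⟩ := h1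
    obtain ⟨_, _, r', hr'⟩ := h2
    have := hr.1
    have := hr'.1
    have := hr'.le_of_touch hr.2.1 le_rfl (by linarith)
    linarith
  · exact hR.2.2.1 ⟨x, p, q, y, z, h, h2, h1, hlt⟩

/-! ### Chains of rectangles going west -/

variable (R) in
/-- The segment `{x} × [p, q]` has no ticks on its left, and between it and some segment with a
tick on its right there is nothing or a block of its full height. -/
def WestBound (x p q : ℝ) : Prop :=
  R.IsVSeg x p q ∧ (∀ y, ¬ R.TickLeft x p q y) ∧ ((∃ y, R.TickRight x p q y) ∨
    ∃ b, R.IsBlock x b p q ∧ ∃ p' q' y, R.IsVSeg b p' q' ∧ p' ≤ p ∧ q ≤ q' ∧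
      R.TickRight b p' q' y)

theorem isBlock_cell (c : Fin n) :
    R.IsBlock (R.left c) (R.right c) (R.bottom c) (R.top c) :=
  ⟨R.left_lt_right c, R.bottom_lt_top c, {c}, by simp [cell]⟩

theorem IsBlock.union_cell {x b p q : ℝ} (h : R.IsBlock x b p q) {c : Fin n} (h1 : R.right c = x)
    (h2 : R.bottom c = p) (h3 : R.top c = q) : R.IsBlock (R.left c) b p q := by
  rw [isBlock_iff] at h ⊢
  obtain ⟨a1, a2, I, hI⟩ := h
  have hc := R.left_lt_right c
  refine ⟨by linarith, a2, insert c I, fun u v => ?_⟩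
  have := hI u v
  simp only [mem_insert_iff, exists_eq_or_imp, this]
  rw [mem_cell, h1, h2, h3]
  constructor
  · rintro (⟨⟨_, _⟩, _, _⟩ | ⟨⟨_, _⟩, _, _⟩) <;> refine ⟨⟨?_, ?_⟩, ?_, ?_⟩ <;> linarith
  · rintro ⟨⟨k1, k2⟩, k3⟩
    rcases le_total u x with k | k
    · exact Or.inl ⟨⟨k1, k⟩, k3⟩
    · exact Or.inr ⟨⟨k, k2⟩, k3⟩

/-- The absence of left ticks yields one rectangle `c` along the whole segment. Together with `c`,
the block behind it reaches the next segment to the west, where a left tick would complete P7. -/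
theorem WestBound.step (hR : R.Clean) {x p q : ℝ} (h : R.WestBound x p q) (hx : R.west < x) :
    ∃ c p' q', R.right c = x ∧ R.bottom c = p ∧ R.top c = q ∧ p' ≤ p ∧ q ≤ q' ∧
      R.WestBound (R.left c) p' q' := by
  obtain ⟨hv, hl, hb⟩ := h
  obtain ⟨c, h1, h2, h3⟩ := hv.exists_left_cell hx hl
  obtain ⟨p', q', i1, i2, i3⟩ := R.exists_isVSeg (R.bottom_lt_top c) (R.left_side_subset c)
  have hblock : ∃ b, R.IsBlock (R.left c) b p q ∧ ∃ p' q' y, R.IsVSeg b p' q' ∧ p' ≤ p ∧ q ≤ q' ∧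
      R.TickRight b p' q' y := by
    rcases hb with ⟨y, hy⟩ | ⟨b, hb, hb'⟩
    · refine ⟨x, ?_, p, q, y, hv, le_rfl, le_rfl, hy⟩
      have := R.isBlock_cell c
      rwa [h1, h2, h3] at this
    · exact ⟨b, hb.union_cell h1 h2 h3, hb'⟩
  refine ⟨c, p', q', h1, h2, h3, h2 ▸ i1, h3 ▸ i2, i3, fun y hy => ?_, ?_⟩
  · obtain ⟨b, hb, p'', q'', y', j1, j2, j3, j4⟩ := hblock
    exact hR.2.2.2.2.1 ⟨_, b, p, q, hb, ⟨p', q', y, i3, h2 ▸ i1, h3 ▸ i2, hy⟩,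
      p'', q'', y', j1, j2, j3, j4⟩
  · by_cases ht : ∃ y, R.TickRight (R.left c) p' q' y
    · exact Or.inl ht
    -- Without right ticks the new segment is the left side of a single rectangle, which must be
    -- `c`. So the block enlarged by `c` has the full height of this segment.
    · right
      obtain ⟨c', k1, k2, k3⟩ := i3.exists_right_cell
        ((R.left_lt_right c).trans_le (R.right_le_east c)) (not_exists.1 ht)
      have a1 := R.left_lt_right c
      have a2 := R.left_lt_right c'
      have a3 := R.bottom_lt_top c
      obtain ⟨u, hu1, hu2⟩ := exists_between
        (show R.left c < min (R.right c) (R.right c') by simp only [lt_min_iff]; constructor <;>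
          linarith)
      obtain ⟨v, hv1, hv2⟩ := exists_between a3
      simp only [lt_min_iff] at hu2
      have : c' = c := R.eq_of_mem_interior hu1 hu2.1 hv1 hv2
        (R.mem_cell.2 ⟨⟨by linarith, hu2.2.le⟩, by linarith, by linarith⟩)
      subst this
      rw [← k2, ← k3, h2, h3]
      exact hblock

/-- Iterate `WestBound.step`; the number of rectangles to the west of the current segment decreases.
-/
theorem WestBound.exists_chain (hR : R.Clean) {x p q : ℝ} (h : R.WestBound x p q)
    (hx : R.west < x) : ∃ (m : ℕ) (s : ℕ → Fin n),
      (R.right (s 0) = x ∧ R.bottom (s 0) = p ∧ R.top (s 0) = q) ∧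
      (∀ j ≤ m, R.IsVSeg (R.right (s j)) (R.bottom (s j)) (R.top (s j))) ∧
      (∀ j < m, R.left (s j) = R.right (s (j + 1)) ∧ R.bottom (s (j + 1)) ≤ R.bottom (s j) ∧
        R.top (s j) ≤ R.top (s (j + 1))) ∧ R.left (s m) = R.west := by
  induction hN : {c | R.right c ≤ x}.ncard using Nat.strong_induction_on generalizing x p q with
  | _ N ih =>
    obtain ⟨c, p', q', h1, h2, h3, h4, h5, h6⟩ := h.step hR hx
    have hc := R.left_lt_right c
    rcases (R.west_le_left c).lt_or_eq with hw | hw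
    · have hlt : {c' | R.right c' ≤ R.left c}.ncard < N := by
        rw [← hN]
        refine Set.ncard_lt_ncard (Set.ssubset_iff_of_subset ?_ |>.2 ⟨c, h1.le, ?_⟩) (toFinite _)
        · intro c' hc'
          simp only [mem_ofPred_eq] at hc' ⊢
          linarith
        · simp only [mem_ofPred_eq]; linarith
      obtain ⟨m, s, ⟨a1, a2, a3⟩, a4, a5, a6⟩ := ih _ hlt h6 hw rfl
      refine ⟨m + 1, fun j => Nat.casesOn j c s, ⟨h1, h2, h3⟩, ?_, ?_, a6⟩
      · rintro (_ | j) hj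
        · show R.IsVSeg (R.right c) (R.bottom c) (R.top c)
          rw [h1, h2, h3]; exact h.1
        · exact a4 j (by omega)
      · rintro (_ | j) hj
        · exact ⟨a1.symm, (a2.trans_le h4).trans h2.symm.le, h3.le.trans (h5.trans a3.ge)⟩
        · exact a5 j (by omega)
    · exact ⟨0, fun _ => c, ⟨h1, h2, h3⟩, fun j _ => by simp only [h1, h2, h3]; exact h.1,
        fun j hj => absurd hj (Nat.not_lt_zero _), hw.symm⟩

/-! ### Arms around the interior of a windmill -/

variable (R) in
/-- The side of `c` in direction `k` is a whole segment. -/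
def FullSide (k : Fin 4) (c : Fin n) : Prop :=
  ∀ c', (R.ext k c' = R.ext k c ∨ -R.ext (k + 2) c' = R.ext k c) →
    -R.ext (k + 3) c' ≤ R.ext (k + 1) c → -R.ext (k + 3) c ≤ R.ext (k + 1) c' →
    R.ext (k + 1) c' ≤ R.ext (k + 1) c ∧ R.ext (k + 3) c' ≤ R.ext (k + 3) c

theorem IsVSeg.fullSide {c : Fin n} (h : R.IsVSeg (R.right c) (R.bottom c) (R.top c)) :
    R.FullSide 0 c := by
  intro c' h1 h2 h3
  simp only [Fin.isValue, zero_add, ext_zero, ext_one, ext_two, ext_three, neg_neg, neg_le_neg_iff]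
    at h1 h2 h3 ⊢
  refine h.le_of_touch (p' := R.bottom c') (q' := R.top c') ?_ h3 h2
  rcases h1 with h1 | h1
  · rw [← h1]; exact R.right_side_subset c'
  · rw [← h1]; exact R.left_side_subset c'

variable (R) in
/-- A chain of `m + 1` rectangles going in direction `k` from `z` to the border of `R`. -/
structure Arm (z : Fin n) (k : Fin 4) (s : ℕ → Fin n) (m : ℕ) : Prop where
  full : ∀ j ≤ m, R.FullSide (k + 2) (s j)
  abut : ∀ j < m, R.ext k (s j) = -R.ext (k + 2) (s (j + 1))
  le_succ : ∀ j < m, R.ext (k + 1) (s j) ≤ R.ext (k + 1) (s (j + 1))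
  le_succ' : ∀ j < m, R.ext (k + 3) (s j) ≤ R.ext (k + 3) (s (j + 1))
  outer : R.ext k (s m) = R.bd k
  start : R.ext (k + 2) (s 0) = -R.ext k z
  lt_start : R.ext (k + 1) z < R.ext (k + 1) (s 0)
  start' : R.ext (k + 3) (s 0) = R.ext (k + 3) z

theorem FullSide.of_rot {k : Fin 4} {c : Fin n} (h : R.rot.FullSide (k + 1) c) :
    R.FullSide k c := by
  have e2 : k + 1 + 2 = k + 2 + 1 := add_right_comm _ _ _
  have e3 : k + 1 + 3 = k + 3 + 1 := add_right_comm _ _ _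
  simpa only [FullSide, e2, e3, ext_rot] using h

theorem Arm.of_rot {z : Fin n} {k : Fin 4} {s : ℕ → Fin n} {m : ℕ} (h : R.rot.Arm z (k + 1) s m) :
    R.Arm z k s m := by
  have e2 : k + 1 + 2 = k + 2 + 1 := add_right_comm _ _ _
  have e3 : k + 1 + 3 = k + 3 + 1 := add_right_comm _ _ _
  obtain ⟨h1, h2, h3, h4, h5, h6, h7, h8⟩ := h
  simp only [e2, e3, ext_rot, bd_rot] at h1 h2 h3 h4 h5 h6 h7 h8
  exact ⟨fun j hj => (h1 j hj).of_rot, h2, h3, h4, h5, h6, h7, h8⟩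

theorem cell_eq_iff {z : Fin n} {a b c d : ℝ} (hab : a < b) (hcd : c < d) :
    R.cell z = Icc a b ×ˢ Icc c d ↔
      R.left z = a ∧ R.right z = b ∧ R.bottom z = c ∧ R.top z = d := by
  constructor
  · intro h
    have h1 := R.left_lt_right z
    have h2 := R.bottom_lt_top z
    have e : ∀ x y, (R.left z ≤ x ∧ x ≤ R.right z) ∧ (R.bottom z ≤ y ∧ y ≤ R.top z) ↔
        (a ≤ x ∧ x ≤ b) ∧ (c ≤ y ∧ y ≤ d) := by
      intro x y
      have : (x, y) ∈ R.cell z ↔ (x, y) ∈ Icc a b ×ˢ Icc c d := by rw [h]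
      rw [mem_cell] at this
      exact this
    have e1 := (e (R.left z) (R.bottom z)).1 ⟨⟨le_rfl, h1.le⟩, le_rfl, h2.le⟩
    have e2 := (e (R.right z) (R.top z)).1 ⟨⟨h1.le, le_rfl⟩, h2.le, le_rfl⟩
    have e3 := (e a c).2 ⟨⟨le_rfl, hab.le⟩, le_rfl, hcd.le⟩
    have e4 := (e b d).2 ⟨⟨hab.le, le_rfl⟩, hcd.le, le_rfl⟩
    refine ⟨?_, ?_, ?_, ?_⟩ <;> linarith [e1.1.1, e1.2.1, e2.1.2, e2.2.2, e3.1.1, e3.2.1, e4.1.2,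
      e4.2.2]
  · rintro ⟨rfl, rfl, rfl, rfl⟩; rfl

/-- The upper segment of the windmill starts at an inner point of the left one. This is a tick on
the right, so the left segment starts a chain. -/
theorem exists_arm_west (hR : R.Clean) {a b c d : ℝ} (hw : R.IsWindmill a b c d) {z : Fin n}
    (hz : R.cell z = Icc a b ×ˢ Icc c d) : ∃ s m, R.Arm z 2 s m := by
  obtain ⟨hab, hcd, l, r, u, v, ⟨h1, h1'⟩, ⟨h2, h2'⟩, ⟨h3, h3'⟩, h4, h4'⟩ := hw
  obtain ⟨z1, z2, z3, z4⟩ := (cell_eq_iff hab hcd).1 hz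
  have ht : R.TickRight a c l d := ⟨hcd, h1', r, h2⟩
  have hwa : R.west < a := by
    have := (R.horizontalSides_bounds (Icc_prod_singleton_subset.1 h4.2.1 v le_rfl h4.1.le)).1.1
    linarith
  obtain ⟨m, s, ⟨a1, a2, a3⟩, a4, a5, a6⟩ := WestBound.exists_chain hR
    ⟨h1, fun y => not_tickLeft_of_tickRight hR h1 ht, Or.inl ⟨d, ht⟩⟩ hwa
  refine ⟨s, m, ⟨fun j hj => (a4 j hj).fullSide, fun j hj => ?_, fun j hj => ?_, fun j hj => ?_,
    ?_, ?_, ?_, ?_⟩⟩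
  · have := (a5 j hj).1
    simpa using this
  · exact (a5 j hj).2.2
  · exact neg_le_neg (a5 j hj).2.1
  · simpa using a6
  · show R.right (s 0) = - -R.left z
    rw [neg_neg, a1, z1]
  · show R.top z < R.top (s 0)
    linarith
  · show -R.bottom (s 0) = -R.bottom z
    rw [a2, z3]

theorem rot_cell_eq {z : Fin n} {a b c d : ℝ} (hab : a < b) (hcd : c < d)
    (hz : R.cell z = Icc a b ×ˢ Icc c d) : R.rot.cell z = Icc c d ×ˢ Icc (-b) (-a) := by
  rw [cell_eq_iff hab hcd] at hz
  rw [cell_eq_iff hcd (by linarith)]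
  simp only [rot, hz]
  trivial

/-- The western case is proved; a quarter turn deduces direction `k` from direction `k + 1`. -/
theorem exists_arm (hR : R.Clean) {a b c d : ℝ} (hw : R.IsWindmill a b c d) {z : Fin n}
    (hz : R.cell z = Icc a b ×ˢ Icc c d) (k : Fin 4) : ∃ s m, R.Arm z k s m := by
  have step : ∀ k : Fin 4, (∀ (R : Rectangulation n) (a b c d : ℝ), R.Clean →
      R.IsWindmill a b c d → R.cell z = Icc a b ×ˢ Icc c d → ∃ s m, R.Arm z (k + 1) s m) →
      ∀ (R : Rectangulation n) (a b c d : ℝ), R.Clean → R.IsWindmill a b c d →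
        R.cell z = Icc a b ×ˢ Icc c d → ∃ s m, R.Arm z k s m := by
    intro k H R a b c d hR hw hz
    obtain ⟨s, m, h⟩ := H R.rot c d (-b) (-a) hR.rot (by rw [rot_isWindmill]; simpa using hw)
      (rot_cell_eq hw.1 hw.2.1 hz)
    exact ⟨s, m, h.of_rot⟩
  have h2 := fun (R : Rectangulation n) (a b c d : ℝ) (hR : R.Clean) (hw : R.IsWindmill a b c d)
    (hz : R.cell z = Icc a b ×ˢ Icc c d) => exists_arm_west hR hw hz
  have h1 := step 1 h2
  have h0 := step 0 h1
  have h3 := step 3 h0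
  fin_cases k
  · exact h0 R a b c d hR hw hz
  · exact h1 R a b c d hR hw hz
  · exact h2 R a b c d hR hw hz
  · exact h3 R a b c d hR hw hz

end Rectangulation

/-! ### Arithmetic of the four directions -/

namespace Direction

theorem add_one_one (k : Fin 4) : k + 1 + 1 = k + 2 := by revert k; decide
theorem add_one_two (k : Fin 4) : k + 1 + 2 = k + 3 := by revert k; decide
theorem add_one_three (k : Fin 4) : k + 1 + 3 = k := by revert k; decide
theorem add_two_one (k : Fin 4) : k + 2 + 1 = k + 3 := by revert k; decide
theorem add_two_two (k : Fin 4) : k + 2 + 2 = k := by revert k; decide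
theorem add_two_three (k : Fin 4) : k + 2 + 3 = k + 1 := by revert k; decide
theorem add_three_one (k : Fin 4) : k + 3 + 1 = k := by revert k; decide
theorem add_three_two (k : Fin 4) : k + 3 + 2 = k + 1 := by revert k; decide
theorem add_three_three (k : Fin 4) : k + 3 + 3 = k + 2 := by revert k; decide

theorem cases (i k : Fin 4) : k = i ∨ k = i + 1 ∨ k = i + 2 ∨ k = i + 3 := by
  revert i k; decide

end Direction

open Direction

/-! ### Codes of spirals -/

/-- Four finite chains `{0, …, M k}` with monotone maps `f k` from each to the next one. -/
@[ext] structure SpiralCode where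
  M : Fin 4 → ℕ
  f : Fin 4 → ℕ → ℕ
  mono : ∀ k, Monotone (f k)
  le : ∀ k j, f k j ≤ M (k + 1)
  -- The default value outside the chain makes a code determined by its values on the chains and
  -- keeps `f k` monotone.
  const : ∀ k j, M k < j → f k j = M (k + 1)

namespace SpiralCode

variable (C : SpiralCode)

/-- The least `d ≤ M k + 1` such that `j ≤ f k d`, or `M k + 1` if there is none. -/
noncomputable def g (k : Fin 4) (j : ℕ) : ℕ := sInf {d | j ≤ C.f k d ∨ C.M k < d}

theorem g_of_lt {k : Fin 4} {j : ℕ} (hj : C.M (k + 1) < j) : C.g k j = C.M k + 1 := by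
  have : {d | j ≤ C.f k d ∨ C.M k < d} = {d | C.M k + 1 ≤ d} := by
    ext d
    have := C.le k d
    simp only [mem_ofPred_eq]
    omega
  rw [g, this]
  exact csInf_Ici

/-- On the chains `g k` is the lower adjoint of `f k`, with the extra value `M k + 1` if `f k` stays
below `j` throughout. -/
theorem g_le_iff {k : Fin 4} {j d : ℕ} (hj : j ≤ C.M (k + 1)) : C.g k j ≤ d ↔ j ≤ C.f k d := by
  have hne : {d | j ≤ C.f k d ∨ C.M k < d}.Nonempty := ⟨C.M k + 1, Or.inr (Nat.lt_succ_self _)⟩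
  constructor
  · intro h
    rcases Nat.sInf_mem hne with h1 | h1
    · exact h1.trans (C.mono k h)
    · rw [C.const k d (h1.trans_le h)]; exact hj
  · intro h
    exact Nat.sInf_le (Or.inl h)

theorem lt_g_iff {k : Fin 4} {j d : ℕ} (hj : j ≤ C.M (k + 1)) : d < C.g k j ↔ C.f k d < j := by
  rw [← not_le, C.g_le_iff hj, not_le]

theorem g_le {k : Fin 4} {j : ℕ} (hj : j ≤ C.M (k + 1)) : C.g k j ≤ C.M k + 1 := by
  rw [C.g_le_iff hj, C.const k _ (Nat.lt_succ_self _)]; exact hj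

theorem g_mono {k : Fin 4} {j j' : ℕ} (h : j ≤ j') (hj : j' ≤ C.M (k + 1)) :
    C.g k j ≤ C.g k j' := by
  rw [C.g_le_iff (h.trans hj)]
  exact h.trans ((C.g_le_iff hj).1 le_rfl)

theorem g_zero (k : Fin 4) : C.g k 0 = 0 := by
  have := (C.g_le_iff (k := k) (d := 0) (Nat.zero_le _)).2 (Nat.zero_le _)
  omega

/-- The coordinate in direction `k` of the `j`-th rectangle of chain `i`. -/
noncomputable def coord (k i : Fin 4) (j : ℕ) : ℤ :=
  ![(j : ℤ) + 2, C.f i j + 2, -(j + 1), C.g k j + 1] (k - i)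

theorem coord_zero (k : Fin 4) (j : ℕ) : C.coord k k j = j + 2 := by simp [coord]
theorem coord_one (k : Fin 4) (j : ℕ) : C.coord (k + 1) k j = C.f k j + 2 := by simp [coord]
theorem coord_two (k : Fin 4) (j : ℕ) : C.coord (k + 2) k j = -(j + 1) := by simp [coord]
theorem coord_three (k : Fin 4) (j : ℕ) : C.coord (k + 3) k j = C.g (k + 3) j + 1 := by
  simp [coord]
theorem coord_one' (k : Fin 4) (j : ℕ) : C.coord k (k + 1) j = C.g k j + 1 := by
  have := C.coord_three (k + 1) j
  rwa [add_one_three] at this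
theorem coord_two' (k : Fin 4) (j : ℕ) : C.coord k (k + 2) j = -(j + 1) := by
  have := C.coord_two (k + 2) j
  rwa [add_two_two] at this
theorem coord_three' (k : Fin 4) (j : ℕ) : C.coord k (k + 3) j = C.f (k + 3) j + 2 := by
  have := C.coord_one (k + 3) j
  rwa [add_three_one] at this
theorem coord_one_three (k : Fin 4) (j : ℕ) : C.coord (k + 1) (k + 3) j = -(j + 1) := by
  rw [← add_one_two, coord_two']
theorem coord_two_one (k : Fin 4) (j : ℕ) : C.coord (k + 2) (k + 1) j = C.f (k + 1) j + 2 := by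
  rw [← add_one_one, coord_one]
theorem coord_two_three (k : Fin 4) (j : ℕ) : C.coord (k + 2) (k + 3) j = C.g (k + 2) j + 1 := by
  rw [← add_two_one, coord_one']
theorem coord_three_one (k : Fin 4) (j : ℕ) : C.coord (k + 3) (k + 1) j = -(j + 1) := by
  rw [← add_one_two, coord_two]

/-- The centre (`none`) and the rectangles of the four chains. -/
abbrev Node : Type := Option (Σ k : Fin 4, Fin (C.M k + 1))

theorem card_node : Fintype.card C.Node = ∑ k, C.M k + 5 := by
  simp [Finset.sum_add_distrib]

/-- The `j`-th rectangle of chain `k`. -/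
def node (k : Fin 4) (j : ℕ) (hj : j ≤ C.M k) : C.Node := some ⟨k, j, Nat.lt_succ_of_le hj⟩

theorem node_cases {motive : C.Node → Prop} (none : motive none)
    (node : ∀ k j hj, motive (C.node k j hj)) (p : C.Node) : motive p := by
  rcases p with _ | ⟨k, j, hj⟩
  · exact none
  · exact node k j (Nat.le_of_lt_succ hj)

/-- The coordinates of the sides of a node, measured outwards. -/
noncomputable def v (k : Fin 4) : C.Node → ℤ
  | none => 1
  | some ⟨i, j⟩ => C.coord k i j

@[simp] theorem v_none (k : Fin 4) : C.v k none = 1 := rfl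
@[simp] theorem v_node (k i : Fin 4) (j : ℕ) (hj) : C.v k (C.node i j hj) = C.coord k i j := rfl

theorem v_ne_zero (k : Fin 4) (p : C.Node) : C.v k p ≠ 0 := by
  induction p using C.node_cases with
  | none => simp
  | node i j hj =>
    rw [v_node]
    rcases Direction.cases k i with rfl | rfl | rfl | rfl <;>
      simp only [coord_zero, coord_one', coord_two', coord_three'] <;> omega

theorem v_pos (k : Fin 4) (p : C.Node) : 0 < C.v k p + C.v (k + 2) p := by
  induction p using C.node_cases with
  | none => simp
  | node i j hj =>
    rw [v_node, v_node]
    rcases Direction.cases k i with rfl | rfl | rfl | rfl <;>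
      simp only [coord_zero, coord_two, coord_one', coord_two', coord_three', coord_two_one,
        coord_two_three] <;> omega

theorem v_le (k : Fin 4) (p : C.Node) : C.v k p ≤ C.M k + 2 := by
  induction p using C.node_cases with
  | none => simp; omega
  | node i j hj =>
    rw [v_node]
    rcases Direction.cases k i with rfl | rfl | rfl | rfl
    · rw [coord_zero]; omega
    · rw [coord_one']; have := C.g_le hj; omega
    · rw [coord_two']; omega
    · rw [coord_three']; have := C.le (k + 3) j; rw [add_three_one] at this; omega

/-- Distinct nodes are separated. -/
theorem exists_v_le {p q : C.Node} (h : p ≠ q) : ∃ k, C.v k p ≤ -C.v (k + 2) q := by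
  induction p using C.node_cases with
  | none =>
    induction q using C.node_cases with
    | none => exact absurd rfl h
    | node i j hj => exact ⟨i, by rw [v_node, coord_two, v_none]; omega⟩
  | node i j hj =>
    induction q using C.node_cases with
    | none => exact ⟨i + 2, by rw [v_node, coord_two, v_none]; omega⟩
    | node i' j' hj' =>
      simp only [v_node]
      rcases Direction.cases i i' with rfl | rfl | rfl | rfl
      · rcases lt_trichotomy j j' with hlt | rfl | hlt
        · exact ⟨i', by rw [coord_zero, coord_two]; omega⟩
        · exact absurd rfl h
        · exact ⟨i' + 2, by rw [add_two_two, coord_zero, coord_two]; omega⟩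
      -- Either rectangle `j` ends before the inner side of rectangle `j'` of the next chain, or, by
      -- the adjunction, `j'` ends before the inner side of `j`.
      · rcases lt_or_ge (C.f i j) j' with hlt | hge
        · exact ⟨i + 1, by rw [add_one_two, coord_one, coord_three_one]; omega⟩
        · rw [← C.g_le_iff hj'] at hge
          exact ⟨i + 2, by rw [add_two_two, coord_two, coord_one']; omega⟩
      · exact ⟨i + 2, by rw [add_two_two, coord_two, coord_two']; omega⟩
      · have e := C.coord_one (i + 3) j'
        have e2 := C.coord_two (i + 3) j'
        have e3 := C.coord_two i j
        have e4 := C.coord_three i j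
        rw [add_three_one] at e
        rw [add_three_two] at e2
        rcases lt_or_ge (C.f (i + 3) j') j with hlt | hge
        · exact ⟨i + 2, by rw [add_two_two]; omega⟩
        · rw [← C.g_le_iff (by rwa [add_three_one])] at hge
          exact ⟨i + 3, by rw [add_three_two]; omega⟩

/-- The nodes cover the whole rectangle. -/
theorem exists_node_cover {X : Fin 4 → ℤ → ℝ} (mono : ∀ k, StrictMono (X k))
    (neg : ∀ k t, X (k + 2) (-t) = -X k t) {P : Fin 4 → ℝ} (hP : ∀ k, P (k + 2) = -P k)
    (hle : ∀ k, P k ≤ X k (C.M k + 2)) : ∃ p, ∀ k, P k ≤ X k (C.v k p) := by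
  have index : ∀ k (a : ℕ), X k (a + 1) < P k →
      ∃ j, a ≤ j ∧ j ≤ C.M k ∧ X k (j + 1) < P k ∧ P k ≤ X k (j + 2) := by
    intro k a ha
    have ex : ∃ j : ℕ, P k ≤ X k (j + 2) := ⟨C.M k, hle k⟩
    classical
    have h1 := Nat.find_spec ex
    have h2 : Nat.find ex ≤ C.M k := Nat.find_min' ex (hle k)
    have h3 : a ≤ Nat.find ex := by
      by_contra! h
      have := (mono k).monotone (show ((Nat.find ex : ℕ) : ℤ) + 2 ≤ a + 1 by omega)
      linarith
    refine ⟨Nat.find ex, h3, h2, ?_, h1⟩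
    rcases h3.lt_or_eq with h4 | h4
    · have := Nat.find_min ex (m := Nat.find ex - 1) (by omega)
      rw [not_le] at this
      have e : ((Nat.find ex - 1 : ℕ) : ℤ) + 2 = Nat.find ex + 1 := by omega
      rwa [e] at this
    · rwa [← h4]
  have opp : ∀ k, X k 1 < P k → ∀ t : ℤ, 1 ≤ t → P (k + 2) ≤ X (k + 2) t := by
    intro k h t ht
    rw [hP]
    have h1 := neg k (-1)
    rw [neg_neg] at h1
    have h2 := mono k (show (-1 : ℤ) < 1 by norm_num)
    have h3 := (mono (k + 2)).monotone ht
    linarith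
  have inner : ∀ k (j : ℕ), X k (j + 1) < P k → P (k + 2) ≤ X (k + 2) (-(j + 1)) := by
    intro k j h
    rw [neg, hP]; linarith
  by_cases h0 : ∀ k, P k ≤ X k 1
  · exact ⟨none, h0⟩
  push Not at h0
  obtain ⟨k, hk⟩ := h0
  -- Beyond side `k` of the centre, the point lies in the strip of some rectangle `j` of chain `k`.
  -- If it is past the end of this rectangle in direction `k + 1` or `k + 3`, it lies in the strip
  -- of a rectangle of that neighbouring chain, which by the adjunction reaches across strip `j`.
  obtain ⟨j, -, hj, hj1, hj2⟩ := index k 0 (by simpa using hk)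
  rcases le_or_gt (P (k + 1)) (X (k + 1) (C.f k j + 2)) with h1 | h1
  · rcases le_or_gt (P (k + 3)) (X (k + 3) (C.g (k + 3) j + 1)) with h3 | h3
    · refine ⟨C.node k j hj, fun i => ?_⟩
      rw [v_node]
      rcases Direction.cases k i with rfl | rfl | rfl | rfl
      · rwa [coord_zero]
      · rwa [coord_one]
      · rw [coord_two]; exact inner _ _ hj1
      · rwa [coord_three]
    · obtain ⟨d, hd0, hd, hd1, hd2⟩ := index (k + 3) _ h3
      have hjM : j ≤ C.M (k + 3 + 1) := by rwa [add_three_one]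
      rw [C.g_le_iff hjM] at hd0
      refine ⟨C.node (k + 3) d hd, fun i => ?_⟩
      rw [v_node]
      rcases Direction.cases k i with rfl | rfl | rfl | rfl
      · rw [coord_three']
        exact hj2.trans ((mono _).monotone (by omega))
      · rw [coord_one_three]
        have := inner _ _ hd1
        rwa [add_three_two] at this
      · rw [coord_two_three]
        exact opp k hk _ (by omega)
      · rw [coord_zero]; exact hd2
  · obtain ⟨b, hb0, hb, hb1, hb2⟩ := index (k + 1) (C.f k j + 1) (by
      rw [Nat.cast_add, Nat.cast_one, add_assoc]; exact h1)
    have hg : j < C.g k b := (C.lt_g_iff hb).2 (by omega)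
    refine ⟨C.node (k + 1) b hb, fun i => ?_⟩
    rw [v_node]
    rcases Direction.cases k i with rfl | rfl | rfl | rfl
    · rw [coord_one']
      exact hj2.trans ((mono _).monotone (by omega))
    · rw [coord_zero]; exact hb2
    · rw [coord_two_one]
      exact opp k hk _ (by omega)
    · rw [coord_three_one]
      have := inner _ _ hb1
      rwa [add_one_two] at this

end SpiralCode

/-- The rectangulation `R` has the shape described by the code `C`. -/
structure Spiral {n : ℕ} (R : Rectangulation n) (C : SpiralCode) where
  cell : C.Node ≃ Fin n
  X : Fin 4 → ℤ → ℝ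
  mono : ∀ k, StrictMono (X k)
  neg : ∀ k t, X (k + 2) (-t) = -X k t
  ext : ∀ k p, R.ext k (cell p) = X k (C.v k p)
  bd : ∀ k, R.bd k = X k (C.M k + 2)

/-! ### Four arms form a spiral -/

namespace Rectangulation

variable {n : ℕ} {R : Rectangulation n}

theorem mem_cell_iff_ext {c : Fin n} {x y : ℝ} :
    (x, y) ∈ R.cell c ↔ ∀ k, ![x, -y, -x, y] k ≤ R.ext k c := by
  simp only [mem_cell, Fin.forall_fin_succ, ext]
  simp
  tauto

namespace Arm

variable {z : Fin n} {s : Fin 4 → ℕ → Fin n} {M : Fin 4 → ℕ}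
  (A : ∀ k, R.Arm z k (s k) (M k)) {k : Fin 4} {i j b : ℕ}

include A

theorem ext_one_le (hij : i ≤ j) (hj : j ≤ M k) :
    R.ext (k + 1) (s k i) ≤ R.ext (k + 1) (s k j) := by
  induction j, hij using Nat.le_induction with
  | base => exact le_rfl
  | succ j hij ih => exact (ih (by omega)).trans ((A k).le_succ j (by omega))

theorem ext_three_le (hij : i ≤ j) (hj : j ≤ M k) :
    R.ext (k + 3) (s k i) ≤ R.ext (k + 3) (s k j) := by
  induction j, hij using Nat.le_induction with
  | base => exact le_rfl
  | succ j hij ih => exact (ih (by omega)).trans ((A k).le_succ' j (by omega))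

theorem ext_lt (hij : i < j) (hj : j ≤ M k) : R.ext k (s k i) < R.ext k (s k j) := by
  induction j, hij using Nat.le_induction with
  | base =>
    have := (A k).abut i (by omega)
    have := R.ext_pos k (s k (i + 1))
    linarith
  | succ j hij ih =>
    have := (A k).abut j (by omega)
    have := R.ext_pos k (s k (j + 1))
    have := ih (by omega)
    linarith

theorem lt_ext_one (hj : j ≤ M k) : R.ext (k + 1) z < R.ext (k + 1) (s k j) :=
  (A k).lt_start.trans_le (ext_one_le A (Nat.zero_le j) hj)

theorem le_ext_three (hj : j ≤ M k) : R.ext (k + 3) z ≤ R.ext (k + 3) (s k j) :=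
  (A k).start'.ge.trans (ext_three_le A (Nat.zero_le j) hj)

theorem le_inner (hj : j ≤ M k) : R.ext k z ≤ -R.ext (k + 2) (s k j) := by
  rcases Nat.eq_zero_or_pos j with rfl | h
  · have := (A k).start; linarith
  · obtain ⟨j, rfl⟩ := Nat.exists_eq_add_of_lt h
    simp only [zero_add] at hj ⊢
    have h1 := (A k).abut j (by omega)
    have h2 := (A k).start
    have h3 := R.ext_pos k (s k 0)
    rcases Nat.eq_zero_or_pos j with rfl | h'
    · linarith
    · have := ext_lt A (k := k) h' (by omega)
      linarith

theorem ne_next (hj : j ≤ M k) (hb : b ≤ M (k + 1)) : s k j ≠ s (k + 1) b := by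
  intro h
  have h1 := le_inner A hj
  have h2 := lt_ext_one A hb
  rw [add_one_one, ← h] at h2
  have := R.ext_pos k z
  linarith

/-- At a corner, one of two segments ends at or before the other one. -/
theorem le_or_le (hj : j ≤ M k) (hb : b ≤ M (k + 1)) :
    R.ext (k + 1) (s (k + 1) b) ≤ R.ext (k + 1) (s k j) ∨
      R.ext k (s k j) ≤ R.ext k (s (k + 1) b) := by
  induction hN : j + b using Nat.strong_induction_on generalizing j b with
  | _ N ih =>
    by_contra! H
    obtain ⟨h1, h2⟩ := H
    -- The corner statement for the preceding rectangle of one arm shows that the two rectangles at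
    -- least touch.
    have hp : -R.ext (k + 2) (s k j) ≤ R.ext k (s (k + 1) b) := by
      rcases j with _ | j
      · have := le_ext_three A hb
        rw [add_one_three] at this
        rw [(A k).start, neg_neg]; exact this
      · have h3 := ext_one_le A (Nat.le_succ j) hj
        have h4 := (A k).abut j (by omega)
        rcases ih (j + b) (by omega) (by omega) hb rfl with h | h <;> linarith
    have hq : -R.ext (k + 3) (s (k + 1) b) ≤ R.ext (k + 1) (s k j) := by
      rcases b with _ | b
      · have h3 := (A (k + 1)).start
        rw [add_one_two] at h3
        have := lt_ext_one A hj
        linarith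
      · have h3 := ext_three_le A (Nat.le_succ b) hb
        rw [add_one_three] at h3
        have h4 := (A (k + 1)).abut b (by omega)
        rw [add_one_two] at h4
        rcases ih (j + b) (by omega) hj (by omega) rfl with h | h <;> linarith
    have p0 := R.ext_pos k (s k j)
    have p1 := R.ext_pos (k + 1) (s k j)
    have p2 := R.ext_pos k (s (k + 1) b)
    have p3 := R.ext_pos (k + 1) (s (k + 1) b)
    rw [add_one_two] at p1 p3
    -- If both inequalities are strict, the two rectangles overlap. If one is an equality, a side of
    -- one rectangle would prolong the inner side of the other, which is a whole segment.
    rcases hp.lt_or_eq with hp' | hp'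
    · rcases hq.lt_or_eq with hq' | hq'
      · obtain ⟨i, hi⟩ := R.exists_ext_le (ne_next A hj hb)
        rcases Direction.cases k i with rfl | rfl | rfl | rfl
        · linarith
        · rw [add_one_two] at hi; linarith
        · rw [add_two_two] at hi; linarith
        · rw [add_three_two] at hi; linarith
      · have := (A (k + 1)).full b hb (s k j)
        simp only [add_one_two, add_three_one, add_three_two, add_three_three] at this
        have := (this (Or.inr (by linarith)) (by linarith) (by linarith)).1
        linarith
    · have := (A k).full j hj (s (k + 1) b)
      simp only [add_two_one, add_two_two, add_two_three] at this
      have := (this (Or.inr (by linarith)) (by linarith) (by linarith)).2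
      linarith

/-- Two distinct rectangles are separated in some direction; the hypothesis and the positions
relative to `z` exclude the other three directions. -/
theorem ext_eq_of_overlap (hj : j ≤ M k) (hb : b ≤ M (k + 1))
    (h : -R.ext (k + 3) (s (k + 1) b) < R.ext (k + 1) (s k j)) :
    R.ext k (s (k + 1) b) ≤ -R.ext (k + 2) (s k j) := by
  obtain ⟨i, hi⟩ := R.exists_ext_le (ne_next A hj hb)
  have h1 := le_inner A hj
  have h2 := lt_ext_one A hb
  have h3 := le_ext_three A hj
  have h4 := le_inner A hb
  have p0 := R.ext_pos k (s k j)
  have p3 := R.ext_pos (k + 1) (s (k + 1) b)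
  have z0 := R.ext_pos k z
  have z1 := R.ext_pos (k + 1) z
  rw [add_one_one] at h2
  rw [add_one_two] at h4 p3 z1
  rcases Direction.cases k i with rfl | rfl | rfl | rfl
  · linarith
  · rw [add_one_two] at hi; linarith
  · rw [add_two_two] at hi; linarith
  · rw [add_three_two] at hi; linarith

/-- Take the last `b` whose inner side lies strictly before the end of `s k j`. By maximality `s k
j` does not reach beyond `b`, and by `le_or_le` it does not stop earlier, since the other
alternative contradicts `ext_eq_of_overlap`. -/
theorem exists_ext_eq (hj : j ≤ M k) :
    ∃ b ≤ M (k + 1), R.ext (k + 1) (s k j) = R.ext (k + 1) (s (k + 1) b) := by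
  classical
  set P : ℕ → Prop := fun b => -R.ext (k + 3) (s (k + 1) b) < R.ext (k + 1) (s k j)
  have hP0 : P 0 := by
    have h3 := (A (k + 1)).start
    rw [add_one_two] at h3
    have := lt_ext_one A hj
    show -R.ext (k + 3) (s (k + 1) 0) < R.ext (k + 1) (s k j)
    linarith
  have hb := Nat.findGreatest_le (P := P) (M (k + 1))
  have hPb : P (Nat.findGreatest P (M (k + 1))) := Nat.findGreatest_spec (Nat.zero_le _) hP0
  refine ⟨Nat.findGreatest P (M (k + 1)), hb, le_antisymm ?_ ?_⟩
  · rcases hb.lt_or_eq with h | h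
    · have h1 : ¬ P (Nat.findGreatest P (M (k + 1)) + 1) :=
        Nat.findGreatest_is_greatest (Nat.lt_succ_self _) h
      have h2 := (A (k + 1)).abut _ h
      rw [add_one_two] at h2
      rw [h2]
      exact not_lt.1 h1
    · rw [h, (A (k + 1)).outer]; exact R.ext_le_bd _ _
  · rcases le_or_le A hj hb with h | h
    · exact h
    · have h1 := ext_eq_of_overlap A hj hb hPb
      have h2 := R.ext_pos k (s k j)
      linarith

open Classical in
/-- The chain rectangle at which the `j`-th rectangle of chain `k` ends. -/
theorem exists_code : ∃ C : SpiralCode, C.M = M ∧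
    ∀ k, ∀ j ≤ M k, R.ext (k + 1) (s k j) = R.ext (k + 1) (s (k + 1) (C.f k j)) := by
  choose! f hf1 hf2 using fun k j (hj : j ≤ M k) => exists_ext_eq A hj
  refine ⟨⟨M, fun k j => if j ≤ M k then f k j else M (k + 1), ?_, ?_, ?_⟩, rfl, ?_⟩
  · intro k i j hij
    by_cases hj : j ≤ M k
    · simp only [hj, hij.trans hj, if_true]
      by_contra! h
      have h1 := ext_one_le A hij hj
      rw [hf2 k i (hij.trans hj), hf2 k j hj] at h1
      have := ext_lt A h (hf1 k i (hij.trans hj))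
      linarith
    · simp only [hj, if_false]
      split_ifs with h
      · exact hf1 k i h
      · exact le_rfl
  · intro k j
    split_ifs with h
    · exact hf1 k j h
    · exact le_rfl
  · intro k j hj
    simp [not_le.2 hj]
  · intro k j hj
    simp only [hj, if_true]
    exact hf2 k j hj

-- Positive indices run through the inner sides of arm `k`, then the border, then arbitrary values
-- at distance 1; negative ones come from arm `k + 2`. Index 0 gets the midpoint of the centre,
-- compatible with both monotonicity and the change of sign.
open Classical in
theorem exists_lines : ∃ X : Fin 4 → ℤ → ℝ, (∀ k, StrictMono (X k)) ∧
    (∀ k t, X (k + 2) (-t) = -X k t) ∧ (∀ k, ∀ j ≤ M k, -R.ext (k + 2) (s k j) = X k (j + 1)) ∧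
    ∀ k, R.bd k = X k (M k + 2) := by
  set L : Fin 4 → ℕ → ℝ := fun k j =>
    if j ≤ M k then -R.ext (k + 2) (s k j) else R.bd k + ((j : ℝ) - M k - 1) with hL
  have hmono : ∀ k, StrictMono (L k) := by
    intro k
    refine strictMono_nat_of_lt_succ fun j => ?_
    simp only [hL]
    rcases lt_trichotomy j (M k) with h | h | h
    · rw [if_pos h.le, if_pos (by omega), ← (A k).abut j h]
      have := R.ext_pos k (s k j)
      linarith
    · subst h
      have := R.ext_pos k (s k (M k))
      rw [if_pos le_rfl, if_neg (by omega), ← (A k).outer]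
      push_cast
      linarith
    · rw [if_neg (by omega), if_neg (by omega)]
      push_cast
      linarith
  have h0 : ∀ k, 0 < L k 0 + L (k + 2) 0 := by
    intro k
    simp only [hL, Nat.zero_le, if_true]
    have h1 := (A k).start
    have h2 := (A (k + 2)).start
    have := R.ext_pos k z
    rw [add_two_two] at h2 ⊢
    linarith
  refine ⟨fun k t => if 0 < t then L k (t - 1).toNat else if t < 0 then -L (k + 2) (-t - 1).toNat
    else (L k 0 - L (k + 2) 0) / 2, ?_, ?_, ?_, ?_⟩
  · intro k a b hab
    have m1 := hmono k
    have m2 := hmono (k + 2)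
    have h0k := h0 k
    have g1 : ∀ a, L k 0 ≤ L k a := fun a => m1.monotone (Nat.zero_le a)
    have g2 : ∀ a, L (k + 2) 0 ≤ L (k + 2) a := fun a => m2.monotone (Nat.zero_le a)
    simp only
    rcases lt_trichotomy a 0 with ha | ha | ha <;> rcases lt_trichotomy b 0 with hb | hb | hb <;>
      try omega
    · rw [if_neg (by omega), if_pos ha, if_neg (by omega), if_pos hb]
      exact neg_lt_neg (m2 (by omega))
    · rw [if_neg (by omega), if_pos ha, if_neg (by omega), if_neg (by omega)]
      have := g2 (-a - 1).toNat
      linarith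
    · rw [if_neg (by omega), if_pos ha, if_pos hb]
      have := g2 (-a - 1).toNat
      have := g1 (b - 1).toNat
      linarith
    · rw [if_neg (by omega), if_neg (by omega), if_pos hb]
      have := g1 (b - 1).toNat
      linarith
    · rw [if_pos ha, if_pos hb]
      exact m1 (by omega)
  · intro k t
    simp only [add_two_two]
    rcases lt_trichotomy t 0 with ha | ha | ha
    · rw [if_pos (by omega), if_neg (by omega), if_pos ha, neg_neg]
    · subst ha; simp; ring
    · rw [if_neg (by omega), if_pos (by omega), if_pos ha, neg_neg]
  · intro k j hj
    simp only
    rw [if_pos (by omega)]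
    have : ((j : ℤ) + 1 - 1).toNat = j := by omega
    simp only [this, hL, hj, if_true]
  · intro k
    simp only
    rw [if_pos (by omega)]
    have : ((M k : ℤ) + 2 - 1).toNat = M k + 1 := by omega
    rw [this]
    simp [hL]

theorem exists_spiral : ∃ (C : SpiralCode) (S : Spiral R C), S.cell none = z := by
  obtain ⟨C, hM, hf⟩ := exists_code A
  subst hM
  obtain ⟨X, mono, neg, hin, hbd⟩ := exists_lines A
  have hout : ∀ k, ∀ j ≤ C.M k, R.ext k (s k j) = X k (j + 2) := by
    intro k j hj
    rcases hj.lt_or_eq with h | h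
    · rw [(A k).abut j h, hin k (j + 1) h]
      push_cast
      rw [add_assoc]; rfl
    · rw [h, (A k).outer, hbd]
  have hz : ∀ k, R.ext k z = X k 1 := by
    intro k
    have h1 := (A k).start
    have h2 := hin k 0 (Nat.zero_le _)
    simp only [Nat.cast_zero, zero_add] at h2
    linarith
  have hup : ∀ k, ∀ j ≤ C.M k, R.ext (k + 1) (s k j) = X (k + 1) (C.f k j + 2) := by
    intro k j hj
    rw [hf k j hj, hout _ _ (C.le k j)]
  -- Rectangle `g k j` of arm `k` ends at or beyond the inner side of rectangle `j`, which bounds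
  -- the end of `j` from above. The preceding rectangle `d` has `f k d < j`, so by `le_or_le`
  -- rectangle `j` reaches the outer side of `d`.
  have hdown : ∀ k, ∀ j ≤ C.M (k + 1), R.ext k (s (k + 1) j) = X k (C.g k j + 1) := by
    intro k j hj
    apply le_antisymm
    · rcases (C.g_le hj).lt_or_eq with h | h
      · have hd : C.g k j ≤ C.M k := by omega
        rw [← hin k _ hd]
        apply ext_eq_of_overlap A hd hj
        rw [hup k _ hd]
        have h1 := hin (k + 1) j hj
        rw [add_one_two] at h1
        rw [h1]
        apply mono
        have := (C.g_le_iff hj).1 (le_refl (C.g k j))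
        omega
      · rw [h]
        push_cast
        rw [add_assoc]
        exact (R.ext_le_bd _ _).trans (hbd k).le
    · rcases Nat.eq_zero_or_pos (C.g k j) with h | h
      · rw [h]
        have := le_ext_three A hj
        rw [add_one_three, hz] at this
        simpa using this
      · obtain ⟨d, hd⟩ := Nat.exists_eq_add_of_lt h
        rw [zero_add] at hd
        have hdM : d ≤ C.M k := by have := C.g_le hj; omega
        have hlt : C.f k d < j := (C.lt_g_iff hj).1 (by omega)
        rw [hd]
        push_cast
        rw [add_assoc, one_add_one_eq_two, ← hout k d hdM]
        refine (le_or_le A hdM hj).resolve_left ?_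
        rw [not_le, hup k d hdM, hout _ _ hj]
        exact mono _ (by omega)
  set c : C.Node → Fin n := fun p => p.elim z fun q => s q.1 q.2 with hc
  have hcn : ∀ k j hj, c (C.node k j hj) = s k j := fun _ _ _ => rfl
  have hext : ∀ k p, R.ext k (c p) = X k (C.v k p) := by
    intro k p
    induction p using C.node_cases with
    | none => exact hz k
    | node i j hj =>
      rw [hcn, C.v_node]
      rcases Direction.cases i k with rfl | rfl | rfl | rfl
      · rw [C.coord_zero, hout k j hj]
      · rw [C.coord_one, hup i j hj]
      · have := hin i j hj
        rw [C.coord_two, neg]; linarith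
      · rw [C.coord_three]
        have := hdown (i + 3) j
        rw [add_three_one] at this
        exact this hj
  have hinj : Function.Injective c := by
    intro p q hpq
    by_contra hne
    obtain ⟨k, hk⟩ := C.exists_v_le hne
    have h1 := (mono k).monotone hk
    have h2 := hext (k + 2) q
    have h3 := neg (k + 2) (C.v (k + 2) q)
    rw [add_two_two] at h3
    rw [h3, ← hext, ← hext, hpq] at h1
    have := R.ext_pos k (c q)
    linarith
  -- An interior point of any rectangle is covered by the centre or an arm, and it lies in only one
  -- rectangle.
  have hsurj : Function.Surjective c := by
    intro i
    have a1 := R.left_lt_right i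
    have a2 := R.bottom_lt_top i
    obtain ⟨x, hx1, hx2⟩ := exists_between a1
    obtain ⟨y, hy1, hy2⟩ := exists_between a2
    have hmem : (x, y) ∈ R.cell i := R.mem_cell.2 ⟨⟨hx1.le, hx2.le⟩, hy1.le, hy2.le⟩
    obtain ⟨p, hp⟩ := C.exists_node_cover mono neg (P := ![x, -y, -x, y])
      (by intro k; fin_cases k <;> simp)
      (fun k => ((mem_cell_iff_ext.1 hmem k).trans (R.ext_le_bd k i)).trans (hbd k).le)
    refine ⟨p, R.eq_of_mem_interior hx1 hx2 hy1 hy2 ?_⟩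
    rw [mem_cell_iff_ext]
    intro k
    rw [hext]; exact hp k
  exact ⟨C, ⟨Equiv.ofBijective c ⟨hinj, hsurj⟩, X, mono, neg, hext, hbd⟩, rfl⟩

end Arm

theorem exists_spiral (hR : R.Clean) {a b c d : ℝ} (hw : R.IsWindmill a b c d) {z : Fin n}
    (hz : R.cell z = Icc a b ×ˢ Icc c d) :
    ∃ (C : SpiralCode) (S : Spiral R C), S.cell none = z := by
  choose s M A using exists_arm hR hw hz
  exact Arm.exists_spiral A

end Rectangulation

/-! ### Valid codes and cycles of the maps -/

namespace SpiralCode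

variable (C : SpiralCode)

/-- The maps preserve the greatest elements, and the composite of all four moves every other
element up. -/
def Valid : Prop := (∀ k, C.f k (C.M k) = C.M (k + 1)) ∧
  ∀ k, ∀ j < C.M k, j < C.f (k + 3) (C.f (k + 2) (C.f (k + 1) (C.f k j)))

variable {C}

theorem g_le_of_top (h : ∀ k, C.f k (C.M k) = C.M (k + 1)) {k : Fin 4} {j : ℕ}
    (hj : j ≤ C.M (k + 1)) : C.g k j ≤ C.M k := by
  rw [C.g_le_iff hj, h]; exact hj

/-- The least `j` with `φ j ≤ j` is fixed: by monotonicity `φ j` has the same property. -/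
theorem exists_fixed_of_map_le {φ : ℕ → ℕ} (hφ : Monotone φ) {m : ℕ} (hm : φ m ≤ m) :
    ∃ j ≤ m, φ j = j := by
  classical
  have ex : ∃ j, φ j ≤ j := ⟨m, hm⟩
  refine ⟨Nat.find ex, Nat.find_min' ex hm, le_antisymm (Nat.find_spec ex) ?_⟩
  exact Nat.find_min' ex (hφ (Nat.find_spec ex))

/-- Cycles of this kind are the mirror windmills. If no greatest element is preserved, the maps `j ↦
f k j + 1` stay inside the chains, and their monotone composite has a fixed point. -/
theorem exists_f_cycle (h : ∀ k, C.f k (C.M k) < C.M (k + 1)) :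
    ∃ j : Fin 4 → ℕ, ∀ k, j k ≤ C.M k ∧ j (k + 1) = C.f k (j k) + 1 := by
  have hle : ∀ k j, j ≤ C.M k → C.f k j + 1 ≤ C.M (k + 1) := fun k j hj =>
    (Nat.add_le_add_right (C.mono k hj) 1).trans (h k)
  obtain ⟨j, hj, hfix⟩ := exists_fixed_of_map_le
    (φ := fun j => C.f 3 (C.f 2 (C.f 1 (C.f 0 j + 1) + 1) + 1) + 1) (m := C.M 0)
    (fun a b hab => by
      have h0 := C.mono 0 hab
      have h1 := C.mono 1 (Nat.add_le_add_right h0 1)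
      have h2 := C.mono 2 (Nat.add_le_add_right h1 1)
      exact Nat.add_le_add_right (C.mono 3 (Nat.add_le_add_right h2 1)) 1)
    (hle 3 _ (hle 2 _ (hle 1 _ (hle 0 _ le_rfl))))
  refine ⟨![j, C.f 0 j + 1, C.f 1 (C.f 0 j + 1) + 1, C.f 2 (C.f 1 (C.f 0 j + 1) + 1) + 1], ?_⟩
  have b0 := hle 0 _ hj
  have b1 := hle 1 _ b0
  have b2 := hle 2 _ b1
  intro k
  fin_cases k
  · exact ⟨hj, rfl⟩
  · exact ⟨b0, rfl⟩
  · exact ⟨b1, rfl⟩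
  · exact ⟨b2, hfix.symm⟩

/-- By monotonicity the composite of the four maps sends `j 0` strictly below itself, contrary to
validity. The greatest element of chain 0 is no exception, as its successor in the cycle would leave
chain 1. -/
theorem not_f_cycle (h : C.Valid) (j : Fin 4 → ℕ) :
    ¬ ∀ k, j k ≤ C.M k ∧ j (k + 1) = C.f k (j k) + 1 := by
  intro H
  rcases (H 0).1.lt_or_eq with h0 | h0
  · have := h.2 0 _ h0
    have h1 : C.f 0 (j 0) ≤ j 1 := by have := (H 0).2; simp only [zero_add] at this; omega
    have h2 : C.f 1 (j 1) ≤ j 2 := by have := (H 1).2; simp only [Fin.isValue, Fin.reduceAdd] at this; omega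
    have h3 : C.f 2 (j 2) ≤ j 3 := by have := (H 2).2; simp only [Fin.isValue, Fin.reduceAdd] at this; omega
    have h4 : C.f 3 (j 3) < j 0 := by have := (H 3).2; simp only [Fin.isValue, Fin.reduceAdd] at this; omega
    simp only [zero_add] at this
    have := C.mono 3 ((C.mono 2 ((C.mono 1 h1).trans h2)).trans h3)
    omega
  · have h1 := (H 0).2
    have h2 := (H (0 + 1)).1
    rw [h1, h0, h.1 0] at h2
    omega

/-- Cycles of `g` are the windmills, and the zero cycle is the centre. Zero propagates around a
cycle. If all entries are positive, the adjunction gives `f i (j i - 1) ≤ j (i + 1) - 1`, so the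
composite of the `f` does not move `j k - 1` up. -/
theorem g_cycle_eq_zero (h : C.Valid) {j : Fin 4 → ℕ}
    (H : ∀ k, j k ≤ C.M k ∧ j k = C.g k (j (k + 1))) (k : Fin 4) : j k = 0 := by
  have prev : ∀ k, j (k + 1) = 0 → j k = 0 := by
    intro k hk
    rw [(H k).2, hk, C.g_zero]
  have all : ∀ i, j i = 0 → ∀ k, j k = 0 := by
    intro i hi k
    have h3 : j (i + 3) = 0 := prev _ (by rwa [add_three_one])
    have h2 : j (i + 2) = 0 := prev _ (by rwa [add_two_one])
    have h1 : j (i + 1) = 0 := prev _ (by rwa [add_one_one])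
    rcases Direction.cases i k with rfl | rfl | rfl | rfl <;> assumption
  by_contra hk
  have hpos : ∀ i, 0 < j i := fun i => Nat.pos_of_ne_zero fun hi => hk (all i hi k)
  have key : ∀ i, C.f i (j i - 1) ≤ j (i + 1) - 1 := by
    intro i
    have h1 : j i - 1 < C.g i (j (i + 1)) := by
      rw [← (H i).2]; have := hpos i; omega
    rw [C.lt_g_iff (H (i + 1)).1] at h1
    omega
  have h1 := h.2 k (j k - 1) (by have := hpos k; have := (H k).1; omega)
  have k0 := key k
  have k1 := key (k + 1)
  have k2 := key (k + 2)
  have k3 := key (k + 3)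
  rw [add_one_one] at k1
  rw [add_two_one] at k2
  rw [add_three_one] at k3
  have := C.mono (k + 3) ((C.mono (k + 2) ((C.mono (k + 1) k0).trans k1)).trans k2)
  omega

/-- If the composite of the `f` does not move `j` up, the adjunction gives `j + 1 ≤ G (j + 1)` for
the composite `G` of the `g`. The greatest `b` with `b ≤ G b` is then a nonzero fixed point. -/
theorem exists_g_cycle (h : ∀ k, C.f k (C.M k) = C.M (k + 1)) (h' : ¬ C.Valid) :
    ∃ j : Fin 4 → ℕ, (∀ k, j k ≤ C.M k ∧ j k = C.g k (j (k + 1))) ∧ ∃ k, j k ≠ 0 := by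
  obtain ⟨k, j, hj, hF⟩ : ∃ k, ∃ j < C.M k,
      C.f (k + 3) (C.f (k + 2) (C.f (k + 1) (C.f k j))) ≤ j := by
    by_contra! H
    exact h' ⟨h, H⟩
  have l3 : ∀ b ≤ C.M k, C.g (k + 3) b ≤ C.M (k + 3) := fun b hb =>
    g_le_of_top h (by rwa [add_three_one])
  have l2 : ∀ b ≤ C.M (k + 3), C.g (k + 2) b ≤ C.M (k + 2) := fun b hb =>
    g_le_of_top h (by rwa [add_two_one])
  have l1 : ∀ b ≤ C.M (k + 2), C.g (k + 1) b ≤ C.M (k + 1) := fun b hb =>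
    g_le_of_top h (by rwa [add_one_one])
  have l0 : ∀ b ≤ C.M (k + 1), C.g k b ≤ C.M k := fun b hb => g_le_of_top h hb
  set G : ℕ → ℕ := fun b => C.g k (C.g (k + 1) (C.g (k + 2) (C.g (k + 3) b))) with hG
  have hGle : ∀ b ≤ C.M k, G b ≤ C.M k := fun b hb => l0 _ (l1 _ (l2 _ (l3 _ hb)))
  have hGmono : ∀ a b, a ≤ b → b ≤ C.M k → G a ≤ G b := by
    intro a b hab hb
    have i3 := C.g_mono (k := k + 3) hab (by rwa [add_three_one])
    have i2 := C.g_mono (k := k + 2) i3 (by rw [add_two_one]; exact l3 _ hb)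
    have i1 := C.g_mono (k := k + 1) i2 (by rw [add_one_one]; exact l2 _ (l3 _ hb))
    exact C.g_mono (k := k) i1 (l1 _ (l2 _ (l3 _ hb)))
  have hstart : j + 1 ≤ G (j + 1) := by
    rw [Nat.succ_le_iff]
    have hb : j + 1 ≤ C.M k := hj
    rw [hG]
    simp only
    rw [C.lt_g_iff (l1 _ (l2 _ (l3 _ hb))), C.lt_g_iff (by rw [add_one_one]; exact l2 _ (l3 _ hb)),
      C.lt_g_iff (by rw [add_two_one]; exact l3 _ hb), C.lt_g_iff (by rwa [add_three_one])]
    omega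
  classical
  have hb := Nat.findGreatest_le (P := fun b => b ≤ G b) (C.M k)
  have hP : Nat.findGreatest (fun b => b ≤ G b) (C.M k) ≤ G _ :=
    Nat.findGreatest_spec (P := fun b => b ≤ G b) hj hstart
  have hpos : j + 1 ≤ Nat.findGreatest (fun b => b ≤ G b) (C.M k) :=
    Nat.le_findGreatest hj hstart
  set b := Nat.findGreatest (fun b => b ≤ G b) (C.M k)
  have hfix : G b = b := by
    refine le_antisymm ?_ hP
    exact Nat.le_findGreatest (P := fun b => b ≤ G b) (hGle b hb) (hGmono _ _ hP (hGle b hb))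
  refine ⟨fun i => ![b, C.g (k + 1) (C.g (k + 2) (C.g (k + 3) b)), C.g (k + 2) (C.g (k + 3) b),
    C.g (k + 3) b] (i - k), fun i => ?_, k, ?_⟩
  · rcases Direction.cases k i with rfl | rfl | rfl | rfl
    · simpa using ⟨hb, hfix.symm⟩
    · have e : k + 1 + 1 - k = 2 := by rw [add_one_one]; simp
      simpa [e] using l1 _ (l2 _ (l3 _ hb))
    · have e : k + 2 + 1 - k = 3 := by rw [add_two_one]; simp
      simpa [e] using l2 _ (l3 _ hb)
    · have e : k + 3 + 1 - k = 0 := by rw [add_three_one]; simp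
      simpa [e] using l3 _ hb
  · simp; omega

/-- A side lying on the `j`-th line of chain `k` is contained in the `j`-th segment. -/
theorem le_of_line {k : Fin 4} {j : ℕ} (hj : j ≤ C.M k + 1) {p : C.Node}
    (h : C.v k p = j + 1 ∨ -C.v (k + 2) p = j + 1) :
    C.v (k + 1) p ≤ C.f k j + 2 ∧ C.v (k + 3) p ≤ C.g (k + 3) j + 1 := by
  rcases (Nat.le_add_one_iff.1 hj) with hj | rfl
  · induction p using C.node_cases with
    | none => simp only [v_none] at h ⊢; omega
    | node i j' hj' =>
      have hj3 : j ≤ C.M (k + 3 + 1) := by rwa [add_three_one]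
      simp only [v_node] at h ⊢
      rcases Direction.cases k i with rfl | rfl | rfl | rfl
      · rw [coord_zero, coord_two] at h
        rw [coord_one, coord_three]
        have hle : j' ≤ j := by omega
        have := C.mono i hle
        have := C.g_mono (k := i + 3) hle hj3
        omega
      · rw [coord_one', coord_two_one] at h
        rw [coord_zero, coord_three_one]
        have := (C.g_le_iff hj' (d := j)).1 (by omega)
        omega
      · rw [coord_two', coord_zero] at h
        omega
      · rw [coord_three', coord_two_three] at h
        rw [coord_one_three, coord_zero]
        have := (C.lt_g_iff hj3 (d := j')).2 (by omega)
        omega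
  -- Line `M k + 1` is the border; here the default values of `f` and `g` give the full side of the
  -- whole rectangle.
  · have h1 := C.v_le (k + 1) p
    have h2 := C.v_le (k + 3) p
    rw [C.const k _ (Nat.lt_succ_self _), C.g_of_lt (by rw [add_three_one]; exact Nat.lt_succ_self _)]
    push_cast
    omega

/-- Sides lie on the lines. -/
theorem exists_line (k : Fin 4) (p : C.Node) :
    (∃ j ≤ C.M k + 1, C.v k p = j + 1) ∨ (∃ j ≤ C.M (k + 2) + 1, C.v k p = -(j + 1)) := by
  have h0 := C.v_ne_zero k p
  have h1 := C.v_le k p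
  have h2 := C.v_le (k + 2) p
  have h3 := C.v_pos k p
  rcases lt_or_gt_of_ne h0 with h | h
  · right; exact ⟨(-C.v k p - 1).toNat, by omega, by omega⟩
  · left; exact ⟨(C.v k p - 1).toNat, by omega, by omega⟩

end SpiralCode

/-! ### Segments of a spiral -/

namespace Spiral

variable {n : ℕ} {R : Rectangulation n} {C : SpiralCode} (S : Spiral R C)

include S

/-- The inner side of rectangle `j` of chain `k` fills the interval, and `le_of_line` says that no
other side on this line protrudes. So each line carries exactly one segment, with ends given by `f`
and `g`. -/
theorem mem_line_iff (k : Fin 4) {j : ℕ} (hj : j ≤ C.M k + 1) (w : ℝ) :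
    (∃ p, (C.v k p = j + 1 ∨ -C.v (k + 2) p = j + 1) ∧
      -S.X (k + 3) (C.v (k + 3) p) ≤ w ∧ w ≤ S.X (k + 1) (C.v (k + 1) p)) ↔
    -S.X (k + 3) (C.g (k + 3) j + 1) ≤ w ∧ w ≤ S.X (k + 1) (C.f k j + 2) := by
  constructor
  · rintro ⟨p, hp, h1, h2⟩
    obtain ⟨h3, h4⟩ := C.le_of_line hj hp
    exact ⟨(neg_le_neg ((S.mono _).monotone h4)).trans h1, h2.trans ((S.mono _).monotone h3)⟩
  · rintro ⟨h1, h2⟩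
    rcases (Nat.le_add_one_iff.1 hj) with hj | rfl
    · refine ⟨C.node k j hj, Or.inr ?_, ?_, ?_⟩
      · rw [C.v_node, C.coord_two]; omega
      · rwa [C.v_node, C.coord_three]
      · rwa [C.v_node, C.coord_one]
    · rw [C.const k _ (Nat.lt_succ_self _)] at h2
      rw [C.g_of_lt (by rw [add_three_one]; exact Nat.lt_succ_self _)] at h1
      push_cast at h1
      rw [add_assoc, one_add_one_eq_two] at h1
      -- No rectangle has its inner side on the border line. The border point with coordinate `w` in
      -- direction `k + 1` lies in some rectangle, whose outer side is then on the border.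
      obtain ⟨p, hp⟩ := C.exists_node_cover S.mono S.neg
        (P := fun i => ![S.X k (C.M k + 2), w, -S.X k (C.M k + 2), -w] (i - k))
        (fun i => by
          rcases Direction.cases k i with rfl | rfl | rfl | rfl
          · simp
          · have e : k + 1 + 2 - k = 3 := by rw [add_one_two]; simp
            simp [e]
          · have e : k + 2 + 2 - k = 0 := by rw [add_two_two]; simp
            simp [e]
          · have e : k + 3 + 2 - k = 1 := by rw [add_three_two]; simp
            simp [e])
        (fun i => by
          rcases Direction.cases k i with rfl | rfl | rfl | rfl
          · simp
          · simpa using h2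
          · simp only [add_sub_cancel_left]
            show -S.X k (C.M k + 2) ≤ _
            rw [← S.neg]
            exact (S.mono _).monotone (by omega)
          · simp only [add_sub_cancel_left]
            show -w ≤ _
            linarith)
      refine ⟨p, Or.inl ?_, ?_, ?_⟩
      · have := hp k
        simp only [sub_self] at this
        have := (S.mono k).le_iff_le.1 this
        have := C.v_le k p
        push_cast
        omega
      · have := hp (k + 3)
        simp only [add_sub_cancel_left] at this
        have : -w ≤ _ := this
        linarith
      · have := hp (k + 1)
        simp only [add_sub_cancel_left] at this
        exact this

theorem X_neg (k : Fin 4) (t : ℤ) : -S.X k t = S.X (k + 2) (-t) := (S.neg k t).symm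

theorem left_eq (p : C.Node) : R.left (S.cell p) = S.X 0 (-C.v 2 p) := by
  have h := S.ext 2 p
  have h2 := S.neg 2 (C.v 2 p)
  rw [show (2 : Fin 4) + 2 = 0 from rfl] at h2
  simp only [Rectangulation.ext_two] at h
  linarith

theorem right_eq (p : C.Node) : R.right (S.cell p) = S.X 0 (C.v 0 p) := S.ext 0 p

theorem bottom_eq (p : C.Node) : R.bottom (S.cell p) = S.X 3 (-C.v 1 p) := by
  have h := S.ext 1 p
  have h2 := S.neg 1 (C.v 1 p)
  rw [show (1 : Fin 4) + 2 = 3 from rfl] at h2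
  simp only [Rectangulation.ext_one] at h
  linarith

theorem top_eq (p : C.Node) : R.top (S.cell p) = S.X 3 (C.v 3 p) := S.ext 3 p

theorem mem_verticalSides {t : ℤ} {y : ℝ} : (S.X 0 t, y) ∈ R.verticalSides ↔
    ∃ p, (t = -C.v 2 p ∨ t = C.v 0 p) ∧ S.X 3 (-C.v 1 p) ≤ y ∧ y ≤ S.X 3 (C.v 3 p) := by
  rw [R.mem_verticalSides, S.cell.surjective.exists]
  simp only [S.left_eq, S.right_eq, S.bottom_eq, S.top_eq, (S.mono 0).injective.eq_iff]

theorem mem_horizontalSides {t : ℤ} {x : ℝ} : (x, S.X 3 t) ∈ R.horizontalSides ↔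
    ∃ p, (t = -C.v 1 p ∨ t = C.v 3 p) ∧ S.X 0 (-C.v 2 p) ≤ x ∧ x ≤ S.X 0 (C.v 0 p) := by
  rw [R.mem_horizontalSides, S.cell.surjective.exists]
  simp only [S.left_eq, S.right_eq, S.bottom_eq, S.top_eq, (S.mono 3).injective.eq_iff, and_comm]

theorem verticalSides_west {j : ℕ} (hj : j ≤ C.M 2 + 1) {y : ℝ} :
    (S.X 0 (-(j + 1)), y) ∈ R.verticalSides ↔
      S.X 3 (-(C.g 1 j + 1)) ≤ y ∧ y ≤ S.X 3 (C.f 2 j + 2) := by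
  have := S.mem_line_iff 2 hj y
  simp only [Fin.isValue, Fin.reduceAdd, S.X_neg] at this
  rw [← this, S.mem_verticalSides]
  refine exists_congr fun p => and_congr_left fun _ => ?_
  omega

theorem verticalSides_east {j : ℕ} (hj : j ≤ C.M 0 + 1) {y : ℝ} :
    (S.X 0 (j + 1), y) ∈ R.verticalSides ↔
      S.X 3 (-(C.f 0 j + 2)) ≤ y ∧ y ≤ S.X 3 (C.g 3 j + 1) := by
  have := S.mem_line_iff 0 hj (-y)
  have e := S.X_neg 1
  simp only [Fin.isValue, Fin.reduceAdd] at this e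
  have e' : ∀ t, -y ≤ S.X 1 t ↔ S.X 3 (-t) ≤ y := fun t => by rw [neg_le, e]
  simp only [neg_le_neg_iff, e'] at this
  rw [and_comm, ← this, S.mem_verticalSides]
  exact exists_congr fun p => and_congr (by omega) and_comm

theorem horizontalSides_north {j : ℕ} (hj : j ≤ C.M 3 + 1) {x : ℝ} :
    (x, S.X 3 (j + 1)) ∈ R.horizontalSides ↔
      S.X 0 (-(C.g 2 j + 1)) ≤ x ∧ x ≤ S.X 0 (C.f 3 j + 2) := by
  have := S.mem_line_iff 3 hj x
  simp only [Fin.isValue, Fin.reduceAdd, S.X_neg] at this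
  rw [← this, S.mem_horizontalSides]
  exact exists_congr fun p => and_congr_left fun _ => by omega

theorem horizontalSides_south {j : ℕ} (hj : j ≤ C.M 1 + 1) {x : ℝ} :
    (x, S.X 3 (-(j + 1))) ∈ R.horizontalSides ↔
      S.X 0 (-(C.f 1 j + 2)) ≤ x ∧ x ≤ S.X 0 (C.g 0 j + 1) := by
  have := S.mem_line_iff 1 hj (-x)
  have e := S.X_neg 2
  simp only [Fin.isValue, Fin.reduceAdd] at this e
  have e' : ∀ t, -x ≤ S.X 2 t ↔ S.X 0 (-t) ≤ x := fun t => by rw [neg_le, e]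
  simp only [neg_le_neg_iff, e'] at this
  rw [and_comm, ← this, S.mem_horizontalSides]
  exact exists_congr fun p => and_congr (by omega) and_comm

omit S in
theorem isVSeg_iff_of_mem {x u w : ℝ} (h : ∀ y, (x, y) ∈ R.verticalSides ↔ u ≤ y ∧ y ≤ w)
    (huw : u < w) {p q : ℝ} : R.IsVSeg x p q ↔ p = u ∧ q = w := by
  have hsub : {x} ×ˢ Icc u w ⊆ R.verticalSides :=
    Rectangulation.singleton_prod_Icc_subset.2 fun y h1 h2 => (h y).2 ⟨h1, h2⟩
  constructor
  · intro hs
    have h1 := (h p).1 (Rectangulation.singleton_prod_Icc_subset.1 hs.2.1 p le_rfl hs.1.le)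
    have h2 := (h q).1 (Rectangulation.singleton_prod_Icc_subset.1 hs.2.1 q hs.1.le le_rfl)
    have := hs.2.2 u w h1.1 h2.2 hsub
    exact ⟨this.1.symm, this.2.symm⟩
  · rintro ⟨rfl, rfl⟩
    refine ⟨huw, hsub, fun p' q' h1 h2 h3 => ?_⟩
    have h4 := (h p').1 (Rectangulation.singleton_prod_Icc_subset.1 h3 p' le_rfl
      (h1.trans (huw.le.trans h2)))
    have h5 := (h q').1 (Rectangulation.singleton_prod_Icc_subset.1 h3 q'
      (h1.trans (huw.le.trans h2)) le_rfl)
    exact ⟨le_antisymm h1 h4.1, le_antisymm h5.2 h2⟩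

omit S in
theorem isHSeg_iff_of_mem {y u w : ℝ} (h : ∀ x, (x, y) ∈ R.horizontalSides ↔ u ≤ x ∧ x ≤ w)
    (huw : u < w) {p q : ℝ} : R.IsHSeg y p q ↔ p = u ∧ q = w := by
  rw [← R.rot_isVSeg, isVSeg_iff_of_mem (u := -w) (w := -u) (fun x => ?_) (neg_lt_neg huw)]
  · simp only [neg_inj, and_comm]
  · have := R.rot_mem_verticalSides (x := -x) (y := y)
    rw [neg_neg] at this
    rw [this, h]
    constructor <;> rintro ⟨_, _⟩ <;> constructor <;> linarith

theorem isVSeg_west {j : ℕ} (hj : j ≤ C.M 2 + 1) {p q : ℝ} :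
    R.IsVSeg (S.X 0 (-(j + 1))) p q ↔ p = S.X 3 (-(C.g 1 j + 1)) ∧ q = S.X 3 (C.f 2 j + 2) :=
  isVSeg_iff_of_mem (fun _ => S.verticalSides_west hj) (S.mono 3 (by omega))

theorem isVSeg_east {j : ℕ} (hj : j ≤ C.M 0 + 1) {p q : ℝ} :
    R.IsVSeg (S.X 0 (j + 1)) p q ↔ p = S.X 3 (-(C.f 0 j + 2)) ∧ q = S.X 3 (C.g 3 j + 1) :=
  isVSeg_iff_of_mem (fun _ => S.verticalSides_east hj) (S.mono 3 (by omega))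

theorem isHSeg_north {j : ℕ} (hj : j ≤ C.M 3 + 1) {p q : ℝ} :
    R.IsHSeg (S.X 3 (j + 1)) p q ↔ p = S.X 0 (-(C.g 2 j + 1)) ∧ q = S.X 0 (C.f 3 j + 2) :=
  isHSeg_iff_of_mem (fun _ => S.horizontalSides_north hj) (S.mono 0 (by omega))

theorem isHSeg_south {j : ℕ} (hj : j ≤ C.M 1 + 1) {p q : ℝ} :
    R.IsHSeg (S.X 3 (-(j + 1))) p q ↔ p = S.X 0 (-(C.f 1 j + 2)) ∧ q = S.X 0 (C.g 0 j + 1) :=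
  isHSeg_iff_of_mem (fun _ => S.horizontalSides_south hj) (S.mono 0 (by omega))

/-- Every vertical segment is one of the lines, and crosses the strip of the centre. -/
theorem exists_of_isVSeg {x p q : ℝ} (h : R.IsVSeg x p q) :
    (∃ j ≤ C.M 2 + 1, x = S.X 0 (-(j + 1)) ∧
      p = S.X 3 (-(C.g 1 j + 1)) ∧ q = S.X 3 (C.f 2 j + 2)) ∨
    (∃ j ≤ C.M 0 + 1, x = S.X 0 (j + 1) ∧
      p = S.X 3 (-(C.f 0 j + 2)) ∧ q = S.X 3 (C.g 3 j + 1)) := by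
  have hm := Rectangulation.singleton_prod_Icc_subset.1 h.2.1 p le_rfl h.1.le
  obtain ⟨t, ht, ht'⟩ : ∃ t, x = S.X 0 t ∧ ((∃ j ≤ C.M 2 + 1, t = -((j : ℤ) + 1)) ∨
      ∃ j ≤ C.M 0 + 1, t = (j : ℤ) + 1) := by
    obtain ⟨c, hc, -⟩ := R.mem_verticalSides.1 hm
    obtain ⟨node, rfl⟩ := S.cell.surjective c
    rw [S.left_eq, S.right_eq] at hc
    rcases hc with hc | hc
    · refine ⟨_, hc, ?_⟩
      rcases C.exists_line 2 node with ⟨j, h1, h2⟩ | ⟨j, h1, h2⟩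
      · exact Or.inl ⟨j, h1, by omega⟩
      · exact Or.inr ⟨j, h1, by omega⟩
    · refine ⟨_, hc, ?_⟩
      rcases C.exists_line 0 node with ⟨j, h1, h2⟩ | ⟨j, h1, h2⟩
      · exact Or.inr ⟨j, h1, by omega⟩
      · exact Or.inl ⟨j, h1, by omega⟩
  subst ht
  rcases ht' with ⟨j, hj, rfl⟩ | ⟨j, hj, rfl⟩
  · exact Or.inl ⟨j, hj, rfl, (S.isVSeg_west hj).1 h⟩
  · exact Or.inr ⟨j, hj, rfl, (S.isVSeg_east hj).1 h⟩

theorem exists_of_isHSeg {y p q : ℝ} (h : R.IsHSeg y p q) :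
    (∃ j ≤ C.M 3 + 1, y = S.X 3 (j + 1) ∧
      p = S.X 0 (-(C.g 2 j + 1)) ∧ q = S.X 0 (C.f 3 j + 2)) ∨
    (∃ j ≤ C.M 1 + 1, y = S.X 3 (-(j + 1)) ∧
      p = S.X 0 (-(C.f 1 j + 2)) ∧ q = S.X 0 (C.g 0 j + 1)) := by
  have hm := Rectangulation.Icc_prod_singleton_subset.1 h.2.1 p le_rfl h.1.le
  obtain ⟨t, ht, ht'⟩ : ∃ t, y = S.X 3 t ∧ ((∃ j ≤ C.M 3 + 1, t = (j : ℤ) + 1) ∨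
      ∃ j ≤ C.M 1 + 1, t = -((j : ℤ) + 1)) := by
    obtain ⟨c, -, hc⟩ := R.mem_horizontalSides.1 hm
    obtain ⟨node, rfl⟩ := S.cell.surjective c
    rw [S.bottom_eq, S.top_eq] at hc
    rcases hc with hc | hc
    · refine ⟨_, hc, ?_⟩
      rcases C.exists_line 1 node with ⟨j, h1, h2⟩ | ⟨j, h1, h2⟩
      · exact Or.inr ⟨j, h1, by omega⟩
      · exact Or.inl ⟨j, h1, by omega⟩
    · refine ⟨_, hc, ?_⟩
      rcases C.exists_line 3 node with ⟨j, h1, h2⟩ | ⟨j, h1, h2⟩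
      · exact Or.inl ⟨j, h1, by omega⟩
      · exact Or.inr ⟨j, h1, by omega⟩
  subst ht
  rcases ht' with ⟨j, hj, rfl⟩ | ⟨j, hj, rfl⟩
  · exact Or.inl ⟨j, hj, rfl, (S.isHSeg_north hj).1 h⟩
  · exact Or.inr ⟨j, hj, rfl, (S.isHSeg_south hj).1 h⟩

/-- This locates segments: whatever ends at a horizontal line from below or from above shows on
which side of the centre that line lies. -/
theorem isVSeg_span {x p q : ℝ} (h : R.IsVSeg x p q) : p ≤ S.X 3 (-1) ∧ S.X 3 1 ≤ q := by
  rcases S.exists_of_isVSeg h with ⟨j, hj, -, rfl, rfl⟩ | ⟨j, hj, -, rfl, rfl⟩ <;>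
    exact ⟨(S.mono 3).monotone (by omega), (S.mono 3).monotone (by omega)⟩

theorem isHSeg_span {y p q : ℝ} (h : R.IsHSeg y p q) : p ≤ S.X 0 (-1) ∧ S.X 0 1 ≤ q := by
  rcases S.exists_of_isHSeg h with ⟨j, hj, -, rfl, rfl⟩ | ⟨j, hj, -, rfl, rfl⟩ <;>
    exact ⟨(S.mono 0).monotone (by omega), (S.mono 0).monotone (by omega)⟩

/-! ### Windmills in spirals -/

/-- As each of the four segments reaches across the strip of the centre, the `k`-th one must be a
line of chain `k`, say the `j k`-th. Its end in direction `k + 3` is given by `g`, so that it starts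
at line `j (k + 3)` exactly when the cycle condition holds. The required prolongations at the other
ends follow from the adjunction. -/
theorem isWindmill_iff {a b c d : ℝ} : R.IsWindmill a b c d ↔
    ∃ j : Fin 4 → ℕ, (∀ k, j k ≤ C.M k ∧ j k = C.g k (j (k + 1))) ∧ a = S.X 0 (-(j 2 + 1)) ∧
      b = S.X 0 (j 0 + 1) ∧ c = S.X 3 (-(j 1 + 1)) ∧ d = S.X 3 (j 3 + 1) := by
  constructor
  · rintro ⟨hab, hcd, l, r, u, v, ⟨h1, h1'⟩, ⟨h2, h2'⟩, ⟨h3, h3'⟩, h4, h4'⟩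
    have a1 := (S.isHSeg_span h2).1
    have b1 := (S.isHSeg_span h4).2
    have c1 := (S.isVSeg_span h1).1
    have d1 := (S.isVSeg_span h3).2
    rcases S.exists_of_isVSeg h1 with ⟨j2, k2, rfl, e2, rfl⟩ | ⟨j2, k2, rfl, e2, rfl⟩
    swap
    · have := (S.mono 0).le_iff_le.1 a1; omega
    rcases S.exists_of_isVSeg h3 with ⟨j0, k0, rfl, rfl, e0⟩ | ⟨j0, k0, rfl, rfl, e0⟩
    · have := (S.mono 0).le_iff_le.1 b1; omega
    rcases S.exists_of_isHSeg h2 with ⟨j3, k3, rfl, e3, rfl⟩ | ⟨j3, k3, rfl, e3, rfl⟩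
    swap
    · have := (S.mono 3).le_iff_le.1 d1; omega
    rcases S.exists_of_isHSeg h4 with ⟨j1, k1, rfl, rfl, e1⟩ | ⟨j1, k1, rfl, rfl, e1⟩
    · have := (S.mono 3).le_iff_le.1 c1; omega
    have q0 := (S.mono 3).injective e0
    have q1 := (S.mono 0).injective e1
    have q2 := (S.mono 3).injective e2
    have q3 := (S.mono 0).injective e3
    rw [(S.mono 3).lt_iff_lt] at h1' h3'
    rw [(S.mono 0).lt_iff_lt] at h2' h4'
    have l0 := C.le 0 j0
    have l1 := C.le 1 j1
    have l2 := C.le 2 j2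
    have l3 := C.le 3 j3
    simp only [Fin.isValue, Fin.reduceAdd] at l0 l1 l2 l3
    refine ⟨![j0, j1, j2, j3], ?_, rfl, rfl, rfl, rfl⟩
    intro k
    fin_cases k <;> simp <;> omega
  · rintro ⟨j, hj, rfl, rfl, rfl, rfl⟩
    have H : ∀ k, j (k + 1) ≤ C.f k (j k) := fun k =>
      (C.g_le_iff (hj (k + 1)).1).1 (hj k).2.ge
    have h0 := (hj 0).2
    have h1 := (hj 1).2
    have h2 := (hj 2).2
    have h3 := (hj 3).2
    have H0 := H 0
    have H1 := H 1
    have H2 := H 2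
    have H3 := H 3
    simp only [Fin.isValue, Fin.reduceAdd] at h0 h1 h2 h3 H0 H1 H2 H3
    refine ⟨S.mono 0 (by omega), S.mono 3 (by omega), _, _, _, _,
      ⟨(S.isVSeg_west (by have := (hj 2).1; omega)).2 ⟨by rw [← h1], rfl⟩, S.mono 3 (by omega)⟩,
      ⟨(S.isHSeg_north (by have := (hj 3).1; omega)).2 ⟨by rw [← h2], rfl⟩, S.mono 0 (by omega)⟩,
      ⟨(S.isVSeg_east (by have := (hj 0).1; omega)).2 ⟨rfl, by rw [← h3]⟩, S.mono 3 (by omega)⟩,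
      (S.isHSeg_south (by have := (hj 1).1; omega)).2 ⟨rfl, by rw [← h0]⟩, S.mono 0 (by omega)⟩

/-- In the mirror image the ends in direction `k + 1` matter. They are given by `f`, and line `j k`
ends on coordinate `f k (j k) + 2`, which is line number `f k (j k) + 1` of chain `k + 1`. -/
theorem isMirrorWindmill_iff {a b c d : ℝ} : R.IsMirrorWindmill a b c d ↔
    ∃ j : Fin 4 → ℕ, (∀ k, j k ≤ C.M k ∧ j (k + 1) = C.f k (j k) + 1) ∧ a = S.X 0 (-(j 2 + 1)) ∧
      b = S.X 0 (j 0 + 1) ∧ c = S.X 3 (-(j 1 + 1)) ∧ d = S.X 3 (j 3 + 1) := by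
  constructor
  · rintro ⟨hab, hcd, l, r, u, v, ⟨h1, h1'⟩, ⟨h2, h2'⟩, ⟨h3, h3'⟩, h4, h4'⟩
    have d1 := (S.isVSeg_span h1).2
    have b1 := (S.isHSeg_span h2).2
    have c1 := (S.isVSeg_span h3).1
    have a1 := (S.isHSeg_span h4).1
    rcases S.exists_of_isVSeg h1 with ⟨j2, k2, rfl, rfl, e2⟩ | ⟨j2, k2, rfl, rfl, e2⟩
    swap
    · have := (S.mono 0).le_iff_le.1 a1; omega
    rcases S.exists_of_isVSeg h3 with ⟨j0, k0, rfl, e0, rfl⟩ | ⟨j0, k0, rfl, e0, rfl⟩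
    · have := (S.mono 0).le_iff_le.1 b1; omega
    rcases S.exists_of_isHSeg h2 with ⟨j3, k3, rfl, rfl, e3⟩ | ⟨j3, k3, rfl, rfl, e3⟩
    swap
    · have := (S.mono 3).le_iff_le.1 d1; omega
    rcases S.exists_of_isHSeg h4 with ⟨j1, k1, rfl, e1, rfl⟩ | ⟨j1, k1, rfl, e1, rfl⟩
    · have := (S.mono 3).le_iff_le.1 c1; omega
    have q0 := (S.mono 3).injective e0
    have q1 := (S.mono 0).injective e1
    have q2 := (S.mono 3).injective e2
    have q3 := (S.mono 0).injective e3
    rw [(S.mono 3).lt_iff_lt] at h1' h3'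
    rw [(S.mono 0).lt_iff_lt] at h2' h4'
    have bounds : ∀ k j, j ≤ C.M (k + 1) + 1 → C.g k j ≤ C.M k + 1 := by
      intro k j hj
      rcases Nat.le_add_one_iff.1 hj with h | rfl
      · exact C.g_le h
      · exact (C.g_of_lt (Nat.lt_succ_self _)).le
    have l0 := bounds 0 j1 k1
    have l1 := bounds 1 j2 k2
    have l2 := bounds 2 j3 k3
    have l3 := bounds 3 j0 k0
    refine ⟨![j0, j1, j2, j3], ?_, rfl, rfl, rfl, rfl⟩
    intro k
    fin_cases k <;> simp <;> omega
  · rintro ⟨j, hj, rfl, rfl, rfl, rfl⟩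
    have H : ∀ k, j k < C.g k (j (k + 1)) := fun k => by
      rw [C.lt_g_iff (hj (k + 1)).1, (hj k).2]; exact Nat.lt_succ_self _
    have h0 := (hj 0).2
    have h1 := (hj 1).2
    have h2 := (hj 2).2
    have h3 := (hj 3).2
    have H0 := H 0
    have H1 := H 1
    have H2 := H 2
    have H3 := H 3
    simp only [Fin.isValue, Fin.reduceAdd] at h0 h1 h2 h3 H0 H1 H2 H3
    refine ⟨S.mono 0 (by omega), S.mono 3 (by omega), _, _, _, _,
      ⟨(S.isVSeg_west (by have := (hj 2).1; omega)).2 ⟨rfl, ?_⟩, S.mono 3 (by omega)⟩,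
      ⟨(S.isHSeg_north (by have := (hj 3).1; omega)).2 ⟨rfl, ?_⟩, S.mono 0 (by omega)⟩,
      ⟨(S.isVSeg_east (by have := (hj 0).1; omega)).2 ⟨?_, rfl⟩, S.mono 3 (by omega)⟩,
      (S.isHSeg_south (by have := (hj 1).1; omega)).2 ⟨?_, rfl⟩, S.mono 0 (by omega)⟩
    · congr 1; omega
    · congr 1; omega
    · congr 1; omega
    · congr 1; omega

theorem isWindmill_centre : R.IsWindmill (S.X 0 (-1)) (S.X 0 1) (S.X 3 (-1)) (S.X 3 1) :=
  S.isWindmill_iff.2 ⟨fun _ => 0, fun k => ⟨Nat.zero_le _, (C.g_zero k).symm⟩, by simp⟩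

theorem cell_centre : R.cell (S.cell none) =
    Icc (S.X 0 (-1)) (S.X 0 1) ×ˢ Icc (S.X 3 (-1)) (S.X 3 1) := by
  rw [Rectangulation.cell_eq_iff (S.mono 0 (by norm_num)) (S.mono 3 (by norm_num)), S.left_eq,
    S.right_eq, S.bottom_eq, S.top_eq]
  simp

/-- A horizontal segment reaches past the centre, so it can end from the left only on its eastern
side. With the three analogues this excludes P3 to P8 in every spiral. -/
theorem tickLeft_le {x p q y : ℝ} (h : R.TickLeft x p q y) : S.X 0 1 ≤ x := by
  obtain ⟨_, _, r, h⟩ := h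
  exact (S.isHSeg_span h).2

theorem tickRight_le {x p q y : ℝ} (h : R.TickRight x p q y) : x ≤ S.X 0 (-1) := by
  obtain ⟨_, _, r, h⟩ := h
  exact (S.isHSeg_span h).1

theorem tickBelow_le {x p q y : ℝ} (h : R.TickBelow y p q x) : S.X 3 1 ≤ y := by
  obtain ⟨_, _, r, h⟩ := h
  exact (S.isVSeg_span h).2

theorem tickAbove_le {x p q y : ℝ} (h : R.TickAbove y p q x) : y ≤ S.X 3 (-1) := by
  obtain ⟨_, _, r, h⟩ := h
  exact (S.isVSeg_span h).1

/-- Validity is needed only against mirror windmills, further windmills and peelability. For the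
last, `g` never takes its extra value, so no rectangle reaches two opposite sides of `R`. -/
theorem isSimpleWhirl (hC : C.Valid) : R.IsSimpleWhirl := by
  have h0 := S.mono 0 (show (-1 : ℤ) < 1 by norm_num)
  have h3 := S.mono 3 (show (-1 : ℤ) < 1 by norm_num)
  refine ⟨⟨⟨?_, ?_, ?_, ?_, ?_, ?_, ?_⟩, _, _, _, _, S.isWindmill_centre⟩, ?_, _, _, _, _,
    S.isWindmill_centre, ?_, _, S.cell_centre⟩
  · rintro ⟨a, b, c, d, h⟩
    obtain ⟨j, hj, -⟩ := S.isMirrorWindmill_iff.1 h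
    exact SpiralCode.not_f_cycle hC j hj
  · rintro ⟨x, p, q, y, z, -, h1, h2, -⟩
    linarith [S.tickLeft_le h1, S.tickRight_le h2]
  · rintro ⟨x, p, q, y, z, -, h1, h2, -⟩
    linarith [S.tickBelow_le h1, S.tickAbove_le h2]
  · rintro ⟨x, p, q, y, z, -, h1, h2, -⟩
    linarith [S.tickLeft_le h1, S.tickRight_le h2]
  · rintro ⟨x, p, q, y, z, -, h1, h2, -⟩
    linarith [S.tickBelow_le h1, S.tickAbove_le h2]
  · rintro ⟨a, b, c, d, hb, ⟨p, q, y, -, -, -, h1⟩, p', q', y', -, -, -, h2⟩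
    linarith [S.tickLeft_le h1, S.tickRight_le h2, hb.1]
  · rintro ⟨a, b, c, d, hb, ⟨p, q, y, -, -, -, h1⟩, p', q', y', -, -, -, h2⟩
    linarith [S.tickBelow_le h1, S.tickAbove_le h2, hb.2.1]
  · rintro ⟨i, hi⟩
    obtain ⟨p, rfl⟩ := S.cell.surjective i
    obtain ⟨k, h1, h2⟩ : ∃ k, R.ext k (S.cell p) = R.bd k ∧
        R.ext (k + 2) (S.cell p) = R.bd (k + 2) := by
      rcases hi with ⟨h1, h2⟩ | ⟨h1, h2⟩
      · exact ⟨0, h2, neg_inj.2 h1⟩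
      · exact ⟨1, neg_inj.2 h1, h2⟩
    rw [S.ext, S.bd, (S.mono _).injective.eq_iff] at h1 h2
    induction p using C.node_cases with
    | none => simp only [C.v_none] at h1; omega
    | node i j hj =>
      rw [C.v_node] at h1 h2
      rcases Direction.cases k i with rfl | rfl | rfl | rfl
      · rw [C.coord_two] at h2; omega
      · rw [C.coord_one'] at h1
        have := SpiralCode.g_le_of_top hC.1 hj
        omega
      · rw [C.coord_two'] at h1; omega
      · rw [C.coord_two_three] at h2
        have := SpiralCode.g_le_of_top hC.1 (k := k + 2) (j := j) (by rwa [add_two_one])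
        omega
  · intro a b c d h
    obtain ⟨j, hj, rfl, rfl, rfl, rfl⟩ := S.isWindmill_iff.1 h
    simp [SpiralCode.g_cycle_eq_zero hC hj]

/-- If `f k` preserves the greatest element but `f (k + 3)` does not, the last rectangle of chain
`k` reaches both borders `k + 1` and `k + 3` and can be peeled. So all four maps preserve the
greatest elements or none does, and the latter produces a mirror windmill. Any further failure of
validity produces a second windmill. -/
theorem valid (h : R.IsSimpleWhirl) : C.Valid := by
  obtain ⟨⟨⟨hP1, -⟩, -⟩, hpeel, a, b, c, d, -, huniq, -⟩ := h
  have step : ∀ k, C.f k (C.M k) = C.M (k + 1) → C.f (k + 3) (C.M (k + 3)) = C.M k := by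
    intro k hk
    by_contra hne
    have hle := C.le (k + 3) (C.M (k + 3))
    rw [add_three_one] at hle
    have hg : C.g (k + 3) (C.M k) = C.M (k + 3) + 1 := by
      have hM : C.M k ≤ C.M (k + 3 + 1) := by rw [add_three_one]
      have h1 := (C.lt_g_iff hM (d := C.M (k + 3))).2 (by omega)
      have h2 := C.g_le hM
      omega
    have e1 : R.ext (k + 1) (S.cell (C.node k _ le_rfl)) = R.bd (k + 1) := by
      rw [S.ext, S.bd, C.v_node, C.coord_one, hk]
    have e3 : R.ext (k + 3) (S.cell (C.node k _ le_rfl)) = R.bd (k + 3) := by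
      rw [S.ext, S.bd, C.v_node, C.coord_three, hg]; push_cast; ring_nf
    refine hpeel ⟨S.cell (C.node k _ le_rfl), ?_⟩
    clear hg hle hne hk
    fin_cases k <;> simp at e1 e3 ⊢ <;> simp [e1, e3]
  have top : ∀ k, C.f k (C.M k) = C.M (k + 1) := by
    by_contra! hne
    obtain ⟨i, hi⟩ := hne
    have hall : ∀ k, C.f k (C.M k) < C.M (k + 1) := by
      intro k
      refine lt_of_le_of_ne (C.le _ _) fun hk => hi ?_
      have h3 := step k hk
      have h2 := step (k + 3) (by rwa [add_three_one])
      rw [add_three_three] at h2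
      have h1 := step (k + 2) (by rwa [add_two_one])
      rw [add_two_three] at h1
      rcases Direction.cases k i with rfl | rfl | rfl | rfl
      · exact hk
      · rwa [add_one_one]
      · rwa [add_two_one]
      · rwa [add_three_one]
    obtain ⟨j, hj⟩ := SpiralCode.exists_f_cycle hall
    exact hP1 ⟨_, _, _, _, S.isMirrorWindmill_iff.2 ⟨j, hj, rfl, rfl, rfl, rfl⟩⟩
  by_contra hC
  obtain ⟨j, hj, i, hi⟩ := SpiralCode.exists_g_cycle top hC
  have w1 := huniq _ _ _ _ (S.isWindmill_iff.2 ⟨j, hj, rfl, rfl, rfl, rfl⟩)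
  have w2 := huniq _ _ _ _ S.isWindmill_centre
  obtain ⟨e1, e2, e3, e4⟩ := w1
  obtain ⟨e1', e2', e3', e4'⟩ := w2
  have q0 := (S.mono 0).injective (e2.trans e2'.symm)
  have q1 := (S.mono 3).injective (e3.trans e3'.symm)
  have q2 := (S.mono 0).injective (e1.trans e1'.symm)
  have q3 := (S.mono 3).injective (e4.trans e4'.symm)
  fin_cases i <;> simp at hi <;> omega

end Spiral

namespace Rectangulation

variable {n : ℕ} {R : Rectangulation n}

/-! ### Rotation of the alternating paths -/

/-- The inverse of the quarter turn `(x, y) ↦ (y, -x)`. -/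
def turn (P : ℝ × ℝ) : ℝ × ℝ := (-P.2, P.1)

theorem turn_mem_segment {P Q X : ℝ × ℝ} (h : X ∈ segment ℝ P Q) :
    turn X ∈ segment ℝ (turn P) (turn Q) := by
  obtain ⟨a, b, ha, hb, hab, rfl⟩ := h
  refine ⟨a, b, ha, hb, hab, ?_⟩
  ext <;> simp [turn] ; ring

theorem AltLeg.map {f g f' g' : ℝ × ℝ → ℝ × ℝ → Prop} {r : ℝ × ℝ → ℝ × ℝ}
    (hf : ∀ P Q, f P Q → f' (r P) (r Q)) (hg : ∀ P Q, g P Q → g' (r P) (r Q)) {O : ℝ × ℝ} {s : Bool}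
    {P Q : ℝ × ℝ} (h : AltLeg f g O s P Q) : AltLeg f' g' (r O) s (r P) (r Q) := by
  induction h with
  | start h => exact .start (hf _ _ h)
  | turnG _ h ih => exact .turnG ih (hg _ _ h)
  | turnF _ h ih => exact .turnF ih (hf _ _ h)

theorem turn_mem_altPath {f g f' g' : ℝ × ℝ → ℝ × ℝ → Prop}
    (hf : ∀ P Q, f P Q → f' (turn P) (turn Q)) (hg : ∀ P Q, g P Q → g' (turn P) (turn Q))
    {O X : ℝ × ℝ} (h : X ∈ altPath f g O) : turn X ∈ altPath f' g' (turn O) := by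
  obtain ⟨s, P, Q, h1, h2⟩ := h
  exact ⟨s, _, _, h1.map hf hg, turn_mem_segment h2⟩

theorem goUp_turn (P Q : ℝ × ℝ) (h : R.rot.GoUp P Q) : R.GoLeft (turn P) (turn Q) := by
  obtain ⟨x, y, p, q, h1, h2, h3, rfl, rfl⟩ := h
  exact ⟨-y, x, -q, -p, R.rot_isVSeg'.1 h1, neg_le_neg h3, neg_le_neg h2, rfl, rfl⟩

theorem goDown_turn (P Q : ℝ × ℝ) (h : R.rot.GoDown P Q) : R.GoRight (turn P) (turn Q) := by
  obtain ⟨x, y, p, q, h1, h2, h3, rfl, rfl⟩ := h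
  exact ⟨-y, x, -q, -p, R.rot_isVSeg'.1 h1, neg_le_neg h3, neg_le_neg h2, rfl, rfl⟩

theorem goLeft_turn (P Q : ℝ × ℝ) (h : R.rot.GoLeft P Q) : R.GoDown (turn P) (turn Q) := by
  obtain ⟨x, y, p, q, h1, h2, h3, rfl, rfl⟩ := h
  exact ⟨-y, x, p, q, R.rot_isHSeg'.1 h1, h2, h3, rfl, rfl⟩

theorem goRight_turn (P Q : ℝ × ℝ) (h : R.rot.GoRight P Q) : R.GoUp (turn P) (turn Q) := by
  obtain ⟨x, y, p, q, h1, h2, h3, rfl, rfl⟩ := h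
  exact ⟨-y, x, p, q, R.rot_isHSeg'.1 h1, h2, h3, rfl, rfl⟩

theorem pathNW_turn {a c x y : ℝ} (h : (x, y) ∈ R.rot.pathNW a c) :
    (-y, x) ∈ R.pathSW (-c) a :=
  turn_mem_altPath goUp_turn goLeft_turn h

theorem pathNE_turn {a d x y : ℝ} (h : (x, y) ∈ R.rot.pathNE a d) :
    (-y, x) ∈ R.pathNW (-d) a :=
  turn_mem_altPath goRight_turn goUp_turn h

theorem pathSE_turn {b d x y : ℝ} (h : (x, y) ∈ R.rot.pathSE b d) :
    (-y, x) ∈ R.pathNE (-d) b :=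
  turn_mem_altPath goDown_turn goRight_turn h

theorem pathSW_turn {b c x y : ℝ} (h : (x, y) ∈ R.rot.pathSW b c) :
    (-y, x) ∈ R.pathSE (-c) b :=
  turn_mem_altPath goLeft_turn goDown_turn h

theorem region_turn (k : Fin 4) {a b c d x y : ℝ}
    (h : (x, y) ∈ R.rot.region c d (-b) (-a) (k + 1)) : (-y, x) ∈ R.region a b c d k := by
  fin_cases k
  · obtain ⟨⟨u, hu, hu'⟩, w, hw, hw'⟩ : (x, y) ∈ betweenHoriz (R.rot.pathSW d (-b))
      (R.rot.pathSE d (-a)) := h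
    have h1 := pathSW_turn hu'
    have h2 := pathSE_turn hw'
    rw [neg_neg] at h1 h2
    exact ⟨⟨u, hu, h1⟩, w, hw, h2⟩
  · obtain ⟨⟨u, hu, hu'⟩, w, hw, hw'⟩ : (x, y) ∈ betweenVert (R.rot.pathSW d (-b))
      (R.rot.pathNW c (-b)) := h
    have h1 := pathSW_turn hu'
    have h2 := pathNW_turn hw'
    rw [neg_neg] at h1 h2
    exact ⟨⟨-w, neg_le_neg hw, h2⟩, -u, neg_le_neg hu, h1⟩
  · obtain ⟨⟨u, hu, hu'⟩, w, hw, hw'⟩ : (x, y) ∈ betweenHoriz (R.rot.pathNW c (-b))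
      (R.rot.pathNE c (-a)) := h
    have h1 := pathNW_turn hu'
    have h2 := pathNE_turn hw'
    rw [neg_neg] at h1 h2
    exact ⟨⟨u, hu, h1⟩, w, hw, h2⟩
  · obtain ⟨⟨u, hu, hu'⟩, w, hw, hw'⟩ : (x, y) ∈ betweenVert (R.rot.pathSE d (-a))
      (R.rot.pathNE c (-a)) := h
    have h1 := pathSE_turn hu'
    have h2 := pathNE_turn hw'
    rw [neg_neg] at h1 h2
    exact ⟨⟨-w, neg_le_neg hw, h2⟩, -u, neg_le_neg hu, h1⟩

/-! ### Half-planes containing the alternating paths -/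

theorem altPath_subset {f g : ℝ × ℝ → ℝ × ℝ → Prop} {O : ℝ × ℝ} {K : Set (ℝ × ℝ)}
    (hK : Convex ℝ K) (hO : O ∈ K) (hf : ∀ P Q, f P Q → P ∈ K → Q ∈ K)
    (hg : ∀ P Q, g P Q → P ∈ K → Q ∈ K) : altPath f g O ⊆ K := by
  rintro X ⟨s, P, Q, h, hX⟩
  suffices hPQ : P ∈ K ∧ Q ∈ K from hK.segment_subset hPQ.1 hPQ.2 hX
  clear hX
  induction h with
  | start h => exact ⟨hO, hf _ _ h hO⟩
  | turnG _ h ih => exact ⟨ih.2, hg _ _ h ih.2⟩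
  | turnF _ h ih => exact ⟨ih.2, hf _ _ h ih.2⟩

theorem pathNW_le {a c x y : ℝ} (h : (x, y) ∈ R.pathNW a c) : x ≤ a := by
  refine altPath_subset (K := {P | P.1 ≤ a}) (convex_halfSpace_le (f := Prod.fst)
    ⟨fun _ _ => rfl, fun _ _ => rfl⟩ a) (le_refl a) ?_ ?_ h
  · rintro _ _ ⟨x, y, p, q, h1, h2, h3, rfl, rfl⟩ h; exact h
  · rintro _ _ ⟨x, y, p, q, h1, h2, h3, rfl, rfl⟩ h; exact h2.trans h

theorem pathSE_le {b d x y : ℝ} (h : (x, y) ∈ R.pathSE b d) : b ≤ x := by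
  refine altPath_subset (K := {P | b ≤ P.1}) (convex_halfSpace_ge (f := Prod.fst)
    ⟨fun _ _ => rfl, fun _ _ => rfl⟩ b) (le_refl b) ?_ ?_ h
  · rintro _ _ ⟨x, y, p, q, h1, h2, h3, rfl, rfl⟩ h; exact h
  · rintro _ _ ⟨x, y, p, q, h1, h2, h3, rfl, rfl⟩ h; exact le_trans h h3

theorem pathSW_le {b c x y : ℝ} (h : (x, y) ∈ R.pathSW b c) : y ≤ c := by
  refine altPath_subset (K := {P | P.2 ≤ c}) (convex_halfSpace_le (f := Prod.snd)
    ⟨fun _ _ => rfl, fun _ _ => rfl⟩ c) (le_refl c) ?_ ?_ h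
  · rintro _ _ ⟨x, y, p, q, h1, h2, h3, rfl, rfl⟩ h; exact h
  · rintro _ _ ⟨x, y, p, q, h1, h2, h3, rfl, rfl⟩ h; exact h2.trans h

theorem pathNE_le {a d x y : ℝ} (h : (x, y) ∈ R.pathNE a d) : d ≤ y := by
  refine altPath_subset (K := {P | d ≤ P.2}) (convex_halfSpace_ge (f := Prod.snd)
    ⟨fun _ _ => rfl, fun _ _ => rfl⟩ d) (le_refl d) ?_ ?_ h
  · rintro _ _ ⟨x, y, p, q, h1, h2, h3, rfl, rfl⟩ h; exact h
  · rintro _ _ ⟨x, y, p, q, h1, h2, h3, rfl, rfl⟩ h; exact le_trans h h3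

/-- One of the two paths bounding region `k` starts along side `k` of the windmill interior and
never comes back across its line. -/
theorem region_le {a b c d x y : ℝ} {k : Fin 4} (h : (x, y) ∈ R.region a b c d k) :
    ![b, -c, -a, d] k ≤ ![x, -y, -x, y] k := by
  fin_cases k
  · obtain ⟨⟨u, hu, hu'⟩, -⟩ : (x, y) ∈ betweenVert _ _ := h
    exact pathSE_le hu'
  · obtain ⟨⟨u, hu, hu'⟩, -⟩ : (x, y) ∈ betweenHoriz _ _ := h
    exact neg_le_neg (pathSW_le hu')
  · obtain ⟨-, ⟨u, hu, hu'⟩⟩ : (x, y) ∈ betweenVert _ _ := h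
    exact neg_le_neg (pathNW_le hu')
  · obtain ⟨-, ⟨u, hu, hu'⟩⟩ : (x, y) ∈ betweenHoriz _ _ := h
    exact pathNE_le hu'

theorem mem_segment_vertical {x y y1 y2 : ℝ} (h1 : y1 ≤ y) (h2 : y ≤ y2) :
    (x, y) ∈ segment ℝ (x, y1) (x, y2) := by
  rw [← Prod.image_mk_segment_right, segment_eq_Icc (h1.trans h2)]
  exact ⟨y, ⟨h1, h2⟩, rfl⟩

theorem mem_segment_horizontal {x y x1 x2 : ℝ} (h1 : x1 ≤ x) (h2 : x ≤ x2) :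
    (x, y) ∈ segment ℝ (x2, y) (x1, y) := by
  rw [segment_symm, ← Prod.image_mk_segment_left, segment_eq_Icc (h1.trans h2)]
  exact ⟨x, ⟨h1, h2⟩, rfl⟩

end Rectangulation

/-! ### Rotation of spirals -/

namespace SpiralCode

variable (C : SpiralCode)

/-- The code of the rotated spiral. -/
def rot : SpiralCode where
  M k := C.M (k + 3)
  f k := C.f (k + 3)
  mono k := C.mono (k + 3)
  le k j := by rw [add_right_comm]; exact C.le (k + 3) j
  const k j hj := by rw [add_right_comm]; exact C.const (k + 3) j hj

theorem rot_coord (k i : Fin 4) (j : ℕ) : C.rot.coord k i j = C.coord (k + 3) (i + 3) j := by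
  have : C.rot.g k j = C.g (k + 3) j := rfl
  simp [coord, this]
  rfl

theorem Valid.rot {C : SpiralCode} (h : C.Valid) : C.rot.Valid := by
  refine ⟨fun k => ?_, fun k j hj => ?_⟩
  · show C.f (k + 3) (C.M (k + 3)) = C.M (k + 1 + 3)
    rw [h.1, add_right_comm]
  · have := h.2 (k + 3) j hj
    show j < C.f (k + 3 + 3) (C.f (k + 2 + 3) (C.f (k + 1 + 3) (C.f (k + 3) j)))
    rw [add_right_comm k 2 3, add_right_comm k 1 3]
    exact this

/-- The nodes of the rotated code. -/
def rotNode : C.rot.Node ≃ C.Node :=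
  Equiv.optionCongr (Equiv.sigmaCongrLeft (β := fun k => Fin (C.M k + 1)) (Equiv.addRight 3))

end SpiralCode

namespace Spiral

variable {n : ℕ} {R : Rectangulation n} {C : SpiralCode} (S : Spiral R C)

/-- The rotated spiral. -/
def rot : Spiral R.rot C.rot where
  cell := C.rotNode.trans S.cell
  X k := S.X (k + 3)
  mono k := S.mono (k + 3)
  neg k t := by rw [add_right_comm]; exact S.neg (k + 3) t
  ext k p := by
    have e := R.ext_rot (k + 3) ((C.rotNode.trans S.cell) p)
    rw [add_three_one] at e
    rw [e, Equiv.trans_apply, S.ext]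
    congr 1
    induction p using C.rot.node_cases with
    | none => rfl
    | node i j hj => exact (C.rot_coord k i j).symm
  bd k := by
    have e := R.bd_rot (k + 3)
    rw [add_three_one] at e
    rw [e, S.bd]
    rfl

theorem rot_cell_node (k : Fin 4) (j : ℕ) (hj : j ≤ C.M k) :
    ∃ hj', S.rot.cell (C.rot.node (k + 1) j hj') = S.cell (C.node k j hj) := by
  have hM : C.rot.M (k + 1) = C.M k := by
    show C.M (k + 1 + 3) = _
    rw [add_one_three]
  refine ⟨hj.trans hM.ge, ?_⟩
  show S.cell (C.node (k + 1 + 3) j (by rw [add_one_three]; exact hj)) = _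
  congr 1
  have key : ∀ k' (h : k' = k) (hj' : j ≤ C.M k'), C.node k' j hj' = C.node k j hj := by
    rintro k' rfl _; rfl
  exact key _ (add_one_three k) _

/-! ### The paths in a spiral -/

open Rectangulation

/-- Climb through the lines `b` of chain 3. The upward leg on vertical line `g 2 b` also serves `b +
1` if it continues past that line. Otherwise it ends there, and the path goes left to vertical line
`g 2 (b + 1)` and up again. -/
theorem exists_leg (hC : C.Valid) {b : ℕ} (hb : b ≤ C.M 3) : ∃ y ≤ S.X 3 (b + 1),
    AltLeg R.GoUp R.GoLeft (S.X 0 (-1), S.X 3 (-1)) true (S.X 0 (-(C.g 2 b + 1)), y)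
      (S.X 0 (-(C.g 2 b + 1)), S.X 3 (C.f 2 (C.g 2 b) + 2)) := by
  have hg : ∀ b ≤ C.M 3, C.g 2 b ≤ C.M 2 := fun b hb => SpiralCode.g_le_of_top hC.1 hb
  have hfg : ∀ b ≤ C.M 3, b ≤ C.f 2 (C.g 2 b) := fun b hb =>
    (C.g_le_iff (k := 2) hb).1 le_rfl
  induction b with
  | zero =>
    rw [C.g_zero]
    simp only [CharP.cast_eq_zero, zero_add]
    refine ⟨S.X 3 (-1), (S.mono 3).monotone (by omega), .start ?_⟩
    have h1 := (S.isVSeg_west (j := 0) (Nat.zero_le _)).2 ⟨rfl, rfl⟩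
    simp only [CharP.cast_eq_zero, zero_add, C.g_zero] at h1
    exact ⟨_, _, _, _, h1, le_rfl, (S.mono 3).monotone (by omega), rfl, rfl⟩
  | succ b ih =>
    obtain ⟨y, hy, hleg⟩ := ih (by omega)
    have h1 := hfg b (by omega)
    have h2 : C.g 2 b ≤ C.g 2 (b + 1) := C.g_mono (k := 2) (Nat.le_succ b) hb
    rcases h1.lt_or_eq with h1 | h1
    · have e : C.g 2 (b + 1) = C.g 2 b := le_antisymm ((C.g_le_iff (k := 2) hb).2 h1) h2
      rw [e]
      exact ⟨y, hy.trans ((S.mono 3).monotone (by omega)), hleg⟩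
    · rw [← h1] at hleg
      have h3 := hfg _ hb
      have hN := (S.isHSeg_north (j := b + 1) (by omega)).2 ⟨rfl, rfl⟩
      have hV := (S.isVSeg_west (j := C.g 2 (b + 1)) (by have := hg _ hb; omega)).2 ⟨rfl, rfl⟩
      have e : ((b + 1 : ℕ) : ℤ) + 1 = b + 2 := by push_cast; ring
      rw [e] at hN ⊢
      refine ⟨S.X 3 (b + 2), le_rfl, .turnF (.turnG hleg
        ⟨_, _, _, _, hN, (S.mono 0).monotone (by omega), (S.mono 0).monotone (by omega), rfl, rfl⟩)
        ⟨_, _, _, _, hV, (S.mono 3).monotone (by omega), (S.mono 3).monotone (by omega), rfl, rfl⟩⟩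

theorem left_side_mem_pathNW (hC : C.Valid) {b : ℕ} (hb : b ≤ C.M 3) {y : ℝ}
    (h1 : S.X 3 (b + 1) ≤ y) (h2 : y ≤ S.X 3 (b + 2)) :
    (S.X 0 (-(C.g 2 b + 1)), y) ∈ R.pathNW (S.X 0 (-1)) (S.X 3 (-1)) := by
  obtain ⟨y', hy, hleg⟩ := S.exists_leg hC hb
  refine ⟨_, _, _, hleg, mem_segment_vertical (hy.trans h1) (h2.trans ((S.mono 3).monotone ?_))⟩
  have := (C.g_le_iff (k := 2) hb).1 le_rfl
  omega

/-- The path climbs vertical line `g 2 (f 2 j) ≤ j` up to the height of the upper side of rectangle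
`j`. There it turns left as far as line `g 2 (f 2 j + 1) > j`, passing along that whole side. -/
theorem top_side_mem_pathNW (hC : C.Valid) {j : ℕ} (hj : j ≤ C.M 2) {x : ℝ}
    (h1 : S.X 0 (-(j + 2)) ≤ x) (h2 : x ≤ S.X 0 (-(j + 1))) :
    (x, S.X 3 (C.f 2 j + 2)) ∈ R.pathNW (S.X 0 (-1)) (S.X 3 (-1)) := by
  have hb : C.f 2 j ≤ C.M 3 := C.le 2 j
  obtain ⟨y', hy, hleg⟩ := S.exists_leg hC hb
  have hg : C.g 2 (C.f 2 j) ≤ j := (C.g_le_iff (k := 2) hb).2 le_rfl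
  have hfg : C.f 2 (C.g 2 (C.f 2 j)) = C.f 2 j :=
    le_antisymm (C.mono 2 hg) ((C.g_le_iff (k := 2) hb).1 le_rfl)
  have hg' : j < C.g 2 (C.f 2 j + 1) := by
    rcases hb.lt_or_eq with h | h
    · rw [C.lt_g_iff (k := 2) h]; exact Nat.lt_succ_self _
    · have : C.g 2 (C.M 3 + 1) = C.M 2 + 1 := C.g_of_lt (k := 2) (Nat.lt_succ_self _)
      rw [h, this]; omega
  rw [hfg] at hleg
  have hN := (S.isHSeg_north (j := C.f 2 j + 1) (by omega)).2 ⟨rfl, rfl⟩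
  have e : ((C.f 2 j + 1 : ℕ) : ℤ) + 1 = C.f 2 j + 2 := by push_cast; ring
  rw [e] at hN
  refine ⟨_, _, _, .turnG hleg ⟨_, _, _, _, hN, (S.mono 0).monotone ?_, (S.mono 0).monotone ?_,
    rfl, rfl⟩, mem_segment_horizontal (((S.mono 0).monotone ?_).trans h1)
    (h2.trans ((S.mono 0).monotone ?_))⟩ <;> omega

theorem X_zero_neg (t : ℤ) : S.X 2 t = -S.X 0 (-t) := by
  have := S.neg 0 (-t)
  rw [neg_neg] at this
  exact this

theorem X_three_neg (t : ℤ) : S.X 1 t = -S.X 3 (-t) := by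
  have := S.neg 3 (-t)
  rw [neg_neg] at this
  exact this

/-- The quarter turn carries the lower sides of chain 2 to left sides of chain 3 and this path to
the north-western one. -/
theorem bottom_side_mem_pathSW (hC : C.Valid) {j : ℕ} (hj : j ≤ C.M 2) {x : ℝ}
    (h1 : S.X 0 (-(j + 2)) ≤ x) (h2 : x ≤ S.X 0 (-(j + 1))) :
    (x, S.X 3 (-(C.g 1 j + 1))) ∈ R.pathSW (S.X 0 1) (S.X 3 (-1)) := by
  have h := S.rot.left_side_mem_pathNW hC.rot (b := j) hj (y := -x)
    (show S.X 2 (j + 1) ≤ -x by rw [X_zero_neg]; linarith)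
    (show -x ≤ S.X 2 (j + 2) by rw [X_zero_neg]; linarith)
  have h' := pathNW_turn h
  rw [neg_neg] at h'
  have e : -S.rot.X 3 (-1) = S.X 0 1 := by
    show -S.X 2 (-1) = _
    rw [X_zero_neg]; simp
  rw [e] at h'
  exact h'

/-- A rectangle of chain 2 has its lower side on the south-western and its upper side on the
north-western path. The other chains follow by quarter turns. -/
theorem cell_subset_region (hC : C.Valid) (k : Fin 4) {j : ℕ} (hj : j ≤ C.M k) :
    R.cell (S.cell (C.node k j hj)) ⊆
      R.region (S.X 0 (-1)) (S.X 0 1) (S.X 3 (-1)) (S.X 3 1) k := by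
  have h2 : ∀ (R : Rectangulation n) (C : SpiralCode) (S : Spiral R C) (_ : C.Valid) (j : ℕ)
      (hj : j ≤ C.M 2), R.cell (S.cell (C.node 2 j hj)) ⊆
        R.region (S.X 0 (-1)) (S.X 0 1) (S.X 3 (-1)) (S.X 3 1) 2 := by
    rintro R C S hC j hj ⟨x, y⟩ hxy
    have c0 : C.coord 0 2 j = -(j + 1) := C.coord_two' 0 j
    have c1 : C.coord 1 2 j = C.g 1 j + 1 := C.coord_one' 1 j
    have c2 : C.coord 2 2 j = j + 2 := C.coord_zero 2 j
    have c3 : C.coord 3 2 j = C.f 2 j + 2 := C.coord_one 2 j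
    rw [mem_cell, S.left_eq, S.right_eq, S.bottom_eq, S.top_eq] at hxy
    simp only [C.v_node, c0, c1, c2, c3] at hxy
    obtain ⟨⟨h1, h2⟩, h3, h4⟩ := hxy
    exact ⟨⟨_, h3, S.bottom_side_mem_pathSW hC hj h1 h2⟩, _, h4, S.top_side_mem_pathNW hC hj h1 h2⟩
  have step : ∀ k : Fin 4, (∀ (R : Rectangulation n) (C : SpiralCode) (S : Spiral R C)
      (_ : C.Valid) (j : ℕ) (hj : j ≤ C.M (k + 1)), R.cell (S.cell (C.node (k + 1) j hj)) ⊆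
        R.region (S.X 0 (-1)) (S.X 0 1) (S.X 3 (-1)) (S.X 3 1) (k + 1)) →
      (∀ (R : Rectangulation n) (C : SpiralCode) (S : Spiral R C) (_ : C.Valid) (j : ℕ)
      (hj : j ≤ C.M k), R.cell (S.cell (C.node k j hj)) ⊆
        R.region (S.X 0 (-1)) (S.X 0 1) (S.X 3 (-1)) (S.X 3 1) k) := by
    rintro k H R C S hC j hj ⟨x, y⟩ hxy
    obtain ⟨hj', e⟩ := S.rot_cell_node k j hj
    have h := H R.rot C.rot S.rot hC.rot j hj'
    rw [e] at h
    have h' := h (R.rot_mem_cell.2 hxy)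
    have e0 : S.rot.X 3 (-1) = -S.X 0 1 := S.X_zero_neg (-1)
    have e1 : S.rot.X 3 1 = -S.X 0 (-1) := S.X_zero_neg 1
    rw [e0, e1] at h'
    have := region_turn k h'
    rwa [neg_neg] at this
  have h1 := step 1 h2
  have h0 := step 0 h1
  have h3 := step 3 h0
  fin_cases k
  · exact h0 R C S hC j hj
  · exact h1 R C S hC j hj
  · exact h2 R C S hC j hj
  · exact h3 R C S hC j hj

/-- The windmill is that of the centre, as the cycles of `g` vanish. Region `k` lies beyond side `k`
of the centre, where there are only rectangles of chain `k`. -/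
theorem hasColour_iff (hC : C.Valid) (i k : Fin 4) {j : ℕ} (hj : j ≤ C.M i) :
    R.HasColour (S.cell (C.node i j hj)) k ↔ i = k := by
  constructor
  · rintro ⟨a, b, c, d, hw, hsub⟩
    obtain ⟨w, hw', rfl, rfl, rfl, rfl⟩ := S.isWindmill_iff.1 hw
    have e : ∀ k, ![S.X 0 1, -S.X 3 (-1), -S.X 0 (-1), S.X 3 1] k = S.X k 1 := by
      intro k
      fin_cases k
      · rfl
      · exact (S.X_three_neg 1).symm
      · exact (S.X_zero_neg 1).symm
      · rfl
    simp only [SpiralCode.g_cycle_eq_zero hC hw', CharP.cast_eq_zero, zero_add] at hsub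
    have hlt := R.left_lt_right (S.cell (C.node i j hj))
    have hbt := R.bottom_lt_top (S.cell (C.node i j hj))
    have hsw := region_le (hsub (R.mem_cell.2 ⟨⟨le_rfl, hlt.le⟩, le_rfl, hbt.le⟩))
    have hne := region_le (hsub (R.mem_cell.2 ⟨⟨hlt.le, le_rfl⟩, hbt.le, le_rfl⟩))
    rw [e] at hsw hne
    have hin : S.X k 1 ≤ -R.ext (k + 2) (S.cell (C.node i j hj)) := by
      clear hsub e
      fin_cases k
      · simpa using hsw
      · simpa using hne
      · simpa using hne
      · simpa using hsw
    rw [S.ext, S.X_neg, add_two_two, (S.mono k).le_iff_le, C.v_node] at hin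
    rcases Direction.cases k i with rfl | rfl | rfl | rfl
    · rfl
    · rw [C.coord_two_one] at hin; omega
    · rw [C.coord_zero] at hin; omega
    · rw [C.coord_two_three] at hin; omega
  · rintro rfl
    exact ⟨_, _, _, _, S.isWindmill_centre, S.cell_subset_region hC i hj⟩

theorem touchesBorder_iff (p : C.Node) :
    R.TouchesBorder (S.cell p) ↔ ∃ k, C.v k p = C.M k + 2 := by
  have : ∀ k, C.v k p = C.M k + 2 ↔ R.ext k (S.cell p) = R.bd k := fun k => by
    rw [S.ext, S.bd, (S.mono k).injective.eq_iff]
  simp only [this]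
  constructor
  · rintro (h | h | h | h)
    · exact ⟨2, neg_inj.2 h⟩
    · exact ⟨0, h⟩
    · exact ⟨1, neg_inj.2 h⟩
    · exact ⟨3, h⟩
  · rintro ⟨k, h⟩
    fin_cases k
    · exact .inr (.inl h)
    · exact .inr (.inr (.inl (neg_inj.1 h)))
    · exact .inl (neg_inj.1 h)
    · exact .inr (.inr (.inr h))

end Spiral

/-! ### Border rectangles of each colour -/

/-- The number of elements of chain `k` that are mapped to the greatest element. -/
def SpiralCode.tops (C : SpiralCode) (k : Fin 4) : ℕ :=
  ((Finset.range (C.M k + 1)).filter fun j => C.f k j = C.M (k + 1)).card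

/-- A rectangle of chain `k` touches the border only in direction `k + 1` or as the last one of its
chain, and the last one is also mapped to the greatest element. Direction `k + 3` is excluded since
`g` does not take its extra value. -/
theorem Spiral.borderCount_eq {n : ℕ} {R : Rectangulation n} {C : SpiralCode} (S : Spiral R C)
    (hC : C.Valid) (k : Fin 4) : R.borderCount k = C.tops k := by
  have touch : ∀ j hj, R.TouchesBorder (S.cell (C.node k j hj)) ↔ C.f k j = C.M (k + 1) := by
    intro j hj
    rw [S.touchesBorder_iff]
    constructor
    · rintro ⟨i, hi⟩
      rw [C.v_node] at hi
      rcases Direction.cases k i with rfl | rfl | rfl | rfl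
      · rw [C.coord_zero] at hi
        rw [show j = C.M i by omega, hC.1]
      · rw [C.coord_one] at hi; omega
      · rw [C.coord_two] at hi; omega
      · rw [C.coord_three] at hi
        have := SpiralCode.g_le_of_top hC.1 (k := k + 3) (j := j) (by rwa [add_three_one])
        omega
    · intro h
      exact ⟨k + 1, by rw [C.v_node, C.coord_one, h]⟩
  rw [SpiralCode.tops, Rectangulation.borderCount, ← Set.ncard_coe_finset]
  symm
  refine Set.ncard_congr (fun j hj => S.cell (C.node k j ?_)) ?_ ?_ ?_
  · simp at hj; omega
  · intro j hj
    simp only [Finset.coe_filter, Finset.mem_range, mem_ofPred_eq] at hj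
    exact ⟨(S.hasColour_iff hC k k _).2 rfl, (touch j _).2 hj.2⟩
  · intro a b ha hb h
    have := S.cell.injective h
    simpa [SpiralCode.node] using this
  · rintro c ⟨h1, h2⟩
    obtain ⟨p, rfl⟩ := S.cell.surjective c
    induction p using C.node_cases with
    | none =>
      obtain ⟨i, hi⟩ := (S.touchesBorder_iff _).1 h2
      rw [C.v_none] at hi
      omega
    | node i j hj =>
      obtain rfl := (S.hasColour_iff hC i k hj).1 h1
      refine ⟨j, ?_, rfl⟩
      simp only [Finset.coe_filter, Finset.mem_range, mem_ofPred_eq]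
      exact ⟨by omega, (touch j hj).1 h2⟩

/-! ### The rectangulation with a given code -/

namespace SpiralCode

variable (C : SpiralCode)

theorem v_opposite_lt_one {k : Fin 4} {p : C.Node} (h : C.v (k + 2) p < 1) :
    ∃ j hj, p = C.node k j hj := by
  induction p using C.node_cases with
  | none => rw [v_none] at h; omega
  | node i j hj =>
    rw [v_node] at h
    rcases Direction.cases k i with rfl | rfl | rfl | rfl
    · exact ⟨j, hj, rfl⟩
    · rw [coord_two_one] at h; omega
    · rw [coord_zero] at h; omega
    · rw [coord_two_three] at h; omega

/-- No four nodes meet in a point. -/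
theorem ncard_nodes_le {P : Fin 4 → ℝ} (hP : ∀ k, P (k + 2) = -P k) :
    {p : C.Node | ∀ k, P k ≤ C.v k p}.ncard ≤ 3 := by
  classical
  have side : ∀ k, P (k + 2) < 1 ∨ P k < 1 := fun k => by
    rw [hP]
    rcases lt_or_ge (P k) 1 with h | h
    · exact .inr h
    · left; linarith
  -- The point is strictly within the lines of sides `α + 2` and `β + 2` of the centre. A node
  -- containing it is encoded by two bits: whether it continues past the point in these two
  -- directions. Distinct nodes differ in a bit because they are separated at the point; two false
  -- bits would place the node in both chains `α` and `β`.
  obtain ⟨α, hα, hα'⟩ : ∃ α : Fin 4, (α = 0 ∨ α = 2) ∧ P (α + 2) < 1 := by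
    rcases side 0 with h | h
    · exact ⟨0, .inl rfl, h⟩
    · exact ⟨2, .inr rfl, h⟩
  obtain ⟨β, hβ, hβ'⟩ : ∃ β : Fin 4, (β = 1 ∨ β = 3) ∧ P (β + 2) < 1 := by
    rcases side 1 with h | h
    · exact ⟨1, .inl rfl, h⟩
    · exact ⟨3, .inr rfl, h⟩
  have hαβ : α ≠ β := by rcases hα with rfl | rfl <;> rcases hβ with rfl | rfl <;> decide
  have hk : ∀ k : Fin 4, k = α ∨ k = α + 2 ∨ k = β ∨ k = β + 2 := by
    rcases hα with rfl | rfl <;> rcases hβ with rfl | rfl <;> decide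
  have hcard : (Finset.univ.erase (false, false) : Finset (Bool × Bool)).card = 3 := rfl
  rw [← hcard, ← Set.ncard_coe_finset]
  refine Set.ncard_le_ncard_of_injOn
    (fun p => (decide (P (α + 2) < C.v (α + 2) p), decide (P (β + 2) < C.v (β + 2) p)))
    ?_ ?_ (Finset.finite_toSet _)
  · intro p hp
    simp only [Finset.coe_erase, Finset.coe_univ, mem_sdiff, mem_univ, true_and, mem_singleton_iff,
      Prod.mk.injEq, decide_eq_false_iff_not, not_lt]
    rintro ⟨h1, h2⟩
    obtain ⟨j, hj, rfl⟩ := C.v_opposite_lt_one (k := α) (p := p)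
      (by exact_mod_cast h1.trans_lt hα')
    obtain ⟨j', hj', e⟩ := C.v_opposite_lt_one (k := β) (p := C.node α j hj)
      (by exact_mod_cast h2.trans_lt hβ')
    have := congrArg (Option.map Sigma.fst) e
    exact hαβ (Option.some_injective _ this)
  · intro p hp q hq hpq
    simp only [mem_ofPred_eq] at hp hq
    simp only [Prod.mk.injEq, decide_eq_decide] at hpq
    by_contra hne
    obtain ⟨k, hk'⟩ := C.exists_v_le hne
    have hk'' : (C.v k p : ℝ) ≤ -C.v (k + 2) q := by exact_mod_cast hk'
    have e := hP k
    have h1 := hp k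
    have h2 := hq (k + 2)
    have hp' : (0 : ℝ) < C.v k p + C.v (k + 2) p := by exact_mod_cast C.v_pos k p
    have hq' : (0 : ℝ) < C.v k q + C.v (k + 2) q := by exact_mod_cast C.v_pos k q
    have A : ¬ (P k < C.v k p ↔ P k < C.v k q) := fun H => by
      have := H.2 (by linarith)
      linarith
    have B : ¬ (P (k + 2) < C.v (k + 2) p ↔ P (k + 2) < C.v (k + 2) q) := fun H => by
      have := H.1 (by linarith)
      linarith
    rcases hk k with rfl | rfl | rfl | rfl
    · exact B hpq.1
    · exact A hpq.1
    · exact B hpq.2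
    · exact A hpq.2

theorem forall_le_iff {x y : ℝ} {w : Fin 4 → ℤ} : (∀ k, ![x, -y, -x, y] k ≤ w k) ↔
    (-w 2 ≤ x ∧ x ≤ w 0) ∧ -w 1 ≤ y ∧ y ≤ w 3 := by
  constructor
  · intro h
    have h0 : x ≤ w 0 := h 0
    have h1 : -y ≤ w 1 := h 1
    have h2 : -x ≤ w 2 := h 2
    have h3 : y ≤ w 3 := h 3
    refine ⟨⟨?_, ?_⟩, ?_, ?_⟩ <;> linarith
  · rintro ⟨⟨h2, h0⟩, h1, h3⟩ k
    fin_cases k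
    · exact h0
    · exact neg_le.1 h1
    · exact neg_le.1 h2
    · exact h3

variable {n : ℕ} (hn : ∑ k, C.M k + 5 = n)

include hn in
theorem card_node_eq : Fintype.card C.Node = n := C.card_node.trans hn

/-- The rectangulation with code `C` whose sides have integer coordinates. -/
noncomputable def toRectangulation : Rectangulation n where
  west := -(C.M 2 + 2 : ℤ)
  east := (C.M 0 + 2 : ℤ)
  south := -(C.M 1 + 2 : ℤ)
  north := (C.M 3 + 2 : ℤ)
  west_lt_east := by push_cast; linarith [(C.M 2).cast_nonneg (α := ℝ), (C.M 0).cast_nonneg (α := ℝ)]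
  south_lt_north := by push_cast; linarith [(C.M 1).cast_nonneg (α := ℝ), (C.M 3).cast_nonneg (α := ℝ)]
  left i := -C.v 2 ((Fintype.equivFinOfCardEq (C.card_node_eq hn)).symm i)
  right i := C.v 0 ((Fintype.equivFinOfCardEq (C.card_node_eq hn)).symm i)
  bottom i := -C.v 1 ((Fintype.equivFinOfCardEq (C.card_node_eq hn)).symm i)
  top i := C.v 3 ((Fintype.equivFinOfCardEq (C.card_node_eq hn)).symm i)
  left_lt_right i := by
    have := C.v_pos 0 ((Fintype.equivFinOfCardEq (C.card_node_eq hn)).symm i)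
    exact_mod_cast neg_lt_iff_pos_add.2 this
  bottom_lt_top i := by
    have := C.v_pos 1 ((Fintype.equivFinOfCardEq (C.card_node_eq hn)).symm i)
    exact_mod_cast neg_lt_iff_pos_add'.2 this
  cover := by
    rw [Rectangulation.cover_iff]
    intro x y
    refine Iff.trans ?_ (forall_le_iff (w := fun k => C.M k + 2))
    constructor
    · rintro ⟨i, hi⟩ k
      exact ((forall_le_iff (w := fun k => C.v k _)).2 hi k).trans (by exact_mod_cast C.v_le k _)
    · intro h
      obtain ⟨p, hp⟩ := C.exists_node_cover (X := fun _ t => (t : ℝ)) (P := ![x, -y, -x, y])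
        (fun _ => Int.cast_strictMono) (fun _ t => Int.cast_neg t)
        (by intro k; fin_cases k <;> simp) h
      exact ⟨Fintype.equivFinOfCardEq (C.card_node_eq hn) p, by
        simpa only [Equiv.symm_apply_apply] using (forall_le_iff (w := fun k => C.v k p)).1 hp⟩
  disjoint_interiors i j hij := by
    obtain ⟨k, hk⟩ := C.exists_v_le
      ((Fintype.equivFinOfCardEq (C.card_node_eq hn)).symm.injective.ne hij)
    have hk' : (C.v k ((Fintype.equivFinOfCardEq (C.card_node_eq hn)).symm i) : ℝ) ≤
      -C.v (k + 2) ((Fintype.equivFinOfCardEq (C.card_node_eq hn)).symm j) := by exact_mod_cast hk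
    rw [Set.disjoint_left]
    rintro ⟨x, y⟩ ⟨⟨a1, a2⟩, a3, a4⟩ ⟨⟨b1, b2⟩, b3, b4⟩
    simp only at a1 a2 a3 a4 b1 b2 b3 b4
    fin_cases k
    · exact absurd (show (C.v 0 _ : ℝ) ≤ -C.v 2 _ from hk') (by linarith)
    · exact absurd (show (C.v 1 _ : ℝ) ≤ -C.v 3 _ from hk') (by linarith)
    · exact absurd (show (C.v 2 _ : ℝ) ≤ -C.v 0 _ from hk') (by linarith)
    · exact absurd (show (C.v 3 _ : ℝ) ≤ -C.v 1 _ from hk') (by linarith)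
  no_four := by
    rintro ⟨x, y⟩
    have h := C.ncard_nodes_le (P := ![x, -y, -x, y]) (by intro k; fin_cases k <;> simp)
    rw [← Set.ncard_image_of_injective _ (Fintype.equivFinOfCardEq (C.card_node_eq hn)).injective,
      Equiv.image_eq_preimage_symm] at h
    convert h using 2
    ext i
    exact (forall_le_iff (w := fun k => C.v k _)).symm

/-- The rectangulation with code `C` is a spiral with code `C`. -/
noncomputable def spiral : Spiral (C.toRectangulation hn) C where
  cell := Fintype.equivFinOfCardEq (C.card_node_eq hn)
  X _ t := t
  mono _ := Int.cast_strictMono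
  neg _ t := Int.cast_neg t
  ext k p := by
    fin_cases k <;> simp [Rectangulation.ext, toRectangulation]
  bd k := by
    fin_cases k <;> simp [Rectangulation.bd, toRectangulation]

end SpiralCode

/-! ### Adjacency of nodes -/

namespace SpiralCode

/-- Node `q` is adjacent to node `p` in direction `k`. -/
def Adj (C : SpiralCode) (k : Fin 4) (p q : C.Node) : Prop :=
  C.v k p = -C.v (k + 2) q ∧ -C.v (k + 3) p < C.v (k + 1) q ∧ -C.v (k + 3) q < C.v (k + 1) p

variable {C D : SpiralCode}

theorem adj_reverse (k : Fin 4) (p q : C.Node) : C.Adj (k + 2) p q ↔ C.Adj k q p := by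
  rw [Adj, Adj, add_two_two, add_two_three, add_two_one]
  omega

/-- Only one rectangle begins at a given line of chain `k`, so adjacency across that line determines
the neighbour. -/
theorem Adj.eq_node {k : Fin 4} {p q : C.Node} {j : ℕ} (h : C.Adj k p q)
    (hp : C.v k p = j + 1) : ∃ hj, q = C.node k j hj := by
  have h1 := h.1
  obtain ⟨j', hj, rfl⟩ := C.v_opposite_lt_one (k := k) (p := q) (by omega)
  rw [v_node, coord_two] at h1
  obtain rfl : j' = j := by omega
  exact ⟨hj, rfl⟩

theorem adj_none (k : Fin 4) : C.Adj k none (C.node k 0 (Nat.zero_le _)) := by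
  simp only [Adj, v_none, v_node, coord_two, coord_one, coord_three]
  omega

theorem adj_node_succ {k : Fin 4} {j : ℕ} (hj : j + 1 ≤ C.M k) :
    C.Adj k (C.node k j (by omega)) (C.node k (j + 1) hj) := by
  simp only [Adj, v_node, coord_zero, coord_two, coord_one, coord_three]
  omega

theorem adj_node_next {k : Fin 4} {j : ℕ} (hj : j ≤ C.M k) (h : C.f k j + 1 ≤ C.M (k + 1)) :
    C.Adj (k + 1) (C.node k j hj) (C.node (k + 1) (C.f k j + 1) h) := by
  have hg : j < C.g k (C.f k j + 1) := (C.lt_g_iff h).2 (by omega)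
  simp only [Adj, v_node, add_one_two, add_one_three, add_one_one, coord_one, coord_zero,
    coord_three_one, coord_two, coord_one', coord_two_one]
  omega

theorem adj_windmill (k : Fin 4) :
    C.Adj k (C.node (k + 1) 0 (Nat.zero_le _)) (C.node k 0 (Nat.zero_le _)) := by
  simp only [Adj, v_node, coord_one', coord_two, coord_three_one, coord_one, coord_three, coord_zero,
    C.g_zero]
  omega

/-- The centre is the only node that is the interior of a windmill. -/
theorem eq_none_of_windmill {p : C.Node} {q : Fin 4 → C.Node}
    (h : ∀ k, C.Adj k p (q k) ∧ C.Adj k (q (k + 1)) (q k)) : p = none := by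
  induction p using C.node_cases with
  | none => rfl
  | node i j hj =>
    exfalso
    -- The neighbour of `p` in direction `i + 3` lies in chain `i + 3`, so its coordinate in
    -- direction `i + 2` is positive. The windmill condition forces it to be that of `p`, which is
    -- negative.
    have h1 := (h (i + 2)).1.1
    have h2 := (h (i + 2)).2.1
    rw [v_node, coord_two] at h1
    rw [← h1, add_two_one] at h2
    obtain ⟨hb, e⟩ := (h (i + 3)).1.eq_node (j := C.g (i + 3) j) (by rw [v_node, coord_three])
    rw [e, v_node] at h2
    have := C.coord_one' (i + 2) (C.g (i + 3) j)
    rw [add_two_one] at this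
    omega

section Hom

variable {τ : C.Node → D.Node} (hτ : ∀ k p q, C.Adj k p q → D.Adj k (τ p) (τ q))

include hτ

theorem hom_none : τ none = none :=
  eq_none_of_windmill (q := fun k => τ (C.node k 0 (Nat.zero_le _))) fun k =>
    ⟨hτ _ _ _ (adj_none k), hτ _ _ _ (adj_windmill k)⟩

theorem hom_node {k : Fin 4} {j : ℕ} (hj : j ≤ C.M k) :
    ∃ hj', τ (C.node k j hj) = D.node k j hj' := by
  induction j with
  | zero =>
    have h := hτ _ _ _ (adj_none k)
    rw [hom_none hτ] at h
    exact h.eq_node (by rw [v_none]; rfl)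
  | succ j ih =>
    have h := hτ _ _ _ (adj_node_succ hj)
    obtain ⟨hj', e⟩ := ih (by omega)
    rw [e] at h
    exact h.eq_node (by rw [v_node, coord_zero]; push_cast; ring)

/-- The rectangle that begins where `j` ends in direction `k + 1` has number `f k j + 1`. There is
none if `f k j` is the greatest element; this value is recovered by exclusion in `eq_of_adj_iff`. -/
theorem hom_f {k : Fin 4} {j : ℕ} (hj : j ≤ C.M k) (h : C.f k j < C.M (k + 1)) :
    D.f k j = C.f k j := by
  have h' := hτ _ _ _ (adj_node_next hj h)
  obtain ⟨hj', e⟩ := hom_node hτ hj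
  obtain ⟨hb', e'⟩ := hom_node hτ h
  rw [e, e'] at h'
  have := h'.1
  rw [v_node, v_node, add_one_two, coord_one, coord_three_one] at this
  omega

end Hom

/-- A code is determined by the adjacencies of its nodes. -/
theorem eq_of_adj_iff (τ : C.Node ≃ D.Node) (hτ : ∀ k p q, C.Adj k p q ↔ D.Adj k (τ p) (τ q)) :
    C = D := by
  have h1 : ∀ k p q, C.Adj k p q → D.Adj k (τ p) (τ q) := fun k p q => (hτ k p q).1
  have h2 : ∀ k p q, D.Adj k p q → C.Adj k (τ.symm p) (τ.symm q) := fun k p q h => by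
    rw [hτ, τ.apply_symm_apply, τ.apply_symm_apply]; exact h
  have hM : C.M = D.M := funext fun k => by
    obtain ⟨a, -⟩ := hom_node h1 (le_refl (C.M k))
    obtain ⟨b, -⟩ := hom_node h2 (le_refl (D.M k))
    exact le_antisymm a b
  refine SpiralCode.ext hM (funext fun k => funext fun j => ?_)
  have eM := congrFun hM (k + 1)
  rcases lt_or_ge (C.M k) j with hj | hj
  · rw [C.const k j hj, D.const k j (hM ▸ hj), hM]
  · have lC := C.le k j
    have lD := D.le k j
    rcases lC.lt_or_eq with h | h
    · exact (hom_f h1 hj h).symm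
    · rcases lD.lt_or_eq with h' | h'
      · exact hom_f h2 (hj.trans_eq (congrFun hM k)) h'
      · omega

end SpiralCode

namespace Spiral

variable {n : ℕ} {R R' : Rectangulation n} {C D : SpiralCode} (S : Spiral R C) (T : Spiral R' D)

include S in
theorem leftAdj_iff (p q : C.Node) : R.LeftAdj (S.cell p) (S.cell q) ↔ C.Adj 0 p q := by
  have hp := R.bottom_lt_top (S.cell p)
  have hq := R.bottom_lt_top (S.cell q)
  simp only [Rectangulation.LeftAdj, max_lt_iff, lt_min_iff, hp, hq, true_and, and_true]
  rw [S.right_eq, S.left_eq, S.bottom_eq, S.bottom_eq, S.top_eq, S.top_eq,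
    (S.mono 0).injective.eq_iff, (S.mono 3).lt_iff_lt, (S.mono 3).lt_iff_lt]
  show C.v 0 p = -C.v 2 q ∧ _ ↔ C.v 0 p = -C.v 2 q ∧ -C.v 3 p < C.v 1 q ∧ -C.v 3 q < C.v 1 p
  omega

include S in
theorem belowAdj_iff (p q : C.Node) : R.BelowAdj (S.cell p) (S.cell q) ↔ C.Adj 3 p q := by
  have hp := R.left_lt_right (S.cell p)
  have hq := R.left_lt_right (S.cell q)
  simp only [Rectangulation.BelowAdj, max_lt_iff, lt_min_iff, hp, hq, true_and, and_true]
  rw [S.top_eq, S.bottom_eq, S.left_eq, S.left_eq, S.right_eq, S.right_eq,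
    (S.mono 3).injective.eq_iff, (S.mono 0).lt_iff_lt, (S.mono 0).lt_iff_lt]
  show C.v 3 p = -C.v 1 q ∧ _ ↔ C.v 3 p = -C.v 1 q ∧ -C.v 2 p < C.v 0 q ∧ -C.v 2 q < C.v 0 p
  omega

include T S in
/-- Rectangulations are equivalent if and only if they have the same code. -/
theorem equivalent_iff : R.Equivalent R' ↔ C = D := by
  constructor
  · rintro ⟨σ, h⟩
    refine SpiralCode.eq_of_adj_iff ((S.cell.trans σ).trans T.cell.symm) fun k p q => ?_
    have h' := h (S.cell p) (S.cell q)
    have h'' := h (S.cell q) (S.cell p)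
    obtain ⟨p', hp'⟩ := T.cell.surjective (σ (S.cell p))
    obtain ⟨q', hq'⟩ := T.cell.surjective (σ (S.cell q))
    simp only [Equiv.trans_apply, ← hp', ← hq', Equiv.symm_apply_apply, S.leftAdj_iff,
      S.belowAdj_iff, T.leftAdj_iff, T.belowAdj_iff] at h' h'' ⊢
    -- Equivalence speaks of the directions 0 and 3 only; the opposite two are obtained by
    -- exchanging the rectangles.
    fin_cases k
    · exact h'.1
    · exact (SpiralCode.adj_reverse 3 p q).trans (h''.2.trans (SpiralCode.adj_reverse 3 p' q').symm)
    · exact (SpiralCode.adj_reverse 0 p q).trans (h''.1.trans (SpiralCode.adj_reverse 0 p' q').symm)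
    · exact h'.2
  · rintro rfl
    refine ⟨S.cell.symm.trans T.cell, fun c c' => ?_⟩
    obtain ⟨p, rfl⟩ := S.cell.surjective c
    obtain ⟨q, rfl⟩ := S.cell.surjective c'
    simp only [Equiv.trans_apply, Equiv.symm_apply_apply, S.leftAdj_iff, S.belowAdj_iff,
      T.leftAdj_iff, T.belowAdj_iff, and_self]

include S in
theorem sum_M_add_five : ∑ k, C.M k + 5 = n := by
  have := Fintype.card_congr S.cell
  rwa [C.card_node, Fintype.card_fin] at this

end Spiral

/-! ### Simple whirls and valid codes -/

/-- The valid codes with `N + 5` nodes. -/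
def validCodes (N : ℕ) : Set SpiralCode := {C | C.Valid ∧ ∑ k, C.M k = N}

theorem finite_validCodes (N : ℕ) : (validCodes N).Finite := by
  -- Chain lengths and values are at most `N`, so reduction modulo `N + 1` loses nothing; beyond the
  -- chains the values are defaults.
  refine Set.Finite.of_injOn (t := Set.univ) (f := fun C k =>
    ((Fin.ofNat (N + 1) (C.M k)), fun j : Fin (N + 1) => Fin.ofNat (N + 1) (C.f k j)))
    (mapsTo_univ _ _) ?_ Set.finite_univ
  rintro C ⟨-, hC⟩ D ⟨-, hD⟩ h
  have lC : ∀ k, C.M k ≤ N := fun k =>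
    hC ▸ Finset.single_le_sum (f := C.M) (fun _ _ => Nat.zero_le _) (Finset.mem_univ k)
  have lD : ∀ k, D.M k ≤ N := fun k =>
    hD ▸ Finset.single_le_sum (f := D.M) (fun _ _ => Nat.zero_le _) (Finset.mem_univ k)
  have key : ∀ a b : ℕ, a ≤ N → b ≤ N → Fin.ofNat (N + 1) a = Fin.ofNat (N + 1) b → a = b := by
    intro a b ha hb e
    have := congrArg Fin.val e
    rwa [Fin.val_ofNat, Fin.val_ofNat, Nat.mod_eq_of_lt (by omega), Nat.mod_eq_of_lt (by omega)]
      at this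
  have hM : C.M = D.M := funext fun k => key _ _ (lC k) (lD k) (congrArg Prod.fst (congrFun h k))
  refine SpiralCode.ext hM (funext fun k => funext fun j => ?_)
  rcases lt_or_ge (C.M k) j with hj | hj
  · rw [C.const k j hj, D.const k j (hM ▸ hj), hM]
  · have := congrFun (congrArg Prod.snd (congrFun h k)) ⟨j, by have := lC k; omega⟩
    exact key _ _ ((C.le k j).trans (lC _)) ((D.le k j).trans (lD _)) this

/-- The class of simple whirls with a given valid code. -/
noncomputable def whirlOfCode (N : ℕ) (C : validCodes N) :
    Quotient (Rectangulation.setoid (N + 5)) :=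
  Quotient.mk _ (C.1.toRectangulation (by rw [C.2.2]))

theorem whirlOfCode_injective (N : ℕ) : Function.Injective (whirlOfCode N) := fun C D h =>
  Subtype.ext (((C.1.spiral _).equivalent_iff (D.1.spiral _)).1 (Quotient.exact h))

theorem Rectangulation.IsSimpleWhirl.exists_code {n : ℕ} {R : Rectangulation n}
    (h : R.IsSimpleWhirl) : ∃ C, C.Valid ∧ Nonempty (Spiral R C) := by
  have ⟨⟨⟨_, h3, h4, h5, h6, h7, h8⟩, _⟩, _, a, b, c, d, hw, _, z, hz⟩ := h
  obtain ⟨C, S, -⟩ := R.exists_spiral ⟨h3, h4, h5, h6, h7, h8⟩ hw hz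
  exact ⟨C, S.valid h, ⟨S⟩⟩

theorem simpleWhirlsWith_eq_image (N : ℕ) (m : Fin 4 → ℕ) :
    simpleWhirlsWith (N + 5) m = whirlOfCode N '' {C | ∀ k, C.1.tops k = m k} := by
  ext W
  constructor
  · rintro ⟨R, rfl, hR, hm⟩
    obtain ⟨C, hC, ⟨S⟩⟩ := hR.exists_code
    have hN := S.sum_M_add_five
    refine ⟨⟨C, hC, by omega⟩, fun k => ?_, Quotient.sound (((C.spiral hN).equivalent_iff S).2 rfl)⟩
    rw [← hm k, S.borderCount_eq hC]
  · rintro ⟨C, hm, rfl⟩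
    refine ⟨_, rfl, (C.1.spiral _).isSimpleWhirl C.2.1, fun k => ?_⟩
    rw [(C.1.spiral _).borderCount_eq C.2.1, hm]

theorem simpleWhirls_eq_range (N : ℕ) : simpleWhirls (N + 5) = range (whirlOfCode N) := by
  ext W
  constructor
  · rintro ⟨R, rfl, hR⟩
    obtain ⟨C, hC, ⟨S⟩⟩ := hR.exists_code
    have hN := S.sum_M_add_five
    exact ⟨⟨C, hC, by omega⟩, Quotient.sound (((C.spiral hN).equivalent_iff S).2 rfl)⟩
  · rintro ⟨C, rfl⟩
    exact ⟨_, rfl, (C.1.spiral _).isSimpleWhirl C.2.1⟩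

theorem simpleWhirls_eq_empty {n : ℕ} (hn : n < 5) : simpleWhirls n = ∅ := by
  rw [Set.eq_empty_iff_forall_notMem]
  rintro W ⟨R, rfl, hR⟩
  obtain ⟨C, hC, ⟨S⟩⟩ := hR.exists_code
  have := S.sum_M_add_five
  omega

theorem simpleWhirlsWith_subset (n : ℕ) (m : Fin 4 → ℕ) : simpleWhirlsWith n m ⊆ simpleWhirls n :=
  fun _ ⟨R, h, hR, _⟩ => ⟨R, h, hR⟩

theorem ncard_simpleWhirlsWith (N : ℕ) (m : Fin 4 → ℕ) :
    (simpleWhirlsWith (N + 5) m).ncard = {C ∈ validCodes N | ∀ k, C.tops k = m k}.ncard := by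
  rw [simpleWhirlsWith_eq_image, Set.ncard_image_of_injective _ (whirlOfCode_injective N),
    ← Set.ncard_image_of_injective _ Subtype.val_injective]
  congr 1
  ext C
  simp [and_comm]

theorem ncard_simpleWhirls (N : ℕ) : (simpleWhirls (N + 5)).ncard = (validCodes N).ncard := by
  rw [simpleWhirls_eq_range, ← Set.image_univ,
    Set.ncard_image_of_injective _ (whirlOfCode_injective N), Set.ncard_univ]
  rfl

theorem finite_simpleWhirls (n : ℕ) : (simpleWhirls n).Finite := by
  rcases lt_or_ge n 5 with hn | hn
  · rw [simpleWhirls_eq_empty hn]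
    exact Set.finite_empty
  · obtain ⟨N, rfl⟩ := Nat.exists_eq_add_of_le' hn
    rw [simpleWhirls_eq_range]
    have := (finite_validCodes N).to_subtype
    exact Set.finite_range _

/-! ### Counting the valid codes -/

namespace Direction

theorem succ_ne (k : Fin 4) : k + 1 ≠ k := by revert k; decide

end Direction

namespace SpiralCode

variable {C : SpiralCode}

/-- A code that preserves the greatest elements is valid if and only if no smaller elements form a
cycle. -/
theorem valid_iff : C.Valid ↔ (∀ k, C.f k (C.M k) = C.M (k + 1)) ∧
    ∀ j : Fin 4 → ℕ, ¬ ∀ k, j k < C.M k ∧ C.f k (j k) = j (k + 1) := by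
  refine and_congr_right fun h => ⟨fun h' j hj => ?_, fun h' k j hj => ?_⟩
  · have := h' 0 _ (hj 0).1
    have e0 : C.f 0 (j 0) = j 1 := (hj 0).2
    have e1 : C.f 1 (j 1) = j 2 := (hj 1).2
    have e2 : C.f 2 (j 2) = j 3 := (hj 2).2
    have e3 : C.f 3 (j 3) = j 0 := (hj 3).2
    simp only [zero_add, e0, e1, e2, e3, lt_irrefl] at this
  -- The composite has a fixed point `a ≤ j`. Its orbit is a cycle that avoids the greatest
  -- elements: from a greatest element on, all images are greatest, and `a` would be so too.
  · by_contra! hle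
    obtain ⟨a, ha, e⟩ := exists_fixed_of_map_le
      (φ := fun j => C.f (k + 3) (C.f (k + 2) (C.f (k + 1) (C.f k j))))
      (fun a b hab => C.mono _ (C.mono _ (C.mono _ (C.mono _ hab)))) hle
    have t1 := h (k + 1)
    have t2 := h (k + 2)
    have t3 := h (k + 3)
    rw [add_one_one] at t1
    rw [add_two_one] at t2
    rw [add_three_one] at t3
    have l1 := C.le (k + 1) (C.f k a)
    have l2 := C.le (k + 2) (C.f (k + 1) (C.f k a))
    rw [add_one_one] at l1
    rw [add_two_one] at l2
    refine h' (fun i => ![a, C.f k a, C.f (k + 1) (C.f k a), C.f (k + 2) (C.f (k + 1) (C.f k a))]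
      (i - k)) fun i => ?_
    rcases Direction.cases k i with rfl | rfl | rfl | rfl
    · refine ⟨?_, ?_⟩
      · simp; omega
      · simp
    · refine ⟨?_, ?_⟩
      · simp only [add_sub_cancel_left]
        refine (C.le _ _).lt_of_ne fun e' => ?_
        rw [e', t1, t2, t3] at e
        omega
      · rw [add_one_one]; simp
    · refine ⟨?_, ?_⟩
      · simp only [add_sub_cancel_left]
        refine l1.lt_of_ne fun e' => ?_
        rw [e', t2, t3] at e
        omega
      · rw [add_two_one]; simp
    · refine ⟨?_, ?_⟩
      · simp only [add_sub_cancel_left]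
        refine l2.lt_of_ne fun e' => ?_
        rw [e', t3] at e
        omega
      · rw [add_three_one]; simpa using e

/-- By monotonicity the elements mapped to the greatest one form a final segment of the chain.
Beyond the chain both sides are true. -/
theorem f_eq_top_iff (k : Fin 4) (j : ℕ) : C.f k j = C.M (k + 1) ↔ C.M k < j + C.tops k := by
  rcases lt_or_ge (C.M k) j with hj | hj
  · exact ⟨fun _ => by omega, fun _ => C.const k j hj⟩
  constructor
  · intro h
    have : Finset.Ico j (C.M k + 1) ⊆
        (Finset.range (C.M k + 1)).filter fun j => C.f k j = C.M (k + 1) := by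
      intro i hi
      simp only [Finset.mem_Ico, Finset.mem_filter, Finset.mem_range] at hi ⊢
      exact ⟨hi.2, le_antisymm (C.le k i) (h ▸ C.mono k hi.1)⟩
    have := Finset.card_le_card this
    rw [Nat.card_Ico, ← tops] at this
    omega
  · intro h
    by_contra hne
    have : (Finset.range (C.M k + 1)).filter (fun j => C.f k j = C.M (k + 1)) ⊆
        Finset.Ico (j + 1) (C.M k + 1) := by
      intro i hi
      simp only [Finset.mem_Ico, Finset.mem_filter, Finset.mem_range] at hi ⊢
      refine ⟨?_, hi.1⟩
      by_contra hij
      exact hne (le_antisymm (C.le k j) (hi.2 ▸ C.mono k (by omega)))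
    have := Finset.card_le_card this
    rw [Nat.card_Ico, ← tops] at this
    omega

theorem tops_le (C : SpiralCode) (k : Fin 4) : C.tops k ≤ C.M k + 1 :=
  (Finset.card_filter_le _ _).trans_eq (Finset.card_range _)

theorem tops_eq {k : Fin 4} {t : ℕ} (ht : t ≤ C.M k + 1)
    (h : ∀ j ≤ C.M k, C.f k j = C.M (k + 1) ↔ C.M k < j + t) : C.tops k = t := by
  have := C.tops_le k
  by_contra hne
  rcases Nat.lt_or_gt_of_ne hne with hlt | hlt
  · have h1 := (C.f_eq_top_iff k (C.M k + 1 - t)).1 ((h _ (by omega)).2 (by omega))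
    omega
  · have h1 := (h (C.M k + 1 - C.tops k) (by omega)).1 ((C.f_eq_top_iff k _).2 (by omega))
    omega

theorem Valid.one_le_tops (h : C.Valid) (k : Fin 4) : 1 ≤ C.tops k := by
  have := (C.f_eq_top_iff k _).1 (h.1 k)
  omega

/-- Removal of the greatest element of chain `k + 1`. -/
def shrink (C : SpiralCode) (k : Fin 4) (h : C.f (k + 1) (C.M (k + 1)) = C.M (k + 1 + 1)) :
    SpiralCode where
  M := Function.update C.M (k + 1) (C.M (k + 1) - 1)
  f := Function.update C.f k fun j => min (C.f k j) (C.M (k + 1) - 1)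
  mono i := by
    rcases eq_or_ne i k with rfl | hi
    · rw [Function.update_self]
      exact fun a b hab => min_le_min_right _ (C.mono _ hab)
    · rw [Function.update_of_ne hi]
      exact C.mono i
  le i j := by
    rcases eq_or_ne i k with rfl | hi
    · rw [Function.update_self, Function.update_self]
      exact min_le_right _ _
    · rw [Function.update_of_ne hi, Function.update_of_ne (by simpa using hi)]
      exact C.le i j
  const i j hj := by
    rcases eq_or_ne i k with rfl | hi
    · rw [Function.update_of_ne (succ_ne i).symm] at hj
      rw [Function.update_self, Function.update_self, C.const i j hj]
      omega
    · rw [Function.update_of_ne hi, Function.update_of_ne (by simpa using hi)]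
      rcases eq_or_ne i (k + 1) with rfl | hi'
      · rw [Function.update_self] at hj
        rcases lt_or_ge (C.M (k + 1)) j with hj' | hj'
        · exact C.const _ j hj'
        -- The removed element now lies outside the chain and must have the default value; the
        -- hypothesis `h` provides it.
        · rw [show j = C.M (k + 1) by omega, h]
      · rw [Function.update_of_ne hi'] at hj
        exact C.const i j hj

/-- Insertion of a new greatest element of chain `k + 1`, the image of the last `t` elements of
chain `k`. -/
def grow (C : SpiralCode) (k : Fin 4) (t : ℕ) : SpiralCode where
  M := Function.update C.M (k + 1) (C.M (k + 1) + 1)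
  f := Function.update C.f k fun j =>
    if C.M k < j + t then C.M (k + 1) + 1 else min (C.f k j) (C.M (k + 1))
  mono i := by
    rcases eq_or_ne i k with rfl | hi
    · rw [Function.update_self]
      intro a b hab
      have := C.mono i hab
      simp only
      split_ifs <;> omega
    · rw [Function.update_of_ne hi]
      exact C.mono i
  le i j := by
    rcases eq_or_ne i k with rfl | hi
    · rw [Function.update_self, Function.update_self]
      have := C.le i j
      split_ifs <;> omega
    · rw [Function.update_of_ne hi, Function.update_of_ne (by simpa using hi)]
      exact C.le i j
  const i j hj := by
    rcases eq_or_ne i k with rfl | hi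
    · rw [Function.update_of_ne (succ_ne i).symm] at hj
      rw [Function.update_self, Function.update_self, if_pos (by omega)]
    · rw [Function.update_of_ne hi, Function.update_of_ne (by simpa using hi)]
      refine C.const i j (lt_of_le_of_lt ?_ hj)
      rcases eq_or_ne i (k + 1) with rfl | hi'
      · rw [Function.update_self]; omega
      · rw [Function.update_of_ne hi']

section

variable {k : Fin 4} {t : ℕ} {h : C.f (k + 1) (C.M (k + 1)) = C.M (k + 1 + 1)}

theorem shrink_M_succ : (C.shrink k h).M (k + 1) = C.M (k + 1) - 1 := Function.update_self ..

theorem shrink_M_of_ne {i : Fin 4} (hi : i ≠ k + 1) : (C.shrink k h).M i = C.M i :=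
  Function.update_of_ne hi ..

theorem shrink_f_self (j : ℕ) : (C.shrink k h).f k j = min (C.f k j) (C.M (k + 1) - 1) := by
  show Function.update C.f k _ k j = _
  rw [Function.update_self]

theorem shrink_f_of_ne {i : Fin 4} (hi : i ≠ k) : (C.shrink k h).f i = C.f i :=
  Function.update_of_ne hi ..

theorem grow_M_succ : (C.grow k t).M (k + 1) = C.M (k + 1) + 1 := Function.update_self ..

theorem grow_M_of_ne {i : Fin 4} (hi : i ≠ k + 1) : (C.grow k t).M i = C.M i :=
  Function.update_of_ne hi ..

theorem grow_f_self (j : ℕ) : (C.grow k t).f k j =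
    if C.M k < j + t then C.M (k + 1) + 1 else C.f k j :=
  (congrFun (Function.update_self ..) j).trans (by rw [min_eq_left (C.le k j)])

theorem grow_f_of_ne {i : Fin 4} (hi : i ≠ k) : (C.grow k t).f i = C.f i :=
  Function.update_of_ne hi ..

theorem sum_grow_M : ∑ i, (C.grow k t).M i = ∑ i, C.M i + 1 := by
  have : (C.grow k t).M = C.M + Pi.single (k + 1) 1 := by
    ext i
    rcases eq_or_ne i (k + 1) with rfl | hi
    · simp [grow_M_succ]
    · simp [grow_M_of_ne hi, hi]
  rw [this]
  simp [Finset.sum_add_distrib]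

theorem shrink_grow {h} (ht : t ≤ C.tops k) : (C.grow k t).shrink k h = C := by
  refine SpiralCode.ext (funext fun i => ?_) (funext fun i => funext fun j => ?_)
  · rcases eq_or_ne i (k + 1) with rfl | hi
    · rw [shrink_M_succ, grow_M_succ]; omega
    · rw [shrink_M_of_ne hi, grow_M_of_ne hi]
  · rcases eq_or_ne i k with rfl | hi
    · rw [shrink_f_self, grow_f_self, grow_M_succ]
      have := C.le i j
      have := C.f_eq_top_iff i j
      split_ifs <;> omega
    · rw [shrink_f_of_ne hi, grow_f_of_ne hi]

theorem grow_shrink (hM : 1 ≤ C.M (k + 1)) : (C.shrink k h).grow k (C.tops k) = C := by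
  refine SpiralCode.ext (funext fun i => ?_) (funext fun i => funext fun j => ?_)
  · rcases eq_or_ne i (k + 1) with rfl | hi
    · rw [grow_M_succ, shrink_M_succ]; omega
    · rw [grow_M_of_ne hi, shrink_M_of_ne hi]
  · rcases eq_or_ne i k with rfl | hi
    · rw [grow_f_self, shrink_f_self, shrink_M_succ, shrink_M_of_ne (succ_ne i).symm]
      have := C.le i j
      have := C.f_eq_top_iff i j
      split_ifs <;> omega
    · rw [grow_f_of_ne hi, shrink_f_of_ne hi]

/-- Since at least two elements of chain `k + 1` are mapped to the greatest one, the new last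
element is too. A cycle of smaller elements is not affected by the cap, so it is a cycle of `C`. -/
theorem Valid.shrink (hC : C.Valid) (ht : 2 ≤ C.tops (k + 1)) : (C.shrink k h).Valid := by
  have hM := C.tops_le (k + 1)
  rw [valid_iff] at hC ⊢
  refine ⟨fun i => ?_, fun j hj => hC.2 j fun i => ?_⟩
  · rcases eq_or_ne i k with rfl | hi
    · rw [shrink_f_self, shrink_M_succ, shrink_M_of_ne (succ_ne i).symm, hC.1]
      omega
    · rw [shrink_f_of_ne hi, shrink_M_of_ne (i := i + 1) (by simpa using hi)]
      rcases eq_or_ne i (k + 1) with rfl | hi'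
      · rw [shrink_M_succ, C.f_eq_top_iff]; omega
      · rw [shrink_M_of_ne hi', hC.1]
  · have h1 := hj i
    rcases eq_or_ne i k with rfl | hi
    · have h2 := (hj (i + 1)).1
      rw [shrink_f_self, shrink_M_of_ne (succ_ne i).symm] at h1
      rw [shrink_M_succ] at h2
      omega
    · rw [shrink_f_of_ne hi] at h1
      refine ⟨h1.1.trans_le ?_, h1.2⟩
      rcases eq_or_ne i (k + 1) with rfl | hi'
      · rw [shrink_M_succ]; omega
      · rw [shrink_M_of_ne hi']

/-- A cycle of smaller elements avoids the old greatest element of chain `k + 1`, whose image is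
still greatest; so it is already a cycle of `C`. -/
theorem Valid.grow (hC : C.Valid) (ht : 1 ≤ t) : (C.grow k t).Valid := by
  rw [valid_iff] at hC ⊢
  refine ⟨fun i => ?_, fun j hj => hC.2 j fun i => ?_⟩
  · rcases eq_or_ne i k with rfl | hi
    · rw [grow_f_self, grow_M_succ, grow_M_of_ne (succ_ne i).symm, if_pos (by omega)]
    · rw [grow_f_of_ne hi, grow_M_of_ne (i := i + 1) (by simpa using hi)]
      rcases eq_or_ne i (k + 1) with rfl | hi'
      · rw [grow_M_succ]; exact C.const _ _ (Nat.lt_succ_self _)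
      · rw [grow_M_of_ne hi', hC.1]
  · have h1 := hj i
    have h2 := (hj (i + 1)).1
    rcases eq_or_ne i k with rfl | hi
    · rw [grow_f_self, grow_M_of_ne (succ_ne i).symm] at h1
      rw [grow_M_succ] at h2
      split_ifs at h1 <;> omega
    · rw [grow_f_of_ne hi] at h1
      refine ⟨?_, h1.2⟩
      rcases eq_or_ne i (k + 1) with rfl | hi'
      · rw [grow_M_succ] at h1
        rw [grow_M_of_ne (succ_ne _)] at h2
        have := hC.1 (k + 1)
        rcases Nat.lt_succ_iff_lt_or_eq.1 h1.1 with h3 | h3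
        · exact h3
        · rw [h3] at h1; omega
      · rw [grow_M_of_ne hi'] at h1
        exact h1.1

theorem tops_shrink_succ (ht : 2 ≤ C.tops (k + 1)) :
    (C.shrink k h).tops (k + 1) = C.tops (k + 1) - 1 := by
  have hM := C.tops_le (k + 1)
  refine tops_eq ?_ fun j hj => ?_
  · rw [shrink_M_succ]; omega
  · rw [shrink_f_of_ne (succ_ne k), shrink_M_of_ne (succ_ne _), shrink_M_succ, C.f_eq_top_iff]
    omega

theorem tops_shrink_of_ne {i : Fin 4} (hi : i ≠ k) (hi' : i ≠ k + 1) :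
    (C.shrink k h).tops i = C.tops i := by
  rw [tops, shrink_f_of_ne hi, shrink_M_of_ne hi', shrink_M_of_ne (by simpa using hi), ← tops]

theorem le_tops_shrink : C.tops k ≤ (C.shrink k h).tops k := by
  by_contra! hlt
  have hle := C.tops_le k
  have h1 := ((C.shrink k h).f_eq_top_iff k (C.M k + 1 - C.tops k)).not.2 (by
    rw [shrink_M_of_ne (succ_ne k).symm]; omega)
  refine h1 ?_
  rw [shrink_f_self, shrink_M_succ, (C.f_eq_top_iff k _).2 (by omega)]
  omega

theorem tops_grow_self (ht : t ≤ C.M k + 1) : (C.grow k t).tops k = t := by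
  refine tops_eq ?_ fun j hj => ?_
  · rwa [grow_M_of_ne (succ_ne k).symm]
  · rw [grow_f_self, grow_M_succ, grow_M_of_ne (succ_ne k).symm]
    have := C.le k j
    split_ifs <;> omega

theorem tops_grow_succ : (C.grow k t).tops (k + 1) = C.tops (k + 1) + 1 := by
  have hM := C.tops_le (k + 1)
  refine tops_eq ?_ fun j hj => ?_
  · rw [grow_M_succ]; omega
  · rw [grow_f_of_ne (succ_ne k), grow_M_of_ne (succ_ne _), grow_M_succ, C.f_eq_top_iff]
    omega

theorem tops_grow_of_ne {i : Fin 4} (hi : i ≠ k) (hi' : i ≠ k + 1) :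
    (C.grow k t).tops i = C.tops i := by
  rw [tops, grow_f_of_ne hi, grow_M_of_ne hi', grow_M_of_ne (by simpa using hi), ← tops]

end

/-- If some elements lie below the greatest ones, then one of them is mapped to a greatest one. -/
theorem Valid.exists_two_le_tops (hC : C.Valid) (hM : ∑ k, C.M k ≠ 0) : ∃ k, 2 ≤ C.tops k := by
  by_contra! H
  have step : ∀ k j, j < C.M k → C.f k j < C.M (k + 1) := fun k j hj =>
    (C.le k j).lt_of_ne fun h => by
      have := (C.f_eq_top_iff k j).1 h
      have := H k
      omega
  obtain ⟨k, -, hk⟩ := Finset.exists_ne_zero_of_sum_ne_zero hM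
  have h0 := hC.2 k (C.M k - 1) (by omega)
  have h1 := step k (C.M k - 1) (by omega)
  have h2 := step _ _ h1
  rw [add_one_one] at h2
  have h3 := step _ _ h2
  rw [add_two_one] at h3
  have h4 := step _ _ h3
  rw [add_three_one] at h4
  omega

end SpiralCode

/-- The valid codes with `N + 5` nodes, in which `r k + 1` elements of chain `k` are mapped to the
greatest element. -/
def topsCodes (N : ℕ) (r : Fin 4 → ℕ) : Set SpiralCode :=
  {C ∈ validCodes N | ∀ k, C.tops k = r k + 1}

theorem finite_topsCodes (N : ℕ) (r : Fin 4 → ℕ) : (topsCodes N r).Finite :=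
  (finite_validCodes N).subset (sep_subset _ _)

theorem topsCodes_eq_empty {N : ℕ} {r : Fin 4 → ℕ} (h : N < ∑ k, r k) : topsCodes N r = ∅ := by
  rw [Set.eq_empty_iff_forall_notMem]
  rintro C ⟨⟨-, hN⟩, hr⟩
  have : ∑ k, r k ≤ ∑ k, C.M k := Finset.sum_le_sum fun k _ => by
    have := C.tops_le k
    have := hr k
    omega
  omega

theorem topsCodes_succ_zero (N : ℕ) : topsCodes (N + 1) 0 = ∅ := by
  rw [Set.eq_empty_iff_forall_notMem]
  rintro C ⟨⟨hC, hN⟩, hr⟩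
  obtain ⟨k, hk⟩ := hC.exists_two_le_tops (by omega)
  rw [hr k] at hk
  simp at hk

theorem ncard_topsCodes_zero_zero : (topsCodes 0 0).ncard = 1 := by
  rw [Set.ncard_eq_one]
  refine ⟨⟨0, 0, fun _ => monotone_const, fun _ _ => le_rfl, fun _ _ _ => rfl⟩, ?_⟩
  ext C
  rw [mem_singleton_iff]
  constructor
  · rintro ⟨⟨hC, hN⟩, hr⟩
    have hM : C.M = 0 := funext fun k => by simpa using (Finset.sum_eq_zero_iff.1 hN) k
    refine SpiralCode.ext hM (funext fun k => funext fun j => ?_)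
    have := C.le k j
    rw [hM] at this
    simpa using this
  · rintro rfl
    refine ⟨⟨⟨fun _ => rfl, fun k j hj => absurd hj (Nat.not_lt_zero j)⟩, by simp⟩, fun k => ?_⟩
    simp [SpiralCode.tops]

/-- `shrink` and `grow` are inverse to each other. Removing the greatest element of chain `k + 1`
lowers `tops (k + 1)` by one and can only raise `tops k`; the former `tops k`, known to be `r k +
1`, is all that is needed to undo it. -/
theorem ncard_topsCodes_eq (N : ℕ) (r : Fin 4 → ℕ) (k : Fin 4) :
    (topsCodes (N + 1) (r + Pi.single (k + 1) 1)).ncard =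
      {C ∈ validCodes N | (∀ i ≠ k, C.tops i = r i + 1) ∧ r k + 1 ≤ C.tops k}.ncard := by
  have hk : ∀ C ∈ topsCodes (N + 1) (r + Pi.single (k + 1) 1), C.tops k = r k + 1 := fun C hC => by
    rw [hC.2 k]; simp [(succ_ne k).symm]
  have hk' : ∀ C ∈ topsCodes (N + 1) (r + Pi.single (k + 1) 1), C.tops (k + 1) = r (k + 1) + 2 :=
    fun C hC => by rw [hC.2 (k + 1)]; simp
  have hM : ∀ C ∈ topsCodes (N + 1) (r + Pi.single (k + 1) 1), 1 ≤ C.M (k + 1) := fun C hC => by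
    have := C.tops_le (k + 1)
    have := hk' C hC
    omega
  refine Set.ncard_congr (fun C hC => C.shrink k (hC.1.1.1 (k + 1))) ?_ ?_ ?_
  · intro C hC
    refine ⟨⟨hC.1.1.shrink (by rw [hk' C hC]; omega), ?_⟩, fun i hi => ?_, ?_⟩
    · have := SpiralCode.sum_grow_M (C := C.shrink k (hC.1.1.1 (k + 1))) (k := k) (t := C.tops k)
      have hN := hC.1.2
      rw [SpiralCode.grow_shrink (hM C hC)] at this
      omega
    · rcases eq_or_ne i (k + 1) with rfl | hi'
      · rw [SpiralCode.tops_shrink_succ (by rw [hk' C hC]; omega), hk' C hC]; omega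
      · rw [SpiralCode.tops_shrink_of_ne hi hi', hC.2 i]; simp [hi']
    · rw [← hk C hC]; exact SpiralCode.le_tops_shrink
  · intro C D hC hD h
    rw [← SpiralCode.grow_shrink (C := C) (k := k) (h := hC.1.1.1 (k + 1)) (hM C hC), h,
      hk C hC, ← hk D hD, SpiralCode.grow_shrink (hM D hD)]
  · rintro C ⟨⟨hC, hN⟩, hne, hle⟩
    have hg := hC.grow (k := k) (t := r k + 1) (by omega)
    refine ⟨C.grow k (r k + 1), ⟨⟨hg, by rw [SpiralCode.sum_grow_M, hN]⟩, fun i => ?_⟩,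
      SpiralCode.shrink_grow hle⟩
    rcases eq_or_ne i k with rfl | hi
    · rw [SpiralCode.tops_grow_self (hle.trans (C.tops_le i))]; simp [(succ_ne i).symm]
    · rcases eq_or_ne i (k + 1) with rfl | hi'
      · rw [SpiralCode.tops_grow_succ, hne _ hi]; simp
      · rw [SpiralCode.tops_grow_of_ne hi hi', hne i hi]; simp [hi']

/-- Among the shrunk codes, either `tops k` equals `r k + 1`, or it is larger; the larger case is
the same bijection for `r + Pi.single k 1`. -/
theorem ncard_topsCodes_succ (N : ℕ) (r : Fin 4 → ℕ) (k : Fin 4) :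
    (topsCodes (N + 1) (r + Pi.single (k + 1) 1)).ncard = (topsCodes N r).ncard +
      (topsCodes (N + 1) (r + Pi.single k 1 + Pi.single (k + 1) 1)).ncard := by
  rw [ncard_topsCodes_eq, ncard_topsCodes_eq, ← Set.ncard_union_eq _ (finite_topsCodes N r)
    ((finite_validCodes N).subset (sep_subset _ _))]
  · congr 1
    ext C
    simp only [topsCodes, mem_union, mem_sep_iff, Pi.add_apply, Pi.single_eq_same]
    rw [← and_or_left]
    refine and_congr_right fun _ => ?_
    have e : (∀ i ≠ k, C.tops i = r i + (Pi.single k 1 : Fin 4 → ℕ) i + 1) ↔ ∀ i ≠ k, C.tops i = r i + 1 :=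
      forall₂_congr fun i hi => by simp [hi]
    have e' : (∀ i, C.tops i = r i + 1) ↔ (∀ i ≠ k, C.tops i = r i + 1) ∧ C.tops k = r k + 1 :=
      ⟨fun h => ⟨fun i _ => h i, h k⟩, fun h i => by
        rcases eq_or_ne i k with rfl | hi
        · exact h.2
        · exact h.1 i hi⟩
    rw [e, e', ← and_or_left]
    refine and_congr_right fun _ => ?_
    omega
  · rw [Set.disjoint_left]
    rintro C ⟨-, h1⟩ ⟨-, -, h2⟩
    rw [h1 k] at h2
    simp at h2

open PowerSeries in
/-- The valid codes are counted by the powers of the Catalan series. -/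
theorem ncard_topsCodes (N : ℕ) (r : Fin 4 → ℕ) :
    (topsCodes N r).ncard = coeff N ((X * catalanSeries) ^ ∑ k, r k) := by
  have zero : ∀ N s : ℕ, N < s → coeff N ((X * catalanSeries) ^ s) = 0 := fun N s h => by
    rw [mul_pow, coeff_X_pow_mul', if_neg (by omega)]
  have step : ∀ N s : ℕ, coeff (N + 1) ((X * catalanSeries) ^ (s + 1)) =
      coeff N ((X * catalanSeries) ^ s) + coeff (N + 1) ((X * catalanSeries) ^ (s + 2)) := by
    intro N s
    rw [← coeff_succ_X_mul N, ← map_add]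
    congr 1
    -- The Catalan equation for `U = t C(t)`; multiplied by `U ^ s` it matches the recurrence for
    -- codes.
    have hU : X * catalanSeries = X + (X * catalanSeries) ^ 2 := by
      conv_lhs => rw [← catalanSeries_sq_mul_X_add_one]
      ring
    calc (X * catalanSeries) ^ (s + 1) = (X * catalanSeries) ^ s * (X + (X * catalanSeries) ^ 2) := by
          rw [← hU, pow_succ]
      _ = _ := by ring
  induction N generalizing r with
  | zero =>
    rcases Nat.eq_zero_or_pos (∑ k, r k) with h | h
    · obtain rfl : r = 0 := funext fun k => by simpa using (Finset.sum_eq_zero_iff.1 h) k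
      rw [ncard_topsCodes_zero_zero]
      simp
    · rw [zero _ _ h, topsCodes_eq_empty h, Set.ncard_empty]
  | succ N ih =>
    -- The recurrence expresses a count by one with smaller `N` and one with the same `N` but larger
    -- sum of `r`. Hence the inner induction descends from sums exceeding `N + 1`, where there are
    -- no codes.
    obtain ⟨d, hd⟩ : ∃ d, N + 2 - ∑ k, r k = d := ⟨_, rfl⟩
    induction d generalizing r with
    | zero => rw [zero _ _ (by omega), topsCodes_eq_empty (by omega), Set.ncard_empty]
    | succ d ihd =>
      rcases Nat.eq_zero_or_pos (∑ k, r k) with h | h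
      · obtain rfl : r = 0 := funext fun k => by simpa using (Finset.sum_eq_zero_iff.1 h) k
        rw [topsCodes_succ_zero]
        simp
      · obtain ⟨i, -, hi⟩ := Finset.exists_ne_zero_of_sum_ne_zero h.ne'
        obtain ⟨k, rfl⟩ : ∃ k, i = k + 1 := ⟨i + 3, (add_three_one i).symm⟩
        obtain ⟨r, rfl⟩ : ∃ r' : Fin 4 → ℕ, r = r' + Pi.single (k + 1) (1 : ℕ) := by
          refine ⟨r - Pi.single (k + 1) 1, funext fun j => ?_⟩
          rcases eq_or_ne j (k + 1) with rfl | hj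
          · simp; omega
          · simp [hj]
        have s1 : ∑ j, (r + Pi.single (k + 1) 1 : Fin 4 → ℕ) j = ∑ j, r j + 1 := by
          simp [Finset.sum_add_distrib]
        have s2 : ∑ j, (r + Pi.single k 1 + Pi.single (k + 1) 1 : Fin 4 → ℕ) j = ∑ j, r j + 2 := by
          simp [Finset.sum_add_distrib]
        rw [ncard_topsCodes_succ, ih, ihd _ (by rw [s2]; omega), s1, s2, step N (∑ j, r j)]

/-! ### The generating function -/

open MvPolynomial in
/-- The generating polynomial of the valid codes by the numbers of elements that are mapped to the
greatest ones. -/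
theorem sum_ncard_mul_eq {N a K : ℕ} [NeZero K]
    (h : ∀ C ∈ validCodes N, ∀ k, a ≤ C.tops k ∧ C.tops k < a + K) :
    ∑ m : Fin 4 → Fin K, MvPolynomial.C ({C ∈ validCodes N | ∀ k, C.tops k = m k + a}.ncard : ℚ) *
        ∏ k, (X k : MvPolynomial (Fin 4) ℚ) ^ ((m k : ℕ) + a) =
      ∑ C ∈ (finite_validCodes N).toFinset, ∏ k, X k ^ C.tops k := by
  classical
  rw [← Finset.sum_fiberwise _ (fun (C : SpiralCode) (k : Fin 4) => Fin.ofNat K (C.tops k - a))]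
  refine Finset.sum_congr rfl fun m _ => ?_
  have hiff : ∀ C ∈ validCodes N, (fun k => Fin.ofNat K (C.tops k - a)) = m ↔
      ∀ k, C.tops k = m k + a := by
    intro C hC
    rw [funext_iff]
    refine forall_congr' fun k => ?_
    have := h C hC k
    rw [Fin.ext_iff, Fin.val_ofNat, Nat.mod_eq_of_lt (by omega)]
    omega
  have hset : {C ∈ validCodes N | ∀ k, C.tops k = m k + a} =
      ((finite_validCodes N).toFinset.filter fun C =>
        (fun k => Fin.ofNat K (C.tops k - a)) = m : Finset SpiralCode) := by
    ext C
    simp only [Finset.coe_filter, Set.Finite.mem_toFinset, mem_ofPred_eq]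
    exact and_congr_right fun hC => (hiff C hC).symm
  rw [hset, Set.ncard_coe_finset, Finset.sum_congr rfl (g := fun _ => ∏ k, X k ^ ((m k : ℕ) + a)),
    Finset.sum_const, nsmul_eq_mul, map_natCast]
  intro C hC
  rw [Finset.mem_filter, Set.Finite.mem_toFinset] at hC
  exact Finset.prod_congr rfl fun k _ => by rw [(hiff C hC.1).1 hC.2 k]

theorem SpiralCode.tops_le_of_mem {N : ℕ} {C : SpiralCode} (hC : C ∈ validCodes N) (k : Fin 4) :
    C.tops k ≤ N + 1 := by
  have h1 := C.tops_le k
  have h2 : C.M k ≤ ∑ i, C.M i :=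
    Finset.single_le_sum (f := C.M) (fun _ _ => Nat.zero_le _) (Finset.mem_univ k)
  have := hC.2
  omega

open MvPolynomial in
theorem coeff_simpleWhirlSeries (N : ℕ) : PowerSeries.coeff (N + 5) simpleWhirlSeries =
    ∑ C ∈ (finite_validCodes N).toFinset, ∏ k, X k ^ C.tops k := by
  rw [← sum_ncard_mul_eq (a := 0) (K := N + 5 + 1) fun C hC k => ⟨Nat.zero_le _, by
    have := SpiralCode.tops_le_of_mem hC k; omega⟩]
  rw [simpleWhirlSeries, PowerSeries.coeff_mk]
  exact Finset.sum_congr rfl fun m _ => by rw [ncard_simpleWhirlsWith]; rfl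

theorem coeff_simpleWhirlSeries_of_lt {n : ℕ} (hn : n < 5) :
    PowerSeries.coeff n simpleWhirlSeries = 0 := by
  rw [simpleWhirlSeries, PowerSeries.coeff_mk]
  refine Finset.sum_eq_zero fun m _ => ?_
  have := (simpleWhirlsWith_subset n fun k => m k).trans_eq (simpleWhirls_eq_empty hn)
  rw [Set.subset_empty_iff.1 this]
  simp

/-- The series `t C(t)`, where `C` is the Catalan series. -/
noncomputable def shiftedCatalan : PowerSeries (MvPolynomial (Fin 4) ℚ) :=
  PowerSeries.map (Nat.castRingHom _) (PowerSeries.X * PowerSeries.catalanSeries)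

theorem shiftedCatalan_eq :
    shiftedCatalan = PowerSeries.X * PowerSeries.map (Nat.castRingHom _) PowerSeries.catalanSeries := by
  rw [shiftedCatalan, map_mul, PowerSeries.map_X]

theorem constantCoeff_shiftedCatalan : PowerSeries.constantCoeff shiftedCatalan = 0 := by
  rw [shiftedCatalan_eq, map_mul, PowerSeries.constantCoeff_X, zero_mul]

theorem shiftedCatalan_mul_one_sub : shiftedCatalan * (1 - shiftedCatalan) = PowerSeries.X := by
  have h := congrArg (PowerSeries.map (Nat.castRingHom (MvPolynomial (Fin 4) ℚ)))
    PowerSeries.catalanSeries_sq_mul_X_add_one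
  simp only [map_add, map_mul, map_pow, PowerSeries.map_X, map_one] at h
  rw [shiftedCatalan_eq]
  linear_combination -PowerSeries.X * h

/-- The quotient of the generating function by `t ^ 5`. -/
noncomputable def whirlQuotient : PowerSeries (MvPolynomial (Fin 4) ℚ) :=
  PowerSeries.mk fun N => PowerSeries.coeff (N + 5) simpleWhirlSeries

theorem simpleWhirlSeries_eq : simpleWhirlSeries = PowerSeries.X ^ 5 * whirlQuotient := by
  ext1 n
  rw [PowerSeries.coeff_X_pow_mul']
  split_ifs with h
  · rw [whirlQuotient, PowerSeries.coeff_mk, Nat.sub_add_cancel h]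
  · exact coeff_simpleWhirlSeries_of_lt (by omega)

-- The counts depend on `r` only through its sum, so the sum over `r` factors into four geometric
-- sums. Truncation at `L > N` is harmless because `tops k ≤ N + 1`.
open MvPolynomial in
theorem coeff_whirlQuotient {N L : ℕ} (hL : N < L) : PowerSeries.coeff N whirlQuotient =
    PowerSeries.coeff N (∏ k, ∑ r : Fin L, xvar k ^ ((r : ℕ) + 1) * shiftedCatalan ^ (r : ℕ)) := by
  have : NeZero L := ⟨by omega⟩
  rw [whirlQuotient, PowerSeries.coeff_mk, coeff_simpleWhirlSeries,
    ← sum_ncard_mul_eq (a := 1) (K := L) fun C hC k => ⟨hC.1.one_le_tops k, by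
      have := SpiralCode.tops_le_of_mem hC k; omega⟩, Fintype.prod_sum, map_sum]
  refine Finset.sum_congr rfl fun m _ => ?_
  have e : ∏ k, xvar k ^ ((m k : ℕ) + 1) * shiftedCatalan ^ (m k : ℕ) =
      PowerSeries.C (∏ k, X k ^ ((m k : ℕ) + 1)) * PowerSeries.map (Nat.castRingHom _)
        ((PowerSeries.X * PowerSeries.catalanSeries) ^ ∑ k, (m k : ℕ)) := by
    rw [Finset.prod_mul_distrib, Finset.prod_pow_eq_pow_sum, map_pow, shiftedCatalan, map_prod]
    simp only [xvar, map_pow]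
  rw [e, PowerSeries.coeff_C_mul, PowerSeries.coeff_map, ← ncard_topsCodes, mul_comm]
  simp only [topsCodes, map_natCast, eq_natCast]

/-- The generating function as a rational function of `t C(t)`. -/
theorem whirlQuotient_mul :
    whirlQuotient * ∏ k, (1 - xvar k * shiftedCatalan) = ∏ k, xvar k := by
  ext1 N
  have e : PowerSeries.coeff N (whirlQuotient * ∏ k, (1 - xvar k * shiftedCatalan)) =
      PowerSeries.coeff N ((∏ k, ∑ r : Fin (N + 1),
        xvar k ^ ((r : ℕ) + 1) * shiftedCatalan ^ (r : ℕ)) *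
          ∏ k, (1 - xvar k * shiftedCatalan)) := by
    rw [PowerSeries.coeff_mul, PowerSeries.coeff_mul]
    refine Finset.sum_congr rfl fun p hp => ?_
    rw [Finset.HasAntidiagonal.mem_antidiagonal] at hp
    rw [coeff_whirlQuotient (L := N + 1) (by omega)]
  rw [e, ← Finset.prod_mul_distrib]
  have geom : ∀ k, (∑ r : Fin (N + 1), xvar k ^ ((r : ℕ) + 1) * shiftedCatalan ^ (r : ℕ)) *
      (1 - xvar k * shiftedCatalan) = xvar k * (1 - (xvar k * shiftedCatalan) ^ (N + 1)) := by
    intro k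
    rw [← geom_sum_mul_neg, ← mul_assoc, Finset.mul_sum, ← Fin.sum_univ_eq_sum_range
      (fun r => xvar k * (xvar k * shiftedCatalan) ^ r)]
    congr 1
    exact Finset.sum_congr rfl fun r _ => by ring
  -- The error terms of the truncated geometric series contain `U ^ (N + 1)`, and `U` is divisible
  -- by `t`; they do not affect the coefficient of `t ^ N`.
  have dvd : (PowerSeries.X : PowerSeries (MvPolynomial (Fin 4) ℚ)) ^ (N + 1) ∣
      ∏ k, xvar k * (1 - (xvar k * shiftedCatalan) ^ (N + 1)) - ∏ k, xvar k := by
    have : ∀ k, ∃ y, (xvar k * shiftedCatalan) ^ (N + 1) = PowerSeries.X ^ (N + 1) * y := fun k =>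
      ⟨(xvar k * PowerSeries.map (Nat.castRingHom _) PowerSeries.catalanSeries) ^ (N + 1), by
        rw [shiftedCatalan_eq]; ring⟩
    choose y hy using this
    simp only [hy, Fin.prod_univ_four]
    generalize (PowerSeries.X : PowerSeries (MvPolynomial (Fin 4) ℚ)) ^ (N + 1) = T
    exact ⟨xvar 0 * xvar 1 * xvar 2 * xvar 3 * (-y 0 * (1 - T * y 1) * (1 - T * y 2) * (1 - T * y 3)
      - y 1 * (1 - T * y 2) * (1 - T * y 3) - y 2 * (1 - T * y 3) - y 3), by ring⟩
  have := PowerSeries.X_pow_dvd_iff.1 dvd N (Nat.lt_succ_self N)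
  rw [map_sub, sub_eq_zero] at this
  simp only [geom, this]

/-! ### Conjugate denominators and the closed form -/

theorem esym_one : esym 1 = xvar 0 + xvar 1 + xvar 2 + xvar 3 := by
  simp only [esym, xvar, MvPolynomial.esymm_one, Fin.sum_univ_four, map_add]

theorem esym_two : esym 2 = xvar 0 * xvar 1 + xvar 0 * xvar 2 + xvar 0 * xvar 3 +
    xvar 1 * xvar 2 + xvar 1 * xvar 3 + xvar 2 * xvar 3 := by
  have : Finset.powersetCard 2 (Finset.univ : Finset (Fin 4)) =
    {{0, 1}, {0, 2}, {0, 3}, {1, 2}, {1, 3}, {2, 3}} := by decide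
  rw [esym, MvPolynomial.esymm, this]
  iterate 5 rw [Finset.sum_insert (by decide)]
  rw [Finset.sum_singleton]
  iterate 6 rw [Finset.prod_pair (by decide)]
  simp only [xvar, map_add, map_mul, add_assoc]

theorem esym_three : esym 3 = xvar 0 * xvar 1 * xvar 2 + xvar 0 * xvar 1 * xvar 3 +
    xvar 0 * xvar 2 * xvar 3 + xvar 1 * xvar 2 * xvar 3 := by
  have : Finset.powersetCard 3 (Finset.univ : Finset (Fin 4)) =
    {{0, 1, 2}, {0, 1, 3}, {0, 2, 3}, {1, 2, 3}} := by decide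
  rw [esym, MvPolynomial.esymm, this]
  iterate 3 rw [Finset.sum_insert (by decide)]
  rw [Finset.sum_singleton]
  iterate 4 rw [Finset.prod_insert (by decide), Finset.prod_pair (by decide)]
  simp only [xvar, map_add, map_mul, add_assoc, mul_assoc]

theorem esym_four : esym 4 = ∏ k, xvar k := by
  have : Finset.powersetCard 4 (Finset.univ : Finset (Fin 4)) = {Finset.univ} := by decide
  rw [esym, MvPolynomial.esymm, this, Finset.sum_singleton, map_prod]
  rfl

/-- The conjugate of the denominator `∏ (1 - xₖ t C(t))`. -/
noncomputable def whirlConjugate : PowerSeries (MvPolynomial (Fin 4) ℚ) :=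
  ∏ k, (1 - xvar k * (1 - shiftedCatalan))

/-- Factor by factor, `(1 - x U) (1 - x (1 - U)) = 1 - x + x² U (1 - U)` and `U (1 - U) = t`. -/
theorem whirlAlpha_eq :
    whirlAlpha = (∏ k, (1 - xvar k * shiftedCatalan)) * whirlConjugate := by
  rw [whirlAlpha, whirlConjugate, ← Finset.prod_mul_distrib]
  refine Finset.prod_congr rfl fun k _ => ?_
  rw [← shiftedCatalan_mul_one_sub]
  ring

theorem whirlBeta_eq :
    whirlBeta = (∏ k, (1 - xvar k * shiftedCatalan) + whirlConjugate) * esym 4 := by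
  rw [whirlBeta, whirlConjugate, ← shiftedCatalan_mul_one_sub]
  congr 1
  rw [esym_one, esym_two, esym_three, esym_four]
  simp only [Fin.prod_univ_four]
  ring

theorem whirlAlpha_mul_whirlQuotient : whirlAlpha * whirlQuotient = whirlConjugate * esym 4 := by
  rw [whirlAlpha_eq, esym_four, ← whirlQuotient_mul]
  ring

theorem constantCoeff_xvar (k : Fin 4) :
    PowerSeries.constantCoeff (xvar k) = MvPolynomial.X k := by simp [xvar]

theorem constantCoeff_whirlAlpha :
    PowerSeries.constantCoeff whirlAlpha = ∏ k, (1 - MvPolynomial.X k) := by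
  simp [whirlAlpha, constantCoeff_xvar]

theorem two_mul_whirlAlpha_ne_zero : 2 * whirlAlpha ≠ 0 := fun h => by
  have := congrArg (fun s => MvPolynomial.eval 0 (PowerSeries.constantCoeff s)) h
  simp only [map_mul, map_ofNat, constantCoeff_whirlAlpha, map_zero] at this
  simp at this

/-- The quotient of `F` by `t⁵` is `e₄` over the denominator; with its conjugate it forms the two
roots of `α Y² - β Y + e₄²`. The polynomial used is this one rescaled by `t⁵`, with leading
coefficient `α ≠ 0`. -/
theorem isAlgebraic_simpleWhirlSeries :
    IsAlgebraic (Polynomial (MvPolynomial (Fin 4) ℚ)) simpleWhirlSeries := by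
  have hX : algebraMap (Polynomial (MvPolynomial (Fin 4) ℚ))
      (PowerSeries (MvPolynomial (Fin 4) ℚ)) Polynomial.X = PowerSeries.X := by
    simp [PowerSeries.algebraMap_apply']
  have hC : ∀ p, algebraMap (Polynomial (MvPolynomial (Fin 4) ℚ))
      (PowerSeries (MvPolynomial (Fin 4) ℚ)) (Polynomial.C p) = PowerSeries.C p := by
    simp [PowerSeries.algebraMap_apply']
  obtain ⟨a, ha⟩ : ∃ a, algebraMap (Polynomial (MvPolynomial (Fin 4) ℚ))
      (PowerSeries (MvPolynomial (Fin 4) ℚ)) a = whirlAlpha :=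
    ⟨∏ k, (1 - Polynomial.C (MvPolynomial.X k) +
      Polynomial.X * Polynomial.C (MvPolynomial.X k) ^ 2), by
      simp only [whirlAlpha, map_prod, map_add, map_sub, map_one, map_mul, map_pow, hX, hC, xvar]⟩
  let e (m : ℕ) : Polynomial (MvPolynomial (Fin 4) ℚ) :=
    Polynomial.C (MvPolynomial.esymm (Fin 4) ℚ m)
  obtain ⟨b, hb⟩ : ∃ b, algebraMap (Polynomial (MvPolynomial (Fin 4) ℚ))
      (PowerSeries (MvPolynomial (Fin 4) ℚ)) b = whirlBeta :=
    ⟨(2 * e 4 * Polynomial.X ^ 2 - Polynomial.X * (4 * e 4 - 3 * e 3 + 2 * e 2)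
      + e 4 - e 3 + e 2 - e 1 + 2) * e 4, by
      simp only [whirlBeta, map_add, map_sub, map_mul, map_pow, hX, hC, e, esym, map_ofNat]⟩
  have h4 : algebraMap (Polynomial (MvPolynomial (Fin 4) ℚ))
      (PowerSeries (MvPolynomial (Fin 4) ℚ)) (e 4) = esym 4 := hC _
  refine ⟨Polynomial.C a * Polynomial.X ^ 2 - Polynomial.C (Polynomial.X ^ 5 * b) * Polynomial.X +
    Polynomial.C (Polynomial.X ^ 10 * e 4 ^ 2), fun h => right_ne_zero_of_mul two_mul_whirlAlpha_ne_zero ?_, ?_⟩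
  · have key : ∀ a b c : Polynomial (MvPolynomial (Fin 4) ℚ),
        (Polynomial.C a * Polynomial.X ^ 2 - Polynomial.C b * Polynomial.X +
          Polynomial.C c).coeff 2 = a := fun a b c => by simp
    rw [← ha, ← key a (Polynomial.X ^ 5 * b) (Polynomial.X ^ 10 * e 4 ^ 2), h,
      Polynomial.coeff_zero, map_zero]
  · simp only [map_add, map_sub, map_mul, map_pow, Polynomial.aeval_C, Polynomial.aeval_X, ha, hb,
      hX, h4]
    have h1 := whirlAlpha_mul_whirlQuotient
    have h2 := whirlQuotient_mul
    rw [← esym_four] at h2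
    rw [simpleWhirlSeries_eq, whirlBeta_eq]
    linear_combination PowerSeries.X ^ 10 * whirlQuotient * h1 -
      PowerSeries.X ^ 10 * esym 4 * h2

/-- At `xₖ = 1` the denominator becomes `(1 - t C) ^ 4`, and `C (1 - t C) = 1`. -/
theorem map_simpleWhirlSeries :
    PowerSeries.map (MvPolynomial.eval fun _ => (1 : ℚ)) simpleWhirlSeries =
      PowerSeries.X ^ 5 *
        PowerSeries.map (Nat.castRingHom ℚ) PowerSeries.catalanSeries ^ 4 := by
  rw [simpleWhirlSeries_eq, map_mul, map_pow, PowerSeries.map_X]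
  congr 1
  have hx : ∀ k, PowerSeries.map (MvPolynomial.eval fun _ => (1 : ℚ)) (xvar k) = 1 := by
    simp [xvar]
  have hU : PowerSeries.map (MvPolynomial.eval fun _ => (1 : ℚ)) shiftedCatalan =
      PowerSeries.X * PowerSeries.map (Nat.castRingHom ℚ) PowerSeries.catalanSeries := by
    rw [shiftedCatalan_eq, map_mul, PowerSeries.map_X]
    congr 1
    ext n
    simp
  have h := congrArg (PowerSeries.map (MvPolynomial.eval fun _ => (1 : ℚ))) whirlQuotient_mul
  simp only [map_mul, map_sub, map_one, hx, hU, Fin.prod_univ_four, one_mul, mul_one] at h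
  have hc := congrArg (PowerSeries.map (Nat.castRingHom ℚ))
    PowerSeries.catalanSeries_sq_mul_X_add_one
  simp only [map_add, map_mul, map_pow, PowerSeries.map_X, map_one] at hc
  generalize PowerSeries.map (Nat.castRingHom ℚ) PowerSeries.catalanSeries = c at *
  generalize PowerSeries.map (MvPolynomial.eval fun _ => (1 : ℚ)) whirlQuotient = q at *
  have hinv : c * (1 - PowerSeries.X * c) = 1 := by linear_combination -hc
  calc q = q * (c * (1 - PowerSeries.X * c)) ^ 4 := by rw [hinv, one_pow, mul_one]
    _ = (q * ((1 - PowerSeries.X * c) * (1 - PowerSeries.X * c) * (1 - PowerSeries.X * c) *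
        (1 - PowerSeries.X * c))) * c ^ 4 := by ring
    _ = c ^ 4 := by rw [h, one_mul]

theorem simpleWhirlCountSeries_eq : simpleWhirlCountSeries =
    PowerSeries.map (MvPolynomial.eval fun _ => (1 : ℚ)) simpleWhirlSeries := by
  ext n
  rw [PowerSeries.coeff_map, simpleWhirlCountSeries, PowerSeries.coeff_mk]
  rcases lt_or_ge n 5 with hn | hn
  · rw [coeff_simpleWhirlSeries_of_lt hn, simpleWhirls_eq_empty hn]
    simp
  · obtain ⟨N, rfl⟩ := Nat.exists_eq_add_of_le' hn
    rw [coeff_simpleWhirlSeries, ncard_simpleWhirls,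
      Set.ncard_eq_toFinset_card _ (finite_validCodes N)]
    simp

theorem mainTheorem3 :
    -- there are finitely many simple whirls of each size
    (∀ n : ℕ, (simpleWhirls n).Finite) ∧
    -- the multivariate generating function is algebraic
    IsAlgebraic (Polynomial (MvPolynomial (Fin 4) ℚ)) simpleWhirlSeries ∧
    -- the closed form, `S` being the square root of `β ^ 2 - 4 α e₄ ^ 2`
    (∃ S : PowerSeries (MvPolynomial (Fin 4) ℚ),
      S ^ 2 = whirlBeta ^ 2 - 4 * whirlAlpha * esym 4 ^ 2 ∧
      PowerSeries.constantCoeff S =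
        MvPolynomial.esymm (Fin 4) ℚ 4 * (1 - ∏ k, (1 - MvPolynomial.X k)) ∧
      2 * whirlAlpha ≠ 0 ∧
      2 * whirlAlpha * simpleWhirlSeries = PowerSeries.X ^ 5 * (whirlBeta - S)) ∧
    -- `F(t) = F(t,1,1,1,1) = t ^ 5 C(t) ^ 4`
    simpleWhirlCountSeries =
      PowerSeries.map (MvPolynomial.eval fun _ => (1 : ℚ)) simpleWhirlSeries ∧
    PowerSeries.map (MvPolynomial.eval fun _ => (1 : ℚ)) simpleWhirlSeries =
      PowerSeries.X ^ 5 *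
        PowerSeries.map (Nat.castRingHom ℚ) PowerSeries.catalanSeries ^ 4 := by
  refine ⟨finite_simpleWhirls, isAlgebraic_simpleWhirlSeries, ?_, simpleWhirlCountSeries_eq,
    map_simpleWhirlSeries⟩
  -- The square root is `e₄` times the difference of the conjugate denominators. The order is fixed
  -- by the constant term: at `t = 0` one has `U = 0`, so the denominator is 1 and its conjugate is
  -- `∏ (1 - xₖ)`.
  refine ⟨(∏ k, (1 - xvar k * shiftedCatalan) - whirlConjugate) * esym 4, ?_, ?_,
    two_mul_whirlAlpha_ne_zero, ?_⟩
  · rw [whirlBeta_eq, whirlAlpha_eq]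
    ring
  · simp [whirlConjugate, constantCoeff_xvar, constantCoeff_shiftedCatalan, esym, mul_comm]
  · rw [simpleWhirlSeries_eq, whirlBeta_eq]
    linear_combination 2 * PowerSeries.X ^ 5 * whirlAlpha_mul_whirlQuotient
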